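/- **Conventions.** In a small category $\mathcal C$, morphisms are composed from left to right; $\mathcal C_{x\to\cdot}$ and $\mathcal C_{\cdot\to x}$ are the sets of morphisms with source, respectively target, $x$. An atom is a non-identity morphism that is not a product of two non-identity morphisms. A *categorical Garside structure* is a pair $(\mathcal C,\Delta)$ where $\mathcal C$ is a small category with an automorphism $\Phi$ and $\Delta$ is a natural transformation $\mathrm{Id}_{\mathcal C}\to\Phi$, such that: every sequence of morphisms each of which is a factor of the preceding one is eventually constant; $\mathcal C$ is left and right cancellative; for every object $x$, left-divisibility is a lattice order on $\mathcal C_{x\to\cdot}$ and right-divisibility is a lattice order on $\mathcal C_{\cdot\to x}$; and for every atom $v\colon x\to y$ there is $\bar v\colon y\to\Phi(x)$ with $v\bar v=\Delta(x)$ and $\bar v\,\Phi(v)=\Delta(y)$. Then $\mathcal C$ is a *Garside category*, and the *associated Garside groupoid* is the groupoid $\mathcal G(\mathcal C)$ of formal inverses of $\mathcal C$ (obtained by formally inverting all morphisms). If $\mathcal C=A^+$ is a monoid, viewed as a category with one object, we speak of a *Garside monoid* $A^+$ with Garside element $\Delta\in A^+$, and of the *Garside group* $A=\mathcal G(A^+)$,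 with canonical morphism $\iota\colon A^+\to A$. For a monoid $M$, the category $\langle M\rangle$ has the submonoids of $M$ as objects; a morphism $P\to Q$ is an element $\delta\in M$ for which there is an isomorphism $\varphi\colon P\to Q$ with $p\,\delta=\delta\,\varphi(p)$ for all $p\in P$; composition is the product of $M$. Let $(A^+,\Delta)$ be a Garside monoid with its Garside element. A submonoid $P$ of $A^+$ is *parabolic* if it is a sublattice of $A^+$ for both left- and right-divisibility and there is $\delta\in\langle A^+\rangle_{P\to P}$ such that $$[1,\delta]=[1,\Delta]\cap P=\{\Delta\wedge p: p\in P\},$$ where intervals and gcds are taken in $A^+$ for left-divisibility. The *positive ribbon category* $\mathcal R^+(A^+)$ is the full subcategory of $\langle A^+\rangle$ whose objects are the parabolic submonoids. The *ribbon groupoid* $\mathcal R(A)$ has as objects the standard parabolic subgroups, i.e. the subgroups $\mathcal G(P)$ of $A$ generated by $\iota(P)$ for $P$ a parabolic submonoid (one has $\iota(P)=\mathcal G(P)\cap\iota(A^+)$); its morphisms $\mathcal G(P)\to\mathcal G(Q)$ are the elements of $A$ that are morphisms in $\langle A\rangle$ both from $\mathcal G(P)$ to $\mathcal G(Q)$ and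 from $\iota(P)$ to $\iota(Q)$. Let $S$ be the set of atoms of $A^+$. The monoid $A^+$ *has a $\nu$-function* if for each parabolic submonoid $P$ there is a map $\nu_P\colon S\to\mathcal R^+(A^+)_{P\to\cdot}$ such that (1) each $\nu_P(s)$ is an atom of $\mathcal R^+(A^+)$; (2) if $s\in S$ left-divides $g\in\mathcal R^+(A^+)_{P\to\cdot}$, then $\nu_P(s)$ left-divides $g$; (3) for all $s,t\in S$ the lcm of $\nu_P(s)$ and $\nu_P(t)$ for left-divisibility lies in $\mathcal R^+(A^+)_{P\to\cdot}$. It *has a $\tilde\nu$-function* if the same holds with maps $\tilde\nu_P\colon S\to\mathcal R^+(A^+)_{\cdot\to P}$, with $\mathcal R^+(A^+)_{\cdot\to P}$ in place of $\mathcal R^+(A^+)_{P\to\cdot}$ and right-divisibility in place of left-divisibility. It *has a $\nu$-structure* if it has both. **Theorem.** Let $(A^+,\Delta)$ be a Garside monoid that has a $\nu$-structure, and let $A$ be its Garside group. Then: 1. $\mathcal R^+(A^+)$ is a Garside category; more precisely, it is one for the natural transformation whose component at each parabolic submonoid $P$ is the morphism given by the element $\Delta$. 2. $\mathcal R(A)$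 is the associated Garside groupoid: $P\mapsto\mathcal G(P)$, $\delta\mapsto\iota(\delta)$ defines a functor $\mathcal R^+(A^+)\to\mathcal R(A)$, and the functor $\mathcal G(\mathcal R^+(A^+))\to\mathcal R(A)$ that it induces is an isomorphism of groupoids. This applies in particular to Artin–Tits groups of spherical type: for every Coxeter matrix $(m_{s,t})_{s,t\in S}$ with $S$ finite and finite Coxeter group $W$, let $A^+$ be the Artin–Tits monoid and let $\Delta\in A^+$ be the product of the letters of any reduced word of the longest element of $W$ (it does not depend on the word). Then $(A^+,\Delta)$ is a Garside monoid, its Garside group is the Artin–Tits group (canonically, by the identity on generators), and $A^+$ has a $\nu$-structure; hence 1 and 2 hold for it. -/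

import Mathlib

open CategoryTheory

namespace RibbonGarside

universe v u v' u'

/-! ### Joins, meets and lattices for a binary relation -/

/-- `m` is a least upper bound of `a` and `b` for the relation `r`. -/
def IsJoin {α : Type u} (r : α → α → Prop) (a b m : α) : Prop :=
  r a m ∧ r b m ∧ ∀ c, r a c → r b c → r m c

/-- `m` is a greatest lower bound of `a` and `b` for the relation `r`. -/
def IsMeet {α : Type u} (r : α → α → Prop) (a b m : α) : Prop :=
  r m a ∧ r m b ∧ ∀ c, r c a → r c b → r c m

/-- The relation `r` is a partial order for which any two elements have a least upper bound and a
greatest lower bound. -/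
def IsLatticeOrder {α : Type u} (r : α → α → Prop) : Prop :=
  (∀ a, r a a) ∧ (∀ a b, r a b → r b a → a = b) ∧ (∀ a b c, r a b → r b c → r a c) ∧
    ∀ a b, (∃ m, IsJoin r a b m) ∧ ∃ m, IsMeet r a b m

/-! ### Garside categories

Composition `f ≫ g` is written in diagrammatic order ("first `f`, then `g`"). -/

section GarsideCategory

variable {C : Type u} [Category.{v} C]

/-- The morphism `f` is an identity morphism (in particular its source and target are equal). -/
inductive IsIdentity : ∀ {x y : C}, (x ⟶ y) → Prop
  | id (x : C) : IsIdentity (𝟙 x)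

/-- An atom: a non-identity morphism that is not a product of two non-identity morphisms. -/
def IsAtomMor {x y : C} (f : x ⟶ y) : Prop :=
  ¬ IsIdentity f ∧
    ∀ (z : C) (g : x ⟶ z) (h : z ⟶ y), g ≫ h = f → IsIdentity g ∨ IsIdentity h

/-- The morphism `w` is a factor of the morphism `w'`. -/
def IsFactor (w w' : Arrow C) : Prop :=
  ∃ (w₁ : w'.left ⟶ w.left) (w₂ : w.right ⟶ w'.right), w'.hom = w₁ ≫ w.hom ≫ w₂

variable (C) in
/-- Every sequence of morphisms in which each term is a factor of the preceding one is eventually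
constant. Equality in `Arrow C` is equality of morphisms, including source and target. -/
def IsNoetherianCat : Prop :=
  ∀ w : ℕ → Arrow C, (∀ i, IsFactor (w (i + 1)) (w i)) → ∃ N, ∀ i, N ≤ i → w i = w N

variable (C) in
/-- Left and right cancellativity. -/
def IsCancellativeCat : Prop :=
  ∀ ⦃x y : C⦄ (f : x ⟶ y), Epi f ∧ Mono f

/-- The set of morphisms with source `x`. -/
abbrev MorFrom (x : C) : Type max u v := Σ y : C, (x ⟶ y)

/-- The set of morphisms with target `x`. -/
abbrev MorTo (x : C) : Type max u v := Σ y : C, (y ⟶ x)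

/-- Left-divisibility on the set of morphisms with source `x`. -/
def LeftDivides {x : C} (f g : MorFrom x) : Prop :=
  ∃ h : f.1 ⟶ g.1, f.2 ≫ h = g.2

/-- Right-divisibility on the set of morphisms with target `x`. -/
def RightDivides {x : C} (f g : MorTo x) : Prop :=
  ∃ h : g.1 ⟶ f.1, h ≫ f.2 = g.2

/-- A functor that is an isomorphism of categories in the strict sense (bijective on objects and
on morphisms), not merely an equivalence. -/
def IsIsomorphism {D : Type u'} [Category.{v'} D] (F : C ⥤ D) : Prop :=
  ∃ G : D ⥤ C, F ⋙ G = 𝟭 C ∧ G ⋙ F = 𝟭 D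

/-- `(C, Δ)` is a categorical Garside structure, with associated automorphism `Φ`. -/
structure IsGarsideStructure (Φ : C ⥤ C) (Δ : 𝟭 C ⟶ Φ) : Prop where
  automorphism : IsIsomorphism Φ
  noetherian : IsNoetherianCat C
  cancellative : IsCancellativeCat C
  left_lattice : ∀ x : C, IsLatticeOrder (LeftDivides (x := x))
  right_lattice : ∀ x : C, IsLatticeOrder (RightDivides (x := x))
  atom_simple : ∀ ⦃x y : C⦄ (f : x ⟶ y), IsAtomMor f →
    ∃ g : y ⟶ Φ.obj x, f ≫ g = Δ.app x ∧ g ≫ Φ.map f = Δ.app y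

end GarsideCategory

/-! ### Monoids as categories with one object -/

section Monoid

variable {M : Type u} [Monoid M]

/-- The category with one object whose morphisms are the elements of `M`. -/
def OneObj (_M : Type u) : Type := Unit

/-- The composition is the product of `M`, in the same order. -/
instance : Category.{u} (OneObj M) where
  Hom _ _ := M
  id _ := (1 : M)
  comp f g := ((f : M) * (g : M) : M)
  id_comp f := one_mul (f : M)
  comp_id f := mul_one (f : M)
  assoc f g h := mul_assoc (f : M) (g : M) (h : M)

/-- The unique object. -/
def OneObj.star (M : Type u) : OneObj M := Unit.unit

/-- The morphism given by an element of `M`. -/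
def OneObj.hom (a : M) : OneObj.star M ⟶ OneObj.star M := a

/-- The element of `M` given by a morphism. -/
def OneObj.val {x y : OneObj M} (f : x ⟶ y) : M := f

/-- `(M, Δ)` is a monoidal Garside structure: a categorical Garside structure with one object. -/
def IsGarsideMonoid (M : Type u) [Monoid M] (Δ : M) : Prop :=
  ∃ (Φ : OneObj M ⥤ OneObj M) (D : 𝟭 (OneObj M) ⟶ Φ),
    IsGarsideStructure Φ D ∧ OneObj.val (D.app (OneObj.star M)) = Δ

/-- The set of atoms of the monoid `M`. -/
abbrev Atoms (M : Type u) [Monoid M] : Type u := {s : M // IsAtomMor (OneObj.hom s)}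

/-- Left-divisibility in `M`: `b = a * c` for some `c`. -/
def LeftDvd (a b : M) : Prop := ∃ c, b = a * c

/-- Right-divisibility in `M`: `b = c * a` for some `c`. -/
def RightDvd (a b : M) : Prop := ∃ c, b = c * a

/-! ### The category of subcategories of a monoid

The non-empty subcategories of a category with one object are the submonoids. -/

/-- `δ` is a natural transformation from the inclusion of `P` to the inclusion of `Q` composed with
some isomorphism `φ : P → Q`. -/
def Conjugates (P Q : Submonoid M) (δ : M) : Prop :=
  ∃ φ : P ≃* Q, ∀ p : P, (p : M) * δ = δ * (φ p : M)

theorem Conjugates.one (P : Submonoid M) : Conjugates P P 1 :=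
  ⟨MulEquiv.refl _, fun p => by simp⟩

theorem Conjugates.mul {P Q R : Submonoid M} {a b : M} (ha : Conjugates P Q a)
    (hb : Conjugates Q R b) : Conjugates P R (a * b) := by
  obtain ⟨φ, hφ⟩ := ha
  obtain ⟨ψ, hψ⟩ := hb
  refine ⟨φ.trans ψ, fun p => ?_⟩
  rw [← mul_assoc, hφ, mul_assoc, hψ, mul_assoc]
  rfl

theorem Conjugates.inv {G : Type u} [Group G] {P Q : Submonoid G} {a : G}
    (ha : Conjugates P Q a) : Conjugates Q P a⁻¹ := by
  obtain ⟨φ, hφ⟩ := ha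
  refine ⟨φ.symm, fun q => ?_⟩
  have h := hφ (φ.symm q)
  rw [MulEquiv.apply_symm_apply] at h
  rw [eq_inv_mul_iff_mul_eq, ← mul_assoc, ← h, mul_assoc, mul_inv_cancel, mul_one]

/-- An object of the category of subcategories of `M`. -/
structure SubCat (M : Type u) [Monoid M] where
  /-- the underlying submonoid -/
  sub : Submonoid M

/-- A morphism of the category of subcategories of `M`. -/
@[ext]
structure SubCat.Hom (P Q : SubCat M) where
  /-- the underlying element of the monoid -/
  elt : M
  conj : Conjugates P.sub Q.sub elt

instance : Category.{u} (SubCat M) where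
  Hom P Q := SubCat.Hom P Q
  id _ := ⟨1, Conjugates.one _⟩
  comp f g := ⟨f.elt * g.elt, f.conj.mul g.conj⟩
  id_comp f := SubCat.Hom.ext (one_mul f.elt)
  comp_id f := SubCat.Hom.ext (mul_one f.elt)
  assoc f g h := SubCat.Hom.ext (mul_assoc f.elt g.elt h.elt)

/-! ### Parabolic submonoids and the positive ribbon category -/

/-- `P` is a parabolic submonoid of `M`, with respect to the Garside element `Δ`: it is a sublattice
for both divisibilities, and there is an endomorphism `δ` of `P` in the category of subcategories
with `[1, δ] = [1, Δ] ∩ P = Δ ∧ P`. -/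
structure IsParabolic (Δ : M) (P : Submonoid M) : Prop where
  left_join : ∀ a ∈ P, ∀ b ∈ P, ∀ m, IsJoin LeftDvd a b m → m ∈ P
  left_meet : ∀ a ∈ P, ∀ b ∈ P, ∀ m, IsMeet LeftDvd a b m → m ∈ P
  right_join : ∀ a ∈ P, ∀ b ∈ P, ∀ m, IsJoin RightDvd a b m → m ∈ P
  right_meet : ∀ a ∈ P, ∀ b ∈ P, ∀ m, IsMeet RightDvd a b m → m ∈ P
  exists_garside : ∃ δ : M, Conjugates P P δ ∧
    {g : M | LeftDvd g δ} = {g : M | LeftDvd g Δ} ∩ (P : Set M) ∧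
    {g : M | LeftDvd g Δ} ∩ (P : Set M) = {g : M | ∃ p ∈ P, IsMeet LeftDvd Δ p g}

/-- The positive ribbon category: the full subcategory of the category of subcategories whose
objects are the parabolic submonoids. -/
abbrev PositiveRibbon (Δ : M) : Type u :=
  ObjectProperty.FullSubcategory (fun P : SubCat M => IsParabolic Δ P.sub)

/-- The element of the monoid underlying a morphism of the positive ribbon category. -/
def PositiveRibbon.elt {Δ : M} {P Q : PositiveRibbon Δ} (f : P ⟶ Q) : M := f.hom.elt

/-! ### The ν-structures -/

/-- `M` has a `ν`-function. -/
def HasNuFunction (Δ : M) : Prop :=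
  ∀ P : PositiveRibbon Δ, ∃ ν : Atoms M → MorFrom P,
    (∀ s, IsAtomMor (ν s).2) ∧
    (∀ (s : Atoms M) (g : MorFrom P), LeftDvd s.1 (PositiveRibbon.elt g.2) →
      LeftDvd (PositiveRibbon.elt (ν s).2) (PositiveRibbon.elt g.2)) ∧
    (∀ (s t : Atoms M) (m : M),
      IsJoin LeftDvd (PositiveRibbon.elt (ν s).2) (PositiveRibbon.elt (ν t).2) m →
      ∃ g : MorFrom P, PositiveRibbon.elt g.2 = m)

/-- `M` has a `ν̃`-function. -/
def HasNuTildeFunction (Δ : M) : Prop :=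
  ∀ P : PositiveRibbon Δ, ∃ ν : Atoms M → MorTo P,
    (∀ s, IsAtomMor (ν s).2) ∧
    (∀ (s : Atoms M) (g : MorTo P), RightDvd s.1 (PositiveRibbon.elt g.2) →
      RightDvd (PositiveRibbon.elt (ν s).2) (PositiveRibbon.elt g.2)) ∧
    (∀ (s t : Atoms M) (m : M),
      IsJoin RightDvd (PositiveRibbon.elt (ν s).2) (PositiveRibbon.elt (ν t).2) m →
      ∃ g : MorTo P, PositiveRibbon.elt g.2 = m)

/-- `M` has a `ν`-structure. -/
def HasNuStructure (Δ : M) : Prop := HasNuFunction Δ ∧ HasNuTildeFunction Δ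

/-! ### The group of formal inverses of a monoid and the ribbon groupoid -/

/-- The relations of `M`, as relators between generators indexed by the elements of `M`. -/
def formalRels (M : Type u) [Monoid M] : Set (FreeGroup M) :=
  {r | ∃ a b : M, r = FreeGroup.of a * FreeGroup.of b * (FreeGroup.of (a * b))⁻¹}

/-- The group of formal inverses of `M`. If `M` is a Garside monoid, this is its associated Garside
group. -/
abbrev FormalGroup (M : Type u) [Monoid M] : Type u := PresentedGroup (formalRels M)

theorem formalGroup_mul (a b : M) :
    (PresentedGroup.of (a * b) : FormalGroup M) = PresentedGroup.of a * PresentedGroup.of b := by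
  have h : (PresentedGroup.mk (formalRels M)
      (FreeGroup.of a * FreeGroup.of b * (FreeGroup.of (a * b))⁻¹)) = 1 :=
    PresentedGroup.one_of_mem ⟨a, b, rfl⟩
  rw [map_mul, map_mul, map_inv, mul_inv_eq_one] at h
  exact h.symm

/-- The canonical morphism from `M` to its group of formal inverses. -/
def toFormal (M : Type u) [Monoid M] : M →* FormalGroup M where
  toFun a := PresentedGroup.of a
  map_one' := by
    have h := formalGroup_mul (1 : M) 1
    rw [mul_one] at h
    exact (mul_eq_left.mp h.symm)
  map_mul' := formalGroup_mul

/-- The subgroup of the group of formal inverses generated by a submonoid `P`; if `P` is parabolic,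
this is the associated standard parabolic subgroup. -/
def generatedSubgroup (P : Submonoid M) : Subgroup (FormalGroup M) :=
  Subgroup.closure (toFormal M '' (P : Set M))

/-- The submonoid of the elements of a subgroup `H` that come from `M`. If `H` is the standard
parabolic subgroup associated with a parabolic submonoid `P` of a Garside monoid, this is (the
image of) `P`. -/
def positivePart (H : Subgroup (FormalGroup M)) : Submonoid (FormalGroup M) :=
  H.toSubmonoid ⊓ MonoidHom.mrange (toFormal M)

/-- The objects of the ribbon groupoid: the standard parabolic subgroups. -/
@[ext]
structure RibbonGroupoid (Δ : M) where
  /-- the underlying subgroup -/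
  sub : Subgroup (FormalGroup M)
  standard : ∃ P : Submonoid M, IsParabolic Δ P ∧ sub = generatedSubgroup P

/-- The ribbons from `H` to `K`: the morphisms from `H` to `K` in the category of subcategories of
the group that are also morphisms between the parabolic submonoids defining `H` and `K`. -/
@[ext]
structure RibbonGroupoid.Hom {Δ : M} (H K : RibbonGroupoid Δ) where
  /-- the underlying element of the group -/
  elt : FormalGroup M
  conj : Conjugates H.sub.toSubmonoid K.sub.toSubmonoid elt
  conj_positive : Conjugates (positivePart H.sub) (positivePart K.sub) elt

instance (Δ : M) : Groupoid.{u} (RibbonGroupoid Δ) where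
  Hom H K := RibbonGroupoid.Hom H K
  id _ := ⟨1, Conjugates.one _, Conjugates.one _⟩
  comp f g := ⟨f.elt * g.elt, f.conj.mul g.conj, f.conj_positive.mul g.conj_positive⟩
  id_comp f := RibbonGroupoid.Hom.ext (one_mul f.elt)
  comp_id f := RibbonGroupoid.Hom.ext (mul_one f.elt)
  assoc f g h := RibbonGroupoid.Hom.ext (mul_assoc f.elt g.elt h.elt)
  inv f := ⟨f.elt⁻¹, f.conj.inv, f.conj_positive.inv⟩
  inv_comp f := RibbonGroupoid.Hom.ext (inv_mul_cancel f.elt)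
  comp_inv f := RibbonGroupoid.Hom.ext (mul_inv_cancel f.elt)

/-- The element of the group underlying a ribbon. -/
def RibbonGroupoid.elt {Δ : M} {H K : RibbonGroupoid Δ} (f : H ⟶ K) : FormalGroup M :=
  RibbonGroupoid.Hom.elt f

/-! ### The two conclusions -/

/-- The positive ribbon category is a Garside category, for the natural transformation given on
each parabolic submonoid by the element `Δ`. -/
def PositiveRibbonIsGarside (Δ : M) : Prop :=
  ∃ (Φ : PositiveRibbon Δ ⥤ PositiveRibbon Δ) (D : 𝟭 (PositiveRibbon Δ) ⟶ Φ),
    IsGarsideStructure Φ D ∧ ∀ P, PositiveRibbon.elt (D.app P) = Δ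

/-- The ribbon groupoid is the groupoid of formal inverses of the positive ribbon category: sending
a parabolic submonoid to the subgroup it generates, and a positive ribbon to its image in the group,
defines a functor whose canonical extension to the groupoid of formal inverses is an isomorphism. -/
def RibbonGroupoidIsFormalInverses (Δ : M) : Prop :=
  ∃ F : PositiveRibbon Δ ⥤ RibbonGroupoid Δ,
    (∀ P, (F.obj P).sub = generatedSubgroup P.obj.sub) ∧
    (∀ (P Q : PositiveRibbon Δ) (f : P ⟶ Q),
      RibbonGroupoid.elt (F.map f) = toFormal M (PositiveRibbon.elt f)) ∧
    IsIsomorphism (FreeGroupoid.lift F)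

end Monoid

/-! ### Artin–Tits monoids and groups -/

section ArtinTits

variable {B : Type u}

/-- The braid relations `s t s ⋯ = t s t ⋯` (`m s t` letters on each side). The entry `0` of a
Coxeter matrix stands for `∞` and gives the trivial relation. -/
def braidRels (A : CoxeterMatrix B) (x y : FreeMonoid B) : Prop :=
  ∃ i j : B, x = FreeMonoid.ofList (CoxeterSystem.alternatingWord i j (A i j)) ∧
    y = FreeMonoid.ofList (CoxeterSystem.alternatingWord j i (A i j))

/-- The Artin–Tits monoid. -/
abbrev ArtinMonoid (A : CoxeterMatrix B) : Type u := PresentedMonoid (braidRels A)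

/-- The product in the Artin–Tits monoid of the letters of a word. -/
def artinProd (A : CoxeterMatrix B) (ω : List B) : ArtinMonoid A :=
  PresentedMonoid.mk (braidRels A) (FreeMonoid.ofList ω)

/-- The Artin–Tits group. -/
abbrev ArtinGroup (A : CoxeterMatrix B) : Type u :=
  PresentedGroup {r : FreeGroup B | ∃ i j : B,
    r = ((CoxeterSystem.alternatingWord i j (A i j)).map FreeGroup.of).prod *
      ((CoxeterSystem.alternatingWord j i (A i j)).map FreeGroup.of).prod⁻¹}

/-- `ω` is a reduced word of an element of maximal length of the Coxeter group. -/
def IsLongestWord (A : CoxeterMatrix B) (ω : List B) : Prop :=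
  A.toCoxeterSystem.IsReduced ω ∧ ∀ w : A.Group, A.toCoxeterSystem.length w ≤ ω.length

end ArtinTits

end RibbonGarside

namespace RibbonGarside

/-! ### Lattices of divisors from joins of enough elements -/

/-! A positive ribbon is determined by its element of the monoid and either its source or its
target, so cancellation and noetherianity pass from the monoid to the ribbon category, and the
lattice property is the real issue. By noetherian induction on a common multiple, two morphisms have
an lcm as soon as any two non-identity ones with a common multiple have non-identity prefixes with
an lcm (`TypedElements.exists_join_of_leftDvd`). For ribbons from `P` divisible by atoms `s` and
`t`, these prefixes are `ν_P(s)` and `ν_P(t)`. Common multiples are powers of `Δ`, which are ribbons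
from every `P`. An atom of the ribbon category divisible by `s` must be `ν_P(s)`, and it divides `Δ`
because `s` does.

For the groupoid, the key fact is that a parabolic submonoid contains all factors of its elements
(`IsGarsideElement.mem_of_mul_mem`). With the Ore embedding of the monoid in its group, it shows
that `P` is recovered from the subgroup that it generates. Every group element becomes positive
after multiplication by some `Δ ^ n`, and the ribbon category has a calculus of fractions, whence
fullness and faithfulness.

For a finite Coxeter group, the parity representation gives the strong exchange property, and the
geometric representation shows that braid words are reduced. Matsumoto's theorem then yields the
lift `red` of the group to the Artin–Tits monoid. The monoid acts on pairs `(w, g)`, thought of as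
`red w * g`: an element of the group absorbs the longest prefix of `w` with which its product is
reduced. The braid relations hold for this action by `cap_mul`. The image of `(1, 1)` under `a`
splits off the greatest simple prefix of `a` (`ArtinMonoid.red_leftDvd_iff`), which gives
cancellation and lcms of atoms at once, hence the Garside structure.

Parabolic submonoids turn out to be those generated by sets `I` of generators, and `g` is a ribbon
from `I` exactly when `g` left-divides `s g` for all `s` in `I`. This condition is stable under lcms
and gcds; so there is a least ribbon divisible by a given atom, and a minimal nontrivial ribbon
prefix of it serves as the value of `ν`. Reversal of words gives `ν̃`. -/

theorem IsLatticeOrder.of_equiv {α : Type*} {β : Type*} {r : α → α → Prop} {r' : β → β → Prop}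
    (e : α ≃ β) (he : ∀ a b, r a b ↔ r' (e a) (e b)) (h : IsLatticeOrder r') :
    IsLatticeOrder r := by
  obtain ⟨h1, h2, h3, h4⟩ := h
  refine ⟨fun a => (he _ _).2 (h1 _), fun a b hab hba => e.injective (h2 _ _ ((he _ _).1 hab)
    ((he _ _).1 hba)), fun a b c hab hbc => (he _ _).2 (h3 _ _ _ ((he _ _).1 hab)
    ((he _ _).1 hbc)), fun a b => ?_⟩
  obtain ⟨⟨m, hm1, hm2, hm3⟩, ⟨n, hn1, hn2, hn3⟩⟩ := h4 (e a) (e b)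
  refine ⟨⟨e.symm m, (he _ _).2 (by simpa using hm1), (he _ _).2 (by simpa using hm2),
    fun c hac hbc => (he _ _).2 ?_⟩, ⟨e.symm n, (he _ _).2 (by simpa using hn1),
    (he _ _).2 (by simpa using hn2), fun c hac hbc => (he _ _).2 ?_⟩⟩
  · simpa using hm3 (e c) ((he _ _).1 hac) ((he _ _).1 hbc)
  · simpa using hn3 (e c) ((he _ _).1 hac) ((he _ _).1 hbc)

section MonoidDivisibility

variable {M : Type*} [Monoid M]

theorem LeftDvd.refl (a : M) : LeftDvd a a := ⟨1, (mul_one a).symm⟩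

theorem LeftDvd.trans {a b c : M} (h : LeftDvd a b) (h' : LeftDvd b c) : LeftDvd a c := by
  obtain ⟨x, rfl⟩ := h
  obtain ⟨y, rfl⟩ := h'
  exact ⟨x * y, mul_assoc _ _ _⟩

theorem LeftDvd.one (a : M) : LeftDvd 1 a := ⟨a, (one_mul a).symm⟩

theorem LeftDvd.mul_right (a b : M) : LeftDvd a (a * b) := ⟨b, rfl⟩

theorem LeftDvd.mul_left {a b : M} (c : M) (h : LeftDvd a b) : LeftDvd (c * a) (c * b) := by
  obtain ⟨x, rfl⟩ := h
  exact ⟨x, (mul_assoc _ _ _).symm⟩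

theorem LeftDvd.of_mul_left (hc : ∀ a b c : M, a * b = a * c → b = c) {a b c : M}
    (h : LeftDvd (c * a) (c * b)) : LeftDvd a b := by
  obtain ⟨x, hx⟩ := h
  exact ⟨x, hc c _ _ (by rw [hx, mul_assoc])⟩

theorem LeftDvd.antisymm (hc : ∀ a b c : M, a * b = a * c → b = c)
    (hu : ∀ a b : M, a * b = 1 → a = 1) {a b : M} (h : LeftDvd a b) (h' : LeftDvd b a) :
    a = b := by
  obtain ⟨x, rfl⟩ := h
  obtain ⟨y, hy⟩ := h'
  have : x * y = 1 := hc a _ _ (by rw [mul_one, ← mul_assoc]; exact hy.symm)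
  rw [hu _ _ this, mul_one]

/-- A category whose morphisms are elements of a monoid and compose by multiplication, closed under
left quotients. -/
structure TypedElements (M : Type*) [Monoid M] (O : Type*) where
  /-- the element `a` is a morphism from `P` to `Q` -/
  rel : O → M → O → Prop
  one : ∀ P, rel P 1 P
  mul : ∀ {P a Q b T}, rel P a Q → rel Q b T → rel P (a * b) T
  quot : ∀ {P a Q b T}, rel P a Q → rel P (a * b) T → rel Q b T

namespace TypedElements

variable {O : Type*} (R : TypedElements M O)

/-- The elements that are morphisms with source `P`. -/
def outs (P : O) : Set M := {a | ∃ Q, R.rel P a Q}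

/-- `m` is a least common multiple of `a` and `b` among the morphisms with source `P`. -/
def Join (P : O) (a b m : M) : Prop :=
  m ∈ R.outs P ∧ LeftDvd a m ∧ LeftDvd b m ∧
    ∀ c ∈ R.outs P, LeftDvd a c → LeftDvd b c → LeftDvd m c

variable {R}

theorem mul_mem_outs {P Q : O} {a b : M} (ha : R.rel P a Q) : a * b ∈ R.outs P ↔ b ∈ R.outs Q :=
  ⟨fun ⟨T, hT⟩ => ⟨T, R.quot ha hT⟩, fun ⟨T, hT⟩ => ⟨T, R.mul ha hT⟩⟩

theorem Join.mul_left (hc : ∀ a b c : M, a * b = a * c → b = c) {P Q : O} {x a b m : M}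
    (hx : R.rel P x Q) (h : R.Join Q a b m) : R.Join P (x * a) (x * b) (x * m) := by
  refine ⟨(mul_mem_outs hx).2 h.1, h.2.1.mul_left x, h.2.2.1.mul_left x, ?_⟩
  rintro c hcP ⟨y, rfl⟩ h2
  rw [mul_assoc] at hcP h2 ⊢
  exact (h.2.2.2 _ ((mul_mem_outs hx).1 hcP) (LeftDvd.mul_right _ _)
    (h2.of_mul_left hc)).mul_left x

/-- Let `c` be the join of the prefixes `a₀` and `b₀`. Form the join `e` of `a` and `c`, the join
`f` of `b` and `c`, and finally the join of `e` and `f`. These pairs share the nontrivial prefixes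
`a₀`, `b₀` and `c`; stripping such a prefix also shortens the common multiple `k`, so induction
applies each time. -/
theorem exists_join_of_leftDvd (hc : ∀ a b c : M, a * b = a * c → b = c)
    (hwf : WellFounded fun a b : M => ∃ x ≠ 1, b = x * a)
    (H : ∀ P, ∀ a ∈ R.outs P, ∀ b ∈ R.outs P, ∀ k ∈ R.outs P, a ≠ 1 → b ≠ 1 → LeftDvd a k →
      LeftDvd b k → ∃ a₀ ∈ R.outs P, ∃ b₀ ∈ R.outs P, a₀ ≠ 1 ∧ b₀ ≠ 1 ∧ LeftDvd a₀ a ∧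
        LeftDvd b₀ b ∧ ∃ c, R.Join P a₀ b₀ c)
    (hu : ∀ a b : M, a * b = 1 → a = 1) (k : M) :
    ∀ P, k ∈ R.outs P → ∀ a ∈ R.outs P, ∀ b ∈ R.outs P, LeftDvd a k → LeftDvd b k →
      ∃ m, R.Join P a b m := by
  induction k using hwf.induction with
  | _ k ih =>
  intro P hk a ha b hb hak hbk
  by_cases ha1 : a = 1
  · subst ha1
    exact ⟨b, hb, LeftDvd.one _, LeftDvd.refl _, fun c _ _ h => h⟩
  by_cases hb1 : b = 1
  · subst hb1
    exact ⟨a, ha, LeftDvd.refl _, LeftDvd.one _, fun c _ h _ => h⟩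
  obtain ⟨a₀, ⟨Qa, hQa⟩, b₀, ⟨Qb, hQb⟩, ha₀, hb₀, haa, hbb, c, hjc⟩ :=
    H P a ha b hb k hk ha1 hb1 hak hbk
  -- joins of morphisms sharing a nontrivial prefix
  have step : ∀ {x u v : M} {Q}, R.rel P x Q → x ≠ 1 → LeftDvd x u → LeftDvd x v →
      u ∈ R.outs P → v ∈ R.outs P → LeftDvd u k → LeftDvd v k → ∃ m, R.Join P u v m := by
    rintro x u v Q hx hx1 ⟨u', rfl⟩ ⟨v', rfl⟩ hu hv huk hvk
    obtain ⟨k', rfl⟩ := (LeftDvd.mul_right x u').trans huk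
    obtain ⟨m, hm⟩ := ih k' ⟨x, hx1, rfl⟩ Q ((mul_mem_outs hx).1 hk) u' ((mul_mem_outs hx).1 hu)
      v' ((mul_mem_outs hx).1 hv) (huk.of_mul_left hc) (hvk.of_mul_left hc)
    exact ⟨x * m, hm.mul_left hc hx⟩
  have hck : LeftDvd c k := hjc.2.2.2 k hk (haa.trans hak) (hbb.trans hbk)
  obtain ⟨e, he⟩ := step hQa ha₀ haa hjc.2.1 ha hjc.1 hak hck
  obtain ⟨f, hf⟩ := step hQb hb₀ hbb hjc.2.2.1 hb hjc.1 hbk hck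
  have hc1 : c ≠ 1 := by
    rintro rfl
    obtain ⟨y, hy⟩ := hjc.2.1
    exact ha₀ (hu _ _ hy.symm)
  obtain ⟨Qc, hQc⟩ := hjc.1
  obtain ⟨m, hm⟩ := step hQc hc1 he.2.2.1 hf.2.2.1 he.1 hf.1 (he.2.2.2 k hk hak hck)
    (hf.2.2.2 k hk hbk hck)
  refine ⟨m, hm.1, he.2.1.trans hm.2.1, hf.2.1.trans hm.2.2.1, fun d hd had hbd => ?_⟩
  have hcd : LeftDvd c d := hjc.2.2.2 d hd (haa.trans had) (hbb.trans hbd)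
  exact hm.2.2.2 d hd (he.2.2.2 d hd had hcd) (hf.2.2.2 d hd hbd hcd)

/-- A set of morphisms dividing `g` that contains `1` and is closed under joins has a greatest
element. -/
theorem exists_greatest_divisor (hwf : WellFounded fun a b : M => ∃ x ≠ 1, b = x * a)
    {g : M} (D : Set M) (h1 : 1 ∈ D) (hg : ∀ a ∈ D, LeftDvd a g)
    (hj : ∀ a ∈ D, ∀ b ∈ D, ∃ m ∈ D, LeftDvd a m ∧ LeftDvd b m)
    (hc : ∀ a b c : M, a * b = a * c → b = c) :
    ∃ m ∈ D, ∀ a ∈ D, LeftDvd a m := by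
  -- Take the element of `D` whose complement in `g` is minimal: joining it with an element that
  -- does not divide it would give a strictly smaller complement.
  obtain ⟨y, ⟨m, hm, hy⟩, hmin⟩ := hwf.has_min {y | ∃ m ∈ D, g = m * y} ⟨g, 1, h1, (one_mul g).symm⟩
  refine ⟨m, hm, fun a ha => ?_⟩
  obtain ⟨n, hn, han, x, rfl⟩ := hj a ha m hm
  obtain ⟨z, hz⟩ := hg _ hn
  have hyz : y = x * z := hc m _ _ (by rw [← hy, hz, mul_assoc])
  by_cases hx : x = 1
  · rwa [hx, mul_one] at han
  · exact (hmin z ⟨_, hn, hz⟩ ⟨x, hx, hyz⟩).elim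

/-- A gcd is the greatest of the common divisors: their pairwise joins, which exist below `a`, still
divide both elements. -/
theorem isLatticeOrder_outs (hc : ∀ a b c : M, a * b = a * c → b = c)
    (hwf : WellFounded fun a b : M => ∃ x ≠ 1, b = x * a)
    (H : ∀ P, ∀ a ∈ R.outs P, ∀ b ∈ R.outs P, ∀ k ∈ R.outs P, a ≠ 1 → b ≠ 1 → LeftDvd a k →
      LeftDvd b k → ∃ a₀ ∈ R.outs P, ∃ b₀ ∈ R.outs P, a₀ ≠ 1 ∧ b₀ ≠ 1 ∧ LeftDvd a₀ a ∧
        LeftDvd b₀ b ∧ ∃ c, R.Join P a₀ b₀ c)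
    (hu : ∀ a b : M, a * b = 1 → a = 1)
    (hcm : ∀ P, ∀ a ∈ R.outs P, ∀ b ∈ R.outs P, ∃ k ∈ R.outs P, LeftDvd a k ∧ LeftDvd b k)
    (P : O) : IsLatticeOrder (fun a b : R.outs P => LeftDvd (a : M) b) := by
  have J := exists_join_of_leftDvd hc hwf H hu
  refine ⟨fun a => LeftDvd.refl _, fun a b h h' => Subtype.ext (h.antisymm hc hu h'),
    fun a b c h h' => LeftDvd.trans h h', fun a b => ⟨?_, ?_⟩⟩
  · obtain ⟨k, hk, hak, hbk⟩ := hcm P a a.2 b b.2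
    obtain ⟨m, hm⟩ := J k P hk a a.2 b b.2 hak hbk
    exact ⟨⟨m, hm.1⟩, hm.2.1, hm.2.2.1, fun c h h' => hm.2.2.2 c c.2 h h'⟩
  · obtain ⟨m, hm, hmax⟩ := exists_greatest_divisor hwf (g := (a : M))
      {d | d ∈ R.outs P ∧ LeftDvd d a ∧ LeftDvd d b} ⟨⟨P, R.one P⟩, LeftDvd.one _, LeftDvd.one _⟩
      (fun d hd => hd.2.1) (fun d hd e he => by
        obtain ⟨m, hm⟩ := J a P a.2 d hd.1 e he.1 hd.2.1 he.2.1
        exact ⟨m, ⟨hm.1, hm.2.2.2 a a.2 hd.2.1 he.2.1, hm.2.2.2 b b.2 hd.2.2 he.2.2⟩, hm.2.1,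
          hm.2.2.1⟩) hc
    exact ⟨⟨m, hm.1⟩, hm.2.1, hm.2.2, fun c h h' => hmax c ⟨c.2, h, h'⟩⟩

end TypedElements

end MonoidDivisibility

/-! ### Garside monoids in terms of elements -/

section GarsideElement

variable {M : Type*} [Monoid M]

theorem oneObj_isIdentity_iff {x y : OneObj M} (f : x ⟶ y) : IsIdentity f ↔ OneObj.val f = 1 := by
  constructor
  · rintro ⟨⟩
    rfl
  · intro h
    have : f = 𝟙 x := h
    rw [this]
    exact IsIdentity.id x

theorem isAtomMor_hom_iff (s : M) :
    IsAtomMor (OneObj.hom s) ↔ s ≠ 1 ∧ ∀ a b, a * b = s → a = 1 ∨ b = 1 := by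
  constructor
  · rintro ⟨h1, h2⟩
    refine ⟨fun h => h1 ((oneObj_isIdentity_iff _).2 h), fun a b hab => ?_⟩
    have := h2 (OneObj.star M) (OneObj.hom a) (OneObj.hom b) hab
    rwa [oneObj_isIdentity_iff, oneObj_isIdentity_iff] at this
  · rintro ⟨h1, h2⟩
    refine ⟨fun h => h1 ((oneObj_isIdentity_iff _).1 h), fun z g h hgh => ?_⟩
    rw [oneObj_isIdentity_iff, oneObj_isIdentity_iff]
    exact h2 _ _ hgh

theorem oneObj_eqToHom {x y : OneObj M} (h : x = y) : OneObj.val (eqToHom h) = 1 := by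
  subst h
  rfl

/-- `Δ` is a Garside element of `M`, and conjugation by `Δ` is the automorphism `φ`. -/
structure IsGarsideElement (Δ : M) (φ : M ≃* M) : Prop where
  mul_eq : ∀ a, a * Δ = Δ * φ a
  left_cancel : ∀ a b c : M, a * b = a * c → b = c
  right_cancel : ∀ a b c : M, a * c = b * c → a = b
  noetherian : ∀ w : ℕ → M, (∀ i, ∃ x y, w i = x * w (i + 1) * y) → ∃ N, ∀ i, N ≤ i → w i = w N
  left_lattice : IsLatticeOrder (LeftDvd (M := M))
  right_lattice : IsLatticeOrder (RightDvd (M := M))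
  atom_dvd : ∀ s : Atoms M, LeftDvd s.1 Δ

theorem oneObj_arrow_eq_iff {w w' : Arrow (OneObj M)} :
    w = w' ↔ OneObj.val w.hom = OneObj.val w'.hom := by
  obtain ⟨⟨⟩, ⟨⟩, f⟩ := w
  obtain ⟨⟨⟩, ⟨⟩, g⟩ := w'
  constructor
  · rintro h
    rw [h]
  · intro h
    have h' : f = g := h
    rw [h']

variable (M) in
/-- The morphisms with a given source in the category with one object are the elements. -/
def oneObjMorFrom : MorFrom (OneObj.star M) ≃ M where
  toFun f := OneObj.val f.2
  invFun a := ⟨OneObj.star M, OneObj.hom a⟩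
  left_inv _ := rfl
  right_inv _ := rfl

variable (M) in
/-- The morphisms with a given target in the category with one object are the elements. -/
def oneObjMorTo : MorTo (OneObj.star M) ≃ M where
  toFun f := OneObj.val f.2
  invFun a := ⟨OneObj.star M, OneObj.hom a⟩
  left_inv _ := rfl
  right_inv _ := rfl

theorem leftDivides_iff_leftDvd (f g : MorFrom (OneObj.star M)) :
    LeftDivides f g ↔ LeftDvd (oneObjMorFrom M f) (oneObjMorFrom M g) :=
  ⟨fun ⟨h, hh⟩ => ⟨OneObj.val h, hh.symm⟩, fun ⟨h, hh⟩ => ⟨OneObj.hom h, hh.symm⟩⟩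

theorem rightDivides_iff_rightDvd (f g : MorTo (OneObj.star M)) :
    RightDivides f g ↔ RightDvd (oneObjMorTo M f) (oneObjMorTo M g) :=
  ⟨fun ⟨h, hh⟩ => ⟨OneObj.val h, hh.symm⟩, fun ⟨h, hh⟩ => ⟨OneObj.hom h, hh.symm⟩⟩

theorem IsGarsideMonoid.exists_isGarsideElement {Δ : M} (h : IsGarsideMonoid M Δ) :
    ∃ φ : M ≃* M, IsGarsideElement Δ φ := by
  obtain ⟨Φ, D, hD, rfl⟩ := h
  obtain ⟨G, hG1, hG2⟩ := hD.automorphism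
  let φ : M ≃* M :=
    { toFun := fun a => OneObj.val (Φ.map (OneObj.hom a))
      invFun := fun a => OneObj.val (G.map (OneObj.hom a))
      left_inv := fun a => by
        have := Functor.congr_hom hG1 (OneObj.hom a)
        have h2 := congrArg OneObj.val this
        refine h2.trans ?_
        change OneObj.val (eqToHom _) * (a * OneObj.val (eqToHom _)) = a
        rw [oneObj_eqToHom, oneObj_eqToHom, one_mul, mul_one]
      right_inv := fun a => by
        have := Functor.congr_hom hG2 (OneObj.hom a)
        have h2 := congrArg OneObj.val this
        refine h2.trans ?_
        change OneObj.val (eqToHom _) * (a * OneObj.val (eqToHom _)) = a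
        rw [oneObj_eqToHom, oneObj_eqToHom, one_mul, mul_one]
      map_mul' := fun a b => Φ.map_comp (OneObj.hom a) (OneObj.hom b) }
  refine ⟨φ, fun a => D.naturality (OneObj.hom a), fun a b c hbc => ?_, fun a b c hab => ?_,
    fun w hw => ?_, ?_, ?_, fun s => ?_⟩
  · have := (hD.cancellative (OneObj.hom a)).1
    exact (cancel_epi (OneObj.hom a)).1 (show OneObj.hom a ≫ OneObj.hom b = _ ≫ OneObj.hom c from hbc)
  · have := (hD.cancellative (OneObj.hom c)).2
    exact (cancel_mono (OneObj.hom c)).1 (show OneObj.hom a ≫ _ = OneObj.hom b ≫ _ from hab)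
  · obtain ⟨N, hN⟩ := hD.noetherian (fun i => Arrow.mk (OneObj.hom (w i))) (fun i => by
      obtain ⟨x, y, h⟩ := hw i
      exact ⟨OneObj.hom x, OneObj.hom y, h.trans (mul_assoc x _ y)⟩)
    exact ⟨N, fun i hi => oneObj_arrow_eq_iff.1 (hN i hi)⟩
  · refine (hD.left_lattice (OneObj.star M)).of_equiv (oneObjMorFrom M).symm fun a b => ?_
    rw [leftDivides_iff_leftDvd, Equiv.apply_symm_apply, Equiv.apply_symm_apply]
  · refine (hD.right_lattice (OneObj.star M)).of_equiv (oneObjMorTo M).symm fun a b => ?_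
    rw [rightDivides_iff_rightDvd, Equiv.apply_symm_apply, Equiv.apply_symm_apply]
  · obtain ⟨g, hg, -⟩ := hD.atom_simple _ s.2
    exact ⟨OneObj.val g, hg.symm⟩

/-! ### Consequences of the Garside axioms: descent, powers of `Δ`, factors in parabolic submonoids
-/

namespace IsGarsideElement

variable {Δ : M} {φ : M ≃* M} (h : IsGarsideElement Δ φ)

include h

theorem isGarsideMonoid : IsGarsideMonoid M Δ := by
  let Φ : OneObj M ⥤ OneObj M :=
    { obj := fun x => x
      map := fun f => OneObj.hom (φ (OneObj.val f))
      map_id := fun _ => map_one φ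
      map_comp := fun f g => map_mul φ (OneObj.val f) (OneObj.val g) }
  let Ψ : OneObj M ⥤ OneObj M :=
    { obj := fun x => x
      map := fun f => OneObj.hom (φ.symm (OneObj.val f))
      map_id := fun _ => map_one φ.symm
      map_comp := fun f g => map_mul φ.symm (OneObj.val f) (OneObj.val g) }
  refine ⟨Φ, ⟨fun _ => OneObj.hom Δ, fun _ _ f => h.mul_eq (OneObj.val f)⟩,
    ⟨⟨Ψ, ?_, ?_⟩, fun w hw => ?_, fun _ _ f => ⟨⟨fun a b hab => ?_⟩, ⟨fun a b hab => ?_⟩⟩,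
      fun x => ?_, fun x => ?_, fun x y f hf => ?_⟩, rfl⟩
  · exact CategoryTheory.Functor.ext (fun _ => rfl) fun _ _ f => by
      simp only [eqToHom_refl, Category.comp_id, Category.id_comp]
      exact φ.symm_apply_apply (OneObj.val f)
  · exact CategoryTheory.Functor.ext (fun _ => rfl) fun _ _ f => by
      simp only [eqToHom_refl, Category.comp_id, Category.id_comp]
      exact φ.apply_symm_apply (OneObj.val f)
  · obtain ⟨N, hN⟩ := h.noetherian (fun i => OneObj.val (w i).hom) (fun i => by
      obtain ⟨x, y, hxy⟩ := hw i
      exact ⟨OneObj.val x, OneObj.val y, (congrArg OneObj.val hxy).trans (mul_assoc _ _ _).symm⟩)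
    exact ⟨N, fun i hi => oneObj_arrow_eq_iff.2 (hN i hi)⟩
  · exact h.left_cancel _ _ _ hab
  · exact h.right_cancel _ _ _ hab
  · exact h.left_lattice.of_equiv (oneObjMorFrom M) leftDivides_iff_leftDvd
  · exact h.right_lattice.of_equiv (oneObjMorTo M) rightDivides_iff_rightDvd
  · obtain ⟨c, hc⟩ := h.atom_dvd ⟨OneObj.val f, hf⟩
    refine ⟨OneObj.hom c, hc.symm, h.left_cancel (OneObj.val f) _ _ ?_⟩
    change OneObj.val f * (c * φ (OneObj.val f)) = OneObj.val f * Δ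
    rw [← mul_assoc, h.mul_eq, hc]

theorem eq_one_of_mul_eq_one {a b : M} (hab : a * b = 1) : a = 1 :=
  h.left_lattice.2.1 _ _ ⟨b, hab.symm⟩ (LeftDvd.one a)

theorem eq_one_of_mul_eq_one' {a b : M} (hab : a * b = 1) : b = 1 := by
  rwa [h.eq_one_of_mul_eq_one hab, one_mul] at hab

/-- Since `e * b ^ n = a * (e * b ^ (n + 1))`, the elements `e * b ^ n` form a sequence of
successive factors. It is eventually constant, and cancellation gives `b = 1`. Thus proper factors
strictly descend. -/
theorem right_factor_eq_one {a b e : M} (he : a * e * b = e) : b = 1 := by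
  have key : ∀ n : ℕ, e * b ^ n = a * (e * b ^ (n + 1)) * 1 := fun n => by
    conv_lhs => rw [← he]
    simp only [mul_assoc, pow_succ', mul_one]
  obtain ⟨N, hN⟩ := h.noetherian (fun n => e * b ^ n) fun n => ⟨a, 1, key n⟩
  have := hN (N + 1) (Nat.le_succ _)
  rw [pow_succ, ← mul_assoc] at this
  exact h.left_cancel (e * b ^ N) _ _ (by rw [this, mul_one])

theorem left_factor_eq_one {a b e : M} (he : a * e * b = e) : a = 1 := by
  have hb := h.right_factor_eq_one he
  rw [hb, mul_one] at he
  exact h.right_cancel _ _ e (by rw [he, one_mul])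

theorem wellFounded_factor :
    WellFounded fun a b : M => ∃ x y, b = x * a * y ∧ (x ≠ 1 ∨ y ≠ 1) := by
  rw [wellFounded_iff_isEmpty_descending_chain]
  refine ⟨fun ⟨w, hw⟩ => ?_⟩
  obtain ⟨N, hN⟩ := h.noetherian w fun i => by
    obtain ⟨x, y, hxy, -⟩ := hw i
    exact ⟨x, y, hxy⟩
  obtain ⟨x, y, hxy, hne⟩ := hw N
  rw [hN (N + 1) (Nat.le_succ _)] at hxy
  exact hne.elim (fun hx => hx (h.left_factor_eq_one hxy.symm))
    fun hy => hy (h.right_factor_eq_one hxy.symm)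

theorem wellFounded_right : WellFounded fun a b : M => ∃ x ≠ 1, b = x * a :=
  Subrelation.wf (fun {_ _} ⟨x, hx, hb⟩ => ⟨x, 1, by rw [hb, mul_one], Or.inl hx⟩)
    h.wellFounded_factor

theorem wellFounded_left : WellFounded fun a b : M => ∃ x ≠ 1, b = a * x :=
  Subrelation.wf (fun {_ _} ⟨x, hx, hb⟩ => ⟨1, x, by rw [hb, one_mul], Or.inr hx⟩)
    h.wellFounded_factor

theorem exists_atom_leftDvd {a : M} (ha : a ≠ 1) : ∃ s : Atoms M, LeftDvd s.1 a := by
  induction a using h.wellFounded_left.induction with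
  | _ a ih =>
  by_cases hs : IsAtomMor (OneObj.hom a)
  · exact ⟨⟨a, hs⟩, LeftDvd.refl _⟩
  · rw [isAtomMor_hom_iff] at hs
    push Not at hs
    obtain ⟨b, c, rfl, hb, hc⟩ := hs ha
    obtain ⟨s, hs⟩ := ih b ⟨c, hc, rfl⟩ hb
    exact ⟨s, hs.trans (LeftDvd.mul_right _ _)⟩

theorem exists_atom_rightDvd {a : M} (ha : a ≠ 1) : ∃ s : Atoms M, RightDvd s.1 a := by
  induction a using h.wellFounded_right.induction with
  | _ a ih =>
  by_cases hs : IsAtomMor (OneObj.hom a)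
  · exact ⟨⟨a, hs⟩, 1, (one_mul a).symm⟩
  · rw [isAtomMor_hom_iff] at hs
    push Not at hs
    obtain ⟨b, c, rfl, hb, hc⟩ := hs ha
    obtain ⟨s, x, rfl⟩ := ih c ⟨b, hb, rfl⟩ hc
    exact ⟨s, b * x, (mul_assoc _ _ _).symm⟩

theorem map_self : φ Δ = Δ := (h.left_cancel Δ _ _ (h.mul_eq Δ)).symm

theorem mul_pow_eq (n : ℕ) (a : M) : a * Δ ^ n = Δ ^ n * (φ ^ n) a := by
  induction n generalizing a with
  | zero => simp
  | succ n ih =>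
    rw [pow_succ', ← mul_assoc, h.mul_eq, mul_assoc, ih, ← mul_assoc, pow_succ]
    rfl

/-- Peel off an atom `s` with `s * t = Δ`. If `c * x = Δ ^ n`, then `s * c * x * φ ^ n (t) = s * t *
Δ ^ n = Δ ^ (n + 1)`. -/
theorem exists_leftDvd_pow (a : M) : ∃ n, LeftDvd a (Δ ^ n) := by
  induction a using h.wellFounded_right.induction with
  | _ a ih =>
  by_cases ha : a = 1
  · exact ⟨0, by rw [ha]; exact LeftDvd.one _⟩
  obtain ⟨s, c, rfl⟩ := h.exists_atom_leftDvd ha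
  have hs1 : s.1 ≠ 1 := ((isAtomMor_hom_iff _).1 s.2).1
  obtain ⟨n, x, hx⟩ := ih c ⟨s.1, hs1, rfl⟩
  obtain ⟨t, ht⟩ := h.atom_dvd s
  refine ⟨n + 1, x * (φ ^ n) t, ?_⟩
  rw [← mul_assoc, mul_assoc s.1, ← hx, mul_assoc, ← h.mul_pow_eq, ← mul_assoc, ← ht, pow_succ']

theorem map_pow_self (n : ℕ) : (φ ^ n) (Δ ^ n) = Δ ^ n :=
  (h.left_cancel (Δ ^ n) _ _ (h.mul_pow_eq n (Δ ^ n))).symm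

/-- From `a * x = Δ ^ n` follows `x * φ ^ n (a) = Δ ^ n`. Applying the inverse of `φ ^ n`, which
fixes `Δ ^ n`, puts `a` on the right. -/
theorem exists_rightDvd_pow (a : M) : ∃ n, RightDvd a (Δ ^ n) := by
  obtain ⟨n, x, hx⟩ := h.exists_leftDvd_pow a
  refine ⟨n, (φ ^ n).symm x, (φ ^ n).injective ?_⟩
  rw [h.map_pow_self, map_mul, MulEquiv.apply_symm_apply]
  refine h.left_cancel a _ _ ?_
  rw [h.mul_pow_eq, ← mul_assoc, ← hx]

/-- The join of two elements for left-divisibility exists. -/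
theorem exists_left_join (a b : M) : ∃ m, IsJoin LeftDvd a b m := (h.left_lattice.2.2.2 a b).1

/-- A parabolic submonoid of a Garside monoid contains the factors of its elements. -/
theorem mem_of_mul_mem {P : Submonoid M} (hP : IsParabolic Δ P) {a b : M} (hab : a * b ∈ P) :
    a ∈ P ∧ b ∈ P := by
  obtain ⟨δ, ⟨ψ, hψ⟩, hδ, hδ'⟩ := hP.exists_garside
  have hδs : ∀ g, LeftDvd g δ ↔ LeftDvd g Δ ∧ g ∈ P := fun g => by
    have := Set.ext_iff.1 hδ g
    simpa using this
  have hδP : δ ∈ P := ((hδs δ).1 (LeftDvd.refl δ)).2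
  -- The gcd of `Δ` and `p` lies in `[1, δ]` by parabolicity, so every divisor of `Δ` that divides
  -- an element of `P` already divides `δ`, and therefore lies in `P`.
  have hsimple : ∀ g p, LeftDvd g Δ → p ∈ P → LeftDvd g p → LeftDvd g δ := by
    intro g p hg hp hgp
    obtain ⟨m, hm⟩ := (h.left_lattice.2.2.2 Δ p).2
    have hmδ : m ∈ {g : M | LeftDvd g δ} := by
      rw [hδ, hδ']
      exact ⟨p, hp, hm⟩
    exact (hm.2.2 g hg hgp).trans hmδ
  have hψδ : ψ.symm ⟨δ, hδP⟩ = ⟨δ, hδP⟩ := by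
    rw [MulEquiv.symm_apply_eq]
    exact Subtype.ext (h.left_cancel δ _ _ (hψ ⟨δ, hδP⟩))
  -- complements in `δ`
  have hcompl : ∀ t, LeftDvd t δ → ∃ q ∈ P, q * t = δ := by
    have h1 : ∀ (t : P) (u : M), (t : M) * u = δ → u * ψ t = δ := by
      intro t u htu
      refine h.left_cancel t _ _ ?_
      rw [← mul_assoc, htu, hψ]
    intro t ht
    have htP : t ∈ P := ((hδs t).1 ht).2
    obtain ⟨u, hu⟩ := ht
    have huP : u ∈ P := ((hδs u).1 ⟨_, (h1 ⟨t, htP⟩ u hu.symm).symm⟩).2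
    have h2 : ψ.symm ⟨t, htP⟩ * ψ.symm ⟨u, huP⟩ = ⟨δ, hδP⟩ := by
      rw [← map_mul, ← hψδ]
      exact congrArg ψ.symm (Subtype.ext hu.symm)
    refine ⟨ψ.symm ⟨u, huP⟩, Subtype.property _, ?_⟩
    have := h1 (ψ.symm ⟨t, htP⟩) (ψ.symm ⟨u, huP⟩) (congrArg Subtype.val h2)
    rwa [MulEquiv.apply_symm_apply] at this
  -- With `q * s = δ`, the element `δ * g = q * (s * g)` is in `P`. Conjugation by `δ` carries it to
  -- `g * δ`, so `g` keeps a right multiple in `P` after the loss of its left factor `s`.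
  have hremove : ∀ s g, LeftDvd s δ → s * g ∈ P → ∃ x, g * x ∈ P := by
    intro s g hs hsg
    obtain ⟨q, hq, hqs⟩ := hcompl s hs
    have hy : δ * g ∈ P := by
      rw [← hqs, mul_assoc]
      exact P.mul_mem hq hsg
    refine ⟨δ, ?_⟩
    have : g * δ = ψ ⟨_, hy⟩ := h.left_cancel δ _ _ (by rw [← mul_assoc]; exact hψ ⟨_, hy⟩)
    rw [this]
    exact Subtype.property _
  -- An element with a right multiple in `P` is in `P`: its first atom divides `δ` by `hsimple`, and
  -- the rest still has a right multiple in `P` by `hremove`.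
  have hleft : ∀ g, (∃ x, g * x ∈ P) → g ∈ P := by
    intro g
    induction g using h.wellFounded_right.induction with
    | _ g ih =>
    rintro ⟨x, hx⟩
    by_cases hg : g = 1
    · rw [hg]
      exact P.one_mem
    obtain ⟨s, g', rfl⟩ := h.exists_atom_leftDvd hg
    have hs : LeftDvd s.1 δ := hsimple _ _ (h.atom_dvd s) hx
      ((LeftDvd.mul_right _ _).trans (LeftDvd.mul_right _ _))
    obtain ⟨y, hy⟩ := hremove s.1 (g' * x) hs (by rwa [← mul_assoc])
    exact P.mul_mem ((hδs _).1 hs).2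
      (ih g' ⟨s.1, ((isAtomMor_hom_iff _).1 s.2).1, rfl⟩ ⟨x * y, by rwa [← mul_assoc]⟩)
  have ha : a ∈ P := hleft a ⟨b, hab⟩
  refine ⟨ha, ?_⟩
  clear ha
  induction a using h.wellFounded_right.induction with
  | _ a ih =>
  by_cases ha1 : a = 1
  · rwa [ha1, one_mul] at hab
  obtain ⟨s, a', rfl⟩ := h.exists_atom_leftDvd ha1
  have hs : LeftDvd s.1 δ := hsimple _ _ (h.atom_dvd s) hab
    ((LeftDvd.mul_right _ _).trans (LeftDvd.mul_right _ _))
  rw [mul_assoc] at hab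
  -- Deleting the first atom of `a` leaves `a' * b` in `P`: `hremove` gives it a right multiple in
  -- `P`, and `hleft` removes that multiple.
  exact ih a' ⟨s.1, ((isAtomMor_hom_iff _).1 s.2).1, rfl⟩ (hleft _ (hremove s.1 _ hs hab))

end IsGarsideElement

/-! ### Conjugation of submonoids in a cancellative monoid -/

section Conjugates

/-- Cancellation makes the correspondence `p * δ = δ * q` single-valued in both directions and
multiplicative, so the isomorphism need not be supplied. -/
theorem Conjugates.iff_forall {M : Type*} [Monoid M] (hl : ∀ a b c : M, a * b = a * c → b = c)
    (hr : ∀ a b c : M, a * c = b * c → a = b) {P Q : Submonoid M} {δ : M} :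
    Conjugates P Q δ ↔
      (∀ p ∈ P, ∃ q ∈ Q, p * δ = δ * q) ∧ ∀ q ∈ Q, ∃ p ∈ P, p * δ = δ * q := by
  constructor
  · rintro ⟨φ, hφ⟩
    exact ⟨fun p hp => ⟨φ ⟨p, hp⟩, Subtype.property _, hφ ⟨p, hp⟩⟩, fun q hq =>
      ⟨φ.symm ⟨q, hq⟩, Subtype.property _, by rw [hφ, MulEquiv.apply_symm_apply]⟩⟩
  · rintro ⟨h1, h2⟩
    choose f hfQ hf using h1
    choose g hgP hg using h2
    exact ⟨{ toFun := fun p => ⟨f p p.2, hfQ _ _⟩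
             invFun := fun q => ⟨g q q.2, hgP _ _⟩
             left_inv := fun p => Subtype.ext (hr _ _ δ (by rw [hg, ← hf]))
             right_inv := fun q => Subtype.ext (hl δ _ _ (by rw [← hf, hg]))
             map_mul' := fun p q => Subtype.ext (hl δ _ _ (by
              simp only [Submonoid.coe_mul]
              rw [← hf, ← mul_assoc, ← hf p p.2, mul_assoc, hf q q.2, mul_assoc])) },
      fun p => hf _ _⟩

theorem Conjugates.quot_left {M : Type*} [Monoid M] (hl : ∀ a b c : M, a * b = a * c → b = c)
    {P Q R : Submonoid M} {a b : M} (ha : Conjugates P Q a) (hab : Conjugates P R (a * b)) :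
    Conjugates Q R b := by
  obtain ⟨φ, hφ⟩ := ha
  obtain ⟨ψ, hψ⟩ := hab
  refine ⟨φ.symm.trans ψ, fun q => hl a _ _ ?_⟩
  have := hψ (φ.symm q)
  rw [← mul_assoc, hφ, MulEquiv.apply_symm_apply] at this
  rw [← mul_assoc, this, mul_assoc]
  rfl

theorem Conjugates.quot_right {M : Type*} [Monoid M] (hr : ∀ a b c : M, a * c = b * c → a = b)
    {P Q R : Submonoid M} {a b : M} (hb : Conjugates Q R b) (hab : Conjugates P R (a * b)) :
    Conjugates P Q a := by
  obtain ⟨φ, hφ⟩ := hb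
  obtain ⟨ψ, hψ⟩ := hab
  refine ⟨ψ.trans φ.symm, fun p => hr _ _ b ?_⟩
  rw [mul_assoc, hψ, mul_assoc, mul_assoc]
  congr 1
  have := hφ (φ.symm (ψ p))
  rw [MulEquiv.apply_symm_apply] at this
  exact this.symm

/-- By left cancellation `Q` can only be the set of `q` for which `a * q` lies in `P a`. Hence
ribbons from `P` may be treated as plain elements of the monoid. -/
theorem Conjugates.target_unique {M : Type*} [Monoid M]
    (hl : ∀ a b c : M, a * b = a * c → b = c) {P Q Q' : Submonoid M} {a : M}
    (h : Conjugates P Q a) (h' : Conjugates P Q' a) : Q = Q' := by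
  have key : ∀ {Q Q' : Submonoid M}, Conjugates P Q a → Conjugates P Q' a → Q ≤ Q' := by
    rintro Q Q' ⟨φ, hφ⟩ ⟨ψ, hψ⟩ q hq
    have h1 := hφ (φ.symm ⟨q, hq⟩)
    rw [hψ, MulEquiv.apply_symm_apply] at h1
    have h2 : (ψ (φ.symm ⟨q, hq⟩) : M) = q := hl a _ _ h1
    rw [← h2]
    exact Subtype.property _
  exact le_antisymm (key h h') (key h' h)

theorem Conjugates.source_unique {M : Type*} [Monoid M]
    (hr : ∀ a b c : M, a * c = b * c → a = b) {P P' Q : Submonoid M} {a : M}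
    (h : Conjugates P Q a) (h' : Conjugates P' Q a) : P = P' := by
  have key : ∀ {P P' : Submonoid M}, Conjugates P Q a → Conjugates P' Q a → P ≤ P' := by
    rintro P P' ⟨φ, hφ⟩ ⟨ψ, hψ⟩ p hp
    have h1 := hψ (ψ.symm (φ ⟨p, hp⟩))
    rw [MulEquiv.apply_symm_apply, ← hφ] at h1
    have h2 : (ψ.symm (φ ⟨p, hp⟩) : M) = p := hr _ _ a h1
    rw [← h2]
    exact Subtype.property _
  exact le_antisymm (key h h') (key h' h)

end Conjugates

end GarsideElement

/-! ### The positive ribbon category -/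

section PositiveRibbon

theorem arrow_mk_eq_of_isIdentity {C : Type*} [Category C] {a b c d : C} {u : a ⟶ b} {v : c ⟶ d}
    {x : c ⟶ a} {y : b ⟶ d} (hx : IsIdentity x) (hy : IsIdentity y) (h : v = x ≫ u ≫ y) :
    Arrow.mk u = Arrow.mk v := by
  cases hx
  cases hy
  simp only [Category.id_comp, Category.comp_id] at h
  rw [h]

theorem arrow_eq_of_isIdentity {C : Type*} [Category C] {w w' : Arrow C} {x : w'.left ⟶ w.left}
    {y : w.right ⟶ w'.right} (hx : IsIdentity x) (hy : IsIdentity y)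
    (h : w'.hom = x ≫ w.hom ≫ y) : w = w' :=
  arrow_mk_eq_of_isIdentity hx hy h

variable {M : Type*} [Monoid M] {Δ : M}

namespace PositiveRibbon

theorem hom_ext {P Q : PositiveRibbon Δ} {f g : P ⟶ Q} (h : elt f = elt g) : f = g :=
  InducedCategory.hom_ext (SubCat.Hom.ext h)

theorem obj_ext {P Q : PositiveRibbon Δ} (h : P.obj.sub = Q.obj.sub) : P = Q := by
  obtain ⟨⟨P⟩, hP⟩ := P
  obtain ⟨⟨Q⟩, hQ⟩ := Q
  subst h
  rfl

/-- The positive ribbon given by an element. -/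
def mkHom {P Q : PositiveRibbon Δ} (a : M) (ha : Conjugates P.obj.sub Q.obj.sub a) : P ⟶ Q :=
  InducedCategory.homMk ⟨a, ha⟩

theorem conj {P Q : PositiveRibbon Δ} (f : P ⟶ Q) : Conjugates P.obj.sub Q.obj.sub (elt f) :=
  f.hom.conj

@[simp] theorem elt_comp {P Q R : PositiveRibbon Δ} (f : P ⟶ Q) (g : Q ⟶ R) :
    elt (f ≫ g) = elt f * elt g := rfl

@[simp] theorem elt_eqToHom {P Q : PositiveRibbon Δ} (h : P = Q) : elt (eqToHom h) = 1 := by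
  subst h
  rfl

theorem isIdentity_iff (hl : ∀ a b c : M, a * b = a * c → b = c) {P Q : PositiveRibbon Δ}
    (f : P ⟶ Q) : IsIdentity f ↔ elt f = 1 := by
  constructor
  · rintro ⟨⟩
    rfl
  · intro h
    have hPQ : P = Q := obj_ext
      ((Conjugates.one P.obj.sub).target_unique hl (h ▸ conj f : Conjugates _ Q.obj.sub 1))
    subst hPQ
    rw [hom_ext (f := f) (g := 𝟙 P) h]
    exact IsIdentity.id P

variable (Δ) in
/-- Positive ribbons as elements of the monoid, by source. -/
def ribbonsFrom (hl : ∀ a b c : M, a * b = a * c → b = c) :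
    TypedElements M (PositiveRibbon Δ) where
  rel P a Q := Conjugates P.obj.sub Q.obj.sub a
  one _ := Conjugates.one _
  mul := Conjugates.mul
  quot := Conjugates.quot_left hl

variable (Δ) in
/-- Positive ribbons as elements of the opposite monoid, by target. -/
def ribbonsTo (hr : ∀ a b c : M, a * c = b * c → a = b) :
    TypedElements Mᵐᵒᵖ (PositiveRibbon Δ) where
  rel P a Q := Conjugates Q.obj.sub P.obj.sub a.unop
  one _ := Conjugates.one _
  mul ha hb := hb.mul ha
  quot ha hab := ha.quot_right hr hab

/-- The morphisms with source `P`, as elements. -/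
noncomputable def equivFrom (hl : ∀ a b c : M, a * b = a * c → b = c) (P : PositiveRibbon Δ) :
    MorFrom P ≃ (ribbonsFrom Δ hl).outs P :=
  Equiv.ofBijective (fun f => ⟨elt f.2, f.1, conj f.2⟩) (by
    constructor
    · rintro ⟨Q, f⟩ ⟨Q', f'⟩ h
      have he : elt f = elt f' := congrArg Subtype.val h
      have hQ : Q = Q' := obj_ext ((conj f).target_unique hl (he ▸ conj f'))
      subst hQ
      rw [hom_ext he]
    · rintro ⟨a, Q, ha⟩
      exact ⟨⟨Q, mkHom a ha⟩, rfl⟩)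

/-- The morphisms with target `P`, as elements. -/
noncomputable def equivTo (hr : ∀ a b c : M, a * c = b * c → a = b) (P : PositiveRibbon Δ) :
    MorTo P ≃ (ribbonsTo Δ hr).outs P :=
  Equiv.ofBijective (fun f => ⟨MulOpposite.op (elt f.2), f.1, conj f.2⟩) (by
    constructor
    · rintro ⟨Q, f⟩ ⟨Q', f'⟩ h
      have he : elt f = elt f' := MulOpposite.op_injective (congrArg Subtype.val h)
      have hQ : Q = Q' := obj_ext ((conj f).source_unique hr (he ▸ conj f'))
      subst hQ
      rw [hom_ext he]
    · rintro ⟨a, Q, ha⟩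
      exact ⟨⟨Q, mkHom a.unop ha⟩, rfl⟩)

theorem leftDivides_iff (hl : ∀ a b c : M, a * b = a * c → b = c) {P : PositiveRibbon Δ}
    (f g : MorFrom P) : LeftDivides f g ↔ LeftDvd (elt f.2) (elt g.2) := by
  constructor
  · rintro ⟨x, hx⟩
    exact ⟨elt x, by rw [← hx]; rfl⟩
  · rintro ⟨x, hx⟩
    exact ⟨mkHom x ((conj f.2).quot_left hl (hx ▸ conj g.2)), hom_ext hx.symm⟩

theorem rightDivides_iff (hr : ∀ a b c : M, a * c = b * c → a = b) {P : PositiveRibbon Δ}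
    (f g : MorTo P) : RightDivides f g ↔ RightDvd (elt f.2) (elt g.2) := by
  constructor
  · rintro ⟨x, hx⟩
    exact ⟨elt x, by rw [← hx]; rfl⟩
  · rintro ⟨x, hx⟩
    exact ⟨mkHom x ((conj f.2).quot_right hr (hx ▸ conj g.2)), hom_ext hx.symm⟩

theorem rightDvd_iff_op (a b : M) :
    RightDvd a b ↔ LeftDvd (MulOpposite.op a) (MulOpposite.op b) :=
  ⟨fun ⟨x, hx⟩ => ⟨MulOpposite.op x, by rw [hx]; rfl⟩,
    fun ⟨x, hx⟩ => ⟨x.unop, MulOpposite.op_injective hx⟩⟩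

end PositiveRibbon

/-! ### Transport of parabolic submonoids along automorphisms fixing `Δ` -/

section Transport

variable (χ : M ≃* M)

theorem leftDvd_map_iff (a b : M) : LeftDvd (χ a) (χ b) ↔ LeftDvd a b := by
  constructor
  · rintro ⟨x, hx⟩
    exact ⟨χ.symm x, χ.injective (by rw [hx, map_mul, MulEquiv.apply_symm_apply])⟩
  · rintro ⟨x, rfl⟩
    exact ⟨χ x, map_mul _ _ _⟩

theorem rightDvd_map_iff (a b : M) : RightDvd (χ a) (χ b) ↔ RightDvd a b := by
  constructor
  · rintro ⟨x, hx⟩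
    exact ⟨χ.symm x, χ.injective (by rw [hx, map_mul, MulEquiv.apply_symm_apply])⟩
  · rintro ⟨x, rfl⟩
    exact ⟨χ x, map_mul _ _ _⟩

theorem isJoin_map {r : M → M → Prop} (hr : ∀ a b, r (χ a) (χ b) ↔ r a b) {a b m : M} :
    IsJoin r (χ a) (χ b) (χ m) ↔ IsJoin r a b m := by
  unfold IsJoin
  rw [hr, hr, χ.surjective.forall]
  simp_rw [hr]

theorem isMeet_map {r : M → M → Prop} (hr : ∀ a b, r (χ a) (χ b) ↔ r a b) {a b m : M} :
    IsMeet r (χ a) (χ b) (χ m) ↔ IsMeet r a b m := by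
  unfold IsMeet
  rw [hr, hr, χ.surjective.forall]
  simp_rw [hr]

theorem mem_map_iff {P : Submonoid M} {a : M} : χ a ∈ P.map χ ↔ a ∈ P :=
  Submonoid.mem_map_iff_mem χ.injective

theorem Conjugates.map {P Q : Submonoid M} {a : M} (h : Conjugates P Q a) :
    Conjugates (P.map χ) (Q.map χ) (χ a) := by
  obtain ⟨ψ, hψ⟩ := h
  refine ⟨((χ.submonoidMap P).symm.trans ψ).trans (χ.submonoidMap Q), fun p => ?_⟩
  obtain ⟨p, rfl⟩ := (χ.submonoidMap P).surjective p
  have := congrArg χ (hψ p)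
  rw [map_mul, map_mul] at this
  rw [MulEquiv.trans_apply, MulEquiv.trans_apply, MulEquiv.symm_apply_apply]
  exact this

theorem IsParabolic.map (hχ : χ Δ = Δ) {P : Submonoid M} (h : IsParabolic Δ P) :
    IsParabolic Δ (P.map χ) := by
  have key : ∀ {q : M → M → M → Prop}, (∀ a b m, q (χ a) (χ b) (χ m) ↔ q a b m) →
      (∀ a ∈ P, ∀ b ∈ P, ∀ m, q a b m → m ∈ P) →
      ∀ a ∈ P.map χ, ∀ b ∈ P.map χ, ∀ m, q a b m →
        m ∈ P.map χ := by
    intro q hq H' a ha b hb m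
    obtain ⟨a, rfl⟩ := χ.surjective a
    obtain ⟨b, rfl⟩ := χ.surjective b
    obtain ⟨m, rfl⟩ := χ.surjective m
    rw [mem_map_iff] at ha hb ⊢
    rw [hq]
    exact H' a ha b hb m
  refine ⟨key (fun a b m => isJoin_map χ (leftDvd_map_iff χ)) h.left_join,
    key (fun a b m => isMeet_map χ (leftDvd_map_iff χ)) h.left_meet,
    key (fun a b m => isJoin_map χ (rightDvd_map_iff χ)) h.right_join,
    key (fun a b m => isMeet_map χ (rightDvd_map_iff χ)) h.right_meet, ?_⟩
  obtain ⟨δ, hδ, h1, h2⟩ := h.exists_garside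
  refine ⟨χ δ, hδ.map χ, ?_, ?_⟩
  · ext g
    obtain ⟨g, rfl⟩ := χ.surjective g
    have := Set.ext_iff.1 h1 g
    simp only [Set.mem_ofPred_eq, Set.mem_inter_iff, SetLike.mem_coe] at this ⊢
    conv_rhs => rw [← hχ]
    rw [leftDvd_map_iff, leftDvd_map_iff, mem_map_iff, this]
  · ext g
    obtain ⟨g, rfl⟩ := χ.surjective g
    have := Set.ext_iff.1 h2 g
    simp only [Set.mem_ofPred_eq, Set.mem_inter_iff, SetLike.mem_coe] at this ⊢
    conv_lhs => rw [← hχ]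
    rw [leftDvd_map_iff, mem_map_iff, this]
    constructor
    · rintro ⟨p, hp, hm⟩
      refine ⟨χ p, (mem_map_iff χ).2 hp, ?_⟩
      conv => arg 2; rw [← hχ]
      exact (isMeet_map χ (leftDvd_map_iff χ)).2 hm
    · rintro ⟨_, ⟨p, hp, rfl⟩, hm⟩
      refine ⟨p, hp, (isMeet_map χ (leftDvd_map_iff χ)).1 ?_⟩
      rw [hχ]
      exact hm

/-- The functor on positive ribbons induced by an automorphism fixing `Δ`. -/
def PositiveRibbon.mapFunctor (hχ : χ Δ = Δ) : PositiveRibbon Δ ⥤ PositiveRibbon Δ where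
  obj P := ⟨⟨P.obj.sub.map χ⟩, P.property.map χ hχ⟩
  map f := PositiveRibbon.mkHom (χ (PositiveRibbon.elt f)) ((PositiveRibbon.conj f).map χ)
  map_id _ := PositiveRibbon.hom_ext (map_one χ)
  map_comp _ _ := PositiveRibbon.hom_ext (map_mul χ _ _)

theorem PositiveRibbon.mapFunctor_isIsomorphism (hχ : χ Δ = Δ) :
    IsIsomorphism (PositiveRibbon.mapFunctor χ hχ) := by
  have hχ' : χ.symm Δ = Δ := by rw [MulEquiv.symm_apply_eq, hχ]
  refine ⟨PositiveRibbon.mapFunctor χ.symm hχ', ?_, ?_⟩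
  · refine CategoryTheory.Functor.ext (fun P => PositiveRibbon.obj_ext ?_) fun P Q f =>
      PositiveRibbon.hom_ext ?_
    · change (P.obj.sub.map χ).map χ.symm = P.obj.sub
      ext x
      rw [← χ.symm_apply_apply x, mem_map_iff, mem_map_iff, χ.symm_apply_apply]
    · simp only [PositiveRibbon.elt_comp, PositiveRibbon.elt_eqToHom, one_mul, mul_one]
      exact χ.symm_apply_apply _
  · refine CategoryTheory.Functor.ext (fun P => PositiveRibbon.obj_ext ?_) fun P Q f =>
      PositiveRibbon.hom_ext ?_
    · change (P.obj.sub.map χ.symm).map χ = P.obj.sub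
      ext x
      rw [← χ.apply_symm_apply x, mem_map_iff, mem_map_iff, χ.apply_symm_apply]
    · simp only [PositiveRibbon.elt_comp, PositiveRibbon.elt_eqToHom, one_mul, mul_one]
      exact χ.apply_symm_apply _

end Transport

/-! ### Lattices, noetherianity and Garside structure of the positive ribbon category -/

namespace IsGarsideElement

variable {φ : M ≃* M} (h : IsGarsideElement Δ φ)

include h

theorem conjugates_map_pow (P : Submonoid M) (n : ℕ) :
    Conjugates P (P.map (φ ^ n)) (Δ ^ n) :=
  ⟨(φ ^ n).submonoidMap P, fun p => h.mul_pow_eq n p⟩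

theorem map_pow_garside (n : ℕ) : (φ ^ n) Δ = Δ := by
  induction n with
  | zero => rfl
  | succ n ih =>
    rw [pow_succ]
    exact (congrArg _ h.map_self).trans ih

theorem exists_pow_dvd_pow (a b : M) : ∃ n, LeftDvd a (Δ ^ n) ∧ LeftDvd b (Δ ^ n) := by
  obtain ⟨n, hn⟩ := h.exists_leftDvd_pow a
  obtain ⟨m, hm⟩ := h.exists_leftDvd_pow b
  exact ⟨n + m, hn.trans ⟨Δ ^ m, pow_add _ _ _⟩, hm.trans ⟨Δ ^ n, by rw [add_comm, pow_add]⟩⟩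

theorem exists_pow_rightDvd_pow (a b : M) : ∃ n, RightDvd a (Δ ^ n) ∧ RightDvd b (Δ ^ n) := by
  obtain ⟨n, x, hn⟩ := h.exists_rightDvd_pow a
  obtain ⟨m, y, hm⟩ := h.exists_rightDvd_pow b
  exact ⟨n + m, ⟨Δ ^ m * x, by rw [mul_assoc, ← hn, ← pow_add, add_comm]⟩,
    ⟨Δ ^ n * y, by rw [mul_assoc, ← hm, ← pow_add]⟩⟩

theorem conjugates_pow_target (P : PositiveRibbon Δ) (n : ℕ) :
    ∃ Q : PositiveRibbon Δ, Conjugates P.obj.sub Q.obj.sub (Δ ^ n) :=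
  ⟨(PositiveRibbon.mapFunctor (φ ^ n) (h.map_pow_garside n)).obj P, h.conjugates_map_pow _ n⟩

theorem conjugates_pow_source (P : PositiveRibbon Δ) (n : ℕ) :
    ∃ Q : PositiveRibbon Δ, Conjugates Q.obj.sub P.obj.sub (Δ ^ n) := by
  obtain ⟨G, -, hG⟩ := PositiveRibbon.mapFunctor_isIsomorphism (φ ^ n) (h.map_pow_garside n)
  refine ⟨G.obj P, ?_⟩
  have := h.conjugates_map_pow (G.obj P).obj.sub n
  rwa [show (G.obj P).obj.sub.map (φ ^ n) = P.obj.sub from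
    congrArg (fun Q : PositiveRibbon Δ => Q.obj.sub)
      (CategoryTheory.Functor.congr_obj hG P)] at this

/-- The prefixes demanded by `TypedElements.isLatticeOrder_outs` are the values of `ν` at atoms
dividing the two ribbons. Their lcm in the monoid is a ribbon, so it is also their lcm among
ribbons. -/
theorem ribbon_left_lattice (hν : HasNuFunction Δ) (P : PositiveRibbon Δ) :
    IsLatticeOrder (LeftDivides (x := P)) := by
  refine IsLatticeOrder.of_equiv (PositiveRibbon.equivFrom h.left_cancel P)
    (fun f g => PositiveRibbon.leftDivides_iff h.left_cancel f g)
    (TypedElements.isLatticeOrder_outs h.left_cancel h.wellFounded_right ?_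
      (fun a b => h.eq_one_of_mul_eq_one) ?_ P)
  · rintro P a ⟨Qa, ha⟩ b ⟨Qb, hb⟩ k - ha1 hb1 - -
    obtain ⟨ν, hν1, hν2, hν3⟩ := hν P
    obtain ⟨s, hs⟩ := h.exists_atom_leftDvd ha1
    obtain ⟨t, ht⟩ := h.exists_atom_leftDvd hb1
    obtain ⟨m, hm⟩ := h.exists_left_join (PositiveRibbon.elt (ν s).2) (PositiveRibbon.elt (ν t).2)
    obtain ⟨g, rfl⟩ := hν3 s t m hm
    have hne : ∀ s, PositiveRibbon.elt (ν s).2 ≠ 1 := fun s hs =>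
      (hν1 s).1 ((PositiveRibbon.isIdentity_iff h.left_cancel _).2 hs)
    exact ⟨_, ⟨_, PositiveRibbon.conj (ν s).2⟩, _, ⟨_, PositiveRibbon.conj (ν t).2⟩, hne s, hne t,
      hν2 s ⟨Qa, PositiveRibbon.mkHom a ha⟩ hs, hν2 t ⟨Qb, PositiveRibbon.mkHom b hb⟩ ht,
      PositiveRibbon.elt g.2, ⟨g.1, PositiveRibbon.conj g.2⟩, hm.1, hm.2.1,
      fun c _ hc hc' => hm.2.2 c hc hc'⟩
  · rintro P a - b -
    obtain ⟨n, ha, hb⟩ := h.exists_pow_dvd_pow a b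
    exact ⟨Δ ^ n, h.conjugates_pow_target P n, ha, hb⟩

/-- This is the argument of `ribbon_left_lattice` in the opposite monoid, with targets fixed instead
of sources. -/
theorem ribbon_right_lattice (hν : HasNuTildeFunction Δ) (P : PositiveRibbon Δ) :
    IsLatticeOrder (RightDivides (x := P)) := by
  have hunop : ∀ a : Mᵐᵒᵖ, a ≠ 1 → a.unop ≠ 1 := fun a ha h1 => ha (MulOpposite.unop_injective h1)
  refine IsLatticeOrder.of_equiv (PositiveRibbon.equivTo h.right_cancel P)
    (fun f g => (PositiveRibbon.rightDivides_iff h.right_cancel f g).trans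
      (PositiveRibbon.rightDvd_iff_op _ _))
    (TypedElements.isLatticeOrder_outs (fun a b c hbc => MulOpposite.unop_injective
      (h.right_cancel _ _ a.unop (congrArg MulOpposite.unop hbc)))
      (Subrelation.wf (fun {a b} ⟨x, hx, hb⟩ => ⟨x.unop, hunop x hx, by rw [hb]; rfl⟩)
        (InvImage.wf MulOpposite.unop h.wellFounded_left)) ?_
      (fun a b hab => MulOpposite.unop_injective
        (h.eq_one_of_mul_eq_one' (congrArg MulOpposite.unop hab))) ?_ P)
  · rintro P a ⟨Qa, ha⟩ b ⟨Qb, hb⟩ k - ha1 hb1 - -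
    obtain ⟨ν, hν1, hν2, hν3⟩ := hν P
    obtain ⟨s, hs⟩ := h.exists_atom_rightDvd (hunop a ha1)
    obtain ⟨t, ht⟩ := h.exists_atom_rightDvd (hunop b hb1)
    obtain ⟨m, hm⟩ := (h.right_lattice.2.2.2 (PositiveRibbon.elt (ν s).2)
      (PositiveRibbon.elt (ν t).2)).1
    obtain ⟨g, rfl⟩ := hν3 s t m hm
    have hne : ∀ s, MulOpposite.op (PositiveRibbon.elt (ν s).2) ≠ 1 := fun s hs =>
      (hν1 s).1 ((PositiveRibbon.isIdentity_iff h.left_cancel _).2 (MulOpposite.op_injective hs))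
    exact ⟨MulOpposite.op _, ⟨_, PositiveRibbon.conj (ν s).2⟩, MulOpposite.op _,
      ⟨_, PositiveRibbon.conj (ν t).2⟩, hne s, hne t,
      (PositiveRibbon.rightDvd_iff_op _ _).1 (hν2 s ⟨Qa, PositiveRibbon.mkHom a.unop ha⟩ hs),
      (PositiveRibbon.rightDvd_iff_op _ _).1 (hν2 t ⟨Qb, PositiveRibbon.mkHom b.unop hb⟩ ht),
      MulOpposite.op (PositiveRibbon.elt g.2), ⟨g.1, PositiveRibbon.conj g.2⟩,
      (PositiveRibbon.rightDvd_iff_op _ _).1 hm.1, (PositiveRibbon.rightDvd_iff_op _ _).1 hm.2.1,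
      fun c _ hc hc' => (PositiveRibbon.rightDvd_iff_op _ _).1
        (hm.2.2 c.unop ((PositiveRibbon.rightDvd_iff_op _ _).2 hc)
          ((PositiveRibbon.rightDvd_iff_op _ _).2 hc'))⟩
  · rintro P a - b -
    obtain ⟨n, ha, hb⟩ := h.exists_pow_rightDvd_pow a.unop b.unop
    exact ⟨MulOpposite.op (Δ ^ n), h.conjugates_pow_source P n,
      (PositiveRibbon.rightDvd_iff_op _ _).1 ha, (PositiveRibbon.rightDvd_iff_op _ _).1 hb⟩

/-- Once the underlying elements are constant, the outer factors between consecutive terms have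
element `1`. Such ribbons are identities, so sources and targets are constant too. -/
theorem ribbon_noetherian : IsNoetherianCat (PositiveRibbon Δ) := by
  intro w hw
  obtain ⟨N, hN⟩ := h.noetherian (fun i => PositiveRibbon.elt (w i).hom) (fun i => by
    obtain ⟨x, y, hxy⟩ := hw i
    refine ⟨PositiveRibbon.elt x, PositiveRibbon.elt y, ?_⟩
    rw [hxy]
    exact (mul_assoc _ _ _).symm)
  have key : ∀ i, N ≤ i → w (i + 1) = w i := by
    intro i hi
    obtain ⟨x, y, hxy⟩ := hw i
    have e : PositiveRibbon.elt (w (i + 1)).hom = PositiveRibbon.elt (w i).hom :=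
      (hN (i + 1) (hi.trans (Nat.le_succ i))).trans (hN i hi).symm
    have e' : PositiveRibbon.elt x * PositiveRibbon.elt (w (i + 1)).hom * PositiveRibbon.elt y =
        PositiveRibbon.elt (w (i + 1)).hom := by
      rw [mul_assoc]
      exact (congrArg PositiveRibbon.elt hxy).symm.trans e.symm
    have hx := (PositiveRibbon.isIdentity_iff h.left_cancel x).2 (h.left_factor_eq_one e')
    have hy := (PositiveRibbon.isIdentity_iff h.left_cancel y).2 (h.right_factor_eq_one e')
    exact arrow_eq_of_isIdentity hx hy hxy
  exact ⟨N, fun i hi => by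
    induction i, hi using Nat.le_induction with
    | base => rfl
    | succ i hi ih => rw [key i hi, ih]⟩

theorem positiveRibbonIsGarside (hν : HasNuStructure Δ) : PositiveRibbonIsGarside Δ := by
  refine ⟨PositiveRibbon.mapFunctor φ h.map_self,
    ⟨fun P => PositiveRibbon.mkHom Δ ⟨φ.submonoidMap P.obj.sub, fun p => h.mul_eq p⟩,
      fun P Q f => PositiveRibbon.hom_ext (h.mul_eq _)⟩,
    ⟨PositiveRibbon.mapFunctor_isIsomorphism _ _, h.ribbon_noetherian, fun P Q f => ⟨⟨?_⟩, ⟨?_⟩⟩,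
      h.ribbon_left_lattice hν.1, h.ribbon_right_lattice hν.2, fun P Q f hf => ?_⟩, fun P => rfl⟩
  · exact fun a b hab => PositiveRibbon.hom_ext
      (h.left_cancel _ _ _ (congrArg PositiveRibbon.elt hab))
  · exact fun a b hab => PositiveRibbon.hom_ext
      (h.right_cancel _ _ _ (congrArg PositiveRibbon.elt hab))
  · obtain ⟨ν, hν1, hν2, -⟩ := hν.1 P
    have hf1 : PositiveRibbon.elt f ≠ 1 := fun h1 =>
      hf.1 ((PositiveRibbon.isIdentity_iff h.left_cancel f).2 h1)
    obtain ⟨s, hs⟩ := h.exists_atom_leftDvd hf1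
    -- An atom `f` of the ribbon category is one of the `ν s`: choose an atom `s` of the monoid
    -- dividing `f`; then `ν s` divides `f` and is not an identity, so the cofactor is.
    obtain ⟨c, hc⟩ := (PositiveRibbon.leftDivides_iff h.left_cancel _ ⟨Q, f⟩).2
      (hν2 s ⟨Q, f⟩ hs)
    have hc1 : PositiveRibbon.elt c = 1 := (PositiveRibbon.isIdentity_iff h.left_cancel c).1
      ((hf.2 _ _ _ hc).resolve_left (hν1 s).1)
    have hfe : PositiveRibbon.elt (ν s).2 = PositiveRibbon.elt f := by
      have := congrArg PositiveRibbon.elt hc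
      rwa [PositiveRibbon.elt_comp, hc1, mul_one] at this
    let D : P ⟶ (PositiveRibbon.mapFunctor φ h.map_self).obj P :=
      PositiveRibbon.mkHom Δ ⟨φ.submonoidMap P.obj.sub, fun p => h.mul_eq p⟩
    -- The element `Δ` is itself a ribbon from `P` divisible by `s`, hence by `ν s`, which is `f`.
    have hd := hν2 s ⟨_, D⟩ (h.atom_dvd s)
    rw [hfe] at hd
    obtain ⟨g, hg⟩ := (PositiveRibbon.leftDivides_iff h.left_cancel ⟨Q, f⟩ ⟨_, D⟩).2 hd
    refine ⟨g, hg, PositiveRibbon.hom_ext (h.left_cancel (PositiveRibbon.elt f) _ _ ?_)⟩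
    have e : PositiveRibbon.elt f * PositiveRibbon.elt g = Δ := congrArg PositiveRibbon.elt hg
    change PositiveRibbon.elt f * (PositiveRibbon.elt g * φ (PositiveRibbon.elt f)) =
      PositiveRibbon.elt f * Δ
    rw [← mul_assoc, e, h.mul_eq]

end IsGarsideElement

end PositiveRibbon

/-! ### The Garside group as a group of fractions -/

section Fractions

variable {M : Type*} [Monoid M] {Δ : M}

/-- The monoid maps to the units of its Ore localization at all elements, so the formal group does
too. If two elements agree there, then `u * b = v * a` with `u = v`, and cancellation gives `a = b`.
-/
theorem toFormal_injective (hl : ∀ a b c : M, a * b = a * c → b = c)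
    (hr : ∀ a b c : M, a * c = b * c → a = b) (hore : ∀ a b : M, ∃ x y, x * a = y * b) :
    Function.Injective (toFormal M) := by
  choose x y hxy using hore
  let : OreLocalization.OreSet (⊤ : Submonoid M) :=
    { ore_right_cancel := fun a b c h => ⟨1, by rw [hr _ _ _ h]⟩
      oreNum := fun r s => y r s
      oreDenom := fun r s => ⟨x r s, trivial⟩
      ore_eq := fun r s => hxy r s }
  let f : M → (OreLocalization (⊤ : Submonoid M) M)ˣ :=
    fun a => OreLocalization.numeratorUnit ⟨a, trivial⟩
  have hf : ∀ a, ((f a : _) : OreLocalization (⊤ : Submonoid M) M) =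
    OreLocalization.numeratorHom a := fun a => rfl
  have hf' : ∀ a b, f a * f b = f (a * b) := fun a b => Units.ext (by
    rw [Units.val_mul, hf, hf, hf, map_mul])
  have hrel : ∀ r ∈ formalRels M, FreeGroup.lift f r = 1 := by
    rintro _ ⟨a, b, rfl⟩
    simp [hf']
  intro a b hab
  have h1 := congrArg (PresentedGroup.toGroup hrel) hab
  have h2 : f a = f b := by
    have e : ∀ c, PresentedGroup.toGroup hrel (toFormal M c) = f c := fun c =>
      PresentedGroup.toGroup.of hrel
    rwa [e, e] at h1
  have h3 := congrArg Units.val h2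
  rw [hf, hf, OreLocalization.numeratorHom_apply, OreLocalization.numeratorHom_apply,
    OreLocalization.oreDiv_eq_iff] at h3
  obtain ⟨u, v, h4, h5⟩ := h3
  simp only [Submonoid.coe_one, mul_one] at h5
  have h6 : (u : M) * b = v * a := h4
  rw [← h5] at h6
  exact (hl _ _ _ h6).symm

/-- The subgroup generated by a submonoid in which any two elements have a common right multiple
consists of fractions. -/
theorem mem_generatedSubgroup_iff {P : Submonoid M}
    (hP : ∀ p ∈ P, ∀ q ∈ P, ∃ x ∈ P, ∃ y ∈ P, p * x = q * y) {g : FormalGroup M} :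
    g ∈ generatedSubgroup P ↔ ∃ p ∈ P, ∃ q ∈ P, g = toFormal M p * (toFormal M q)⁻¹ := by
  constructor
  · intro hg
    induction hg using Subgroup.closure_induction with
    | mem g hg =>
      obtain ⟨p, hp, rfl⟩ := hg
      exact ⟨p, hp, 1, P.one_mem, by simp⟩
    | one => exact ⟨1, P.one_mem, 1, P.one_mem, by simp⟩
    | mul a b _ _ ha hb =>
      obtain ⟨p, hp, q, hq, rfl⟩ := ha
      obtain ⟨p', hp', q', hq', rfl⟩ := hb
      obtain ⟨x, hx, y, hy, hxy⟩ := hP q hq p' hp'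
      refine ⟨p * x, P.mul_mem hp hx, q' * y, P.mul_mem hq' hy, ?_⟩
      have h1 := congrArg (toFormal M) hxy
      rw [map_mul, map_mul] at h1
      have h2 : (toFormal M q)⁻¹ * toFormal M p' = toFormal M x * (toFormal M y)⁻¹ := by
        rw [eq_mul_inv_iff_mul_eq, mul_assoc, ← h1, inv_mul_cancel_left]
      rw [map_mul, map_mul, mul_inv_rev, mul_assoc, ← mul_assoc _ (toFormal M p'), h2]
      simp only [mul_assoc]
    | inv a _ ha =>
      obtain ⟨p, hp, q, hq, rfl⟩ := ha
      exact ⟨q, hq, p, hp, by simp⟩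
  · rintro ⟨p, hp, q, hq, rfl⟩
    exact mul_mem (Subgroup.subset_closure ⟨p, hp, rfl⟩)
      (inv_mem (Subgroup.subset_closure ⟨q, hq, rfl⟩))

theorem generatedSubgroup_top : generatedSubgroup (⊤ : Submonoid M) = ⊤ := by
  rw [eq_top_iff, ← PresentedGroup.closure_range_of]
  refine Subgroup.closure_mono ?_
  rintro _ ⟨a, rfl⟩
  exact ⟨a, trivial, rfl⟩

theorem conjugates_generatedSubgroup {P Q : Submonoid M} {a : M} (h : Conjugates P Q a) :
    Conjugates (generatedSubgroup P).toSubmonoid (generatedSubgroup Q).toSubmonoid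
      (toFormal M a) := by
  obtain ⟨ψ, hψ⟩ := h
  have hψ' : ∀ p : P, toFormal M p * toFormal M a = toFormal M a * toFormal M (ψ p) := fun p => by
    rw [← map_mul, hψ, map_mul]
  have h1 : generatedSubgroup P ≤
      (generatedSubgroup Q).comap (MulAut.conj (toFormal M a)⁻¹).toMonoidHom := by
    refine (Subgroup.closure_le _).2 ?_
    rintro _ ⟨p, hp, rfl⟩
    refine Subgroup.subset_closure ⟨ψ ⟨p, hp⟩, Subtype.property _, ?_⟩
    simp only [MulEquiv.toMonoidHom_eq_coe, MonoidHom.coe_coe, MulAut.conj_apply, inv_inv]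
    rw [mul_assoc, hψ' ⟨p, hp⟩, inv_mul_cancel_left]
  have h2 : generatedSubgroup Q ≤
      (generatedSubgroup P).comap (MulAut.conj (toFormal M a)).toMonoidHom := by
    refine (Subgroup.closure_le _).2 ?_
    rintro _ ⟨q, hq, rfl⟩
    refine Subgroup.subset_closure ⟨ψ.symm ⟨q, hq⟩, Subtype.property _, ?_⟩
    simp only [MulEquiv.toMonoidHom_eq_coe, MonoidHom.coe_coe, MulAut.conj_apply]
    have := hψ' (ψ.symm ⟨q, hq⟩)
    rw [MulEquiv.apply_symm_apply] at this
    rw [← this, mul_inv_cancel_right]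
  rw [Conjugates.iff_forall (fun _ _ _ => mul_left_cancel) (fun _ _ _ => mul_right_cancel)]
  refine ⟨fun g hg => ⟨_, h1 hg, ?_⟩, fun g hg => ⟨_, h2 hg, ?_⟩⟩
  · simp [mul_assoc]
  · simp [mul_assoc]

theorem conjugates_map_iff {N : Type*} [Monoid N] (f : M →* N) (hf : Function.Injective f)
    (hMl : ∀ a b c : M, a * b = a * c → b = c) (hMr : ∀ a b c : M, a * c = b * c → a = b)
    (hl : ∀ a b c : N, a * b = a * c → b = c) (hr : ∀ a b c : N, a * c = b * c → a = b)
    {P Q : Submonoid M} {a : M} :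
    Conjugates (P.map f) (Q.map f) (f a) ↔ Conjugates P Q a := by
  rw [Conjugates.iff_forall hMl hMr, Conjugates.iff_forall hl hr]
  simp only [Submonoid.mem_map, exists_exists_and_eq_and, forall_exists_index, and_imp,
    forall_apply_eq_imp_iff₂, ← map_mul, hf.eq_iff]

end Fractions

/-! ### Recognition of isomorphisms of categories -/

section Isomorphism

variable {C : Type*} [Category C] {D : Type*} [Category D]

theorem isIsomorphism_of_bijective (F : C ⥤ D) [F.Full] [F.Faithful]
    (hobj : Function.Bijective F.obj) : IsIsomorphism F := by
  let e := Equiv.ofBijective F.obj hobj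
  have he : ∀ Y, F.obj (e.symm Y) = Y := e.apply_symm_apply
  have he' : ∀ X, e.symm (F.obj X) = X := e.symm_apply_apply
  let G : D ⥤ C :=
    { obj := e.symm
      map := fun f => F.preimage (eqToHom (he _) ≫ f ≫ eqToHom (he _).symm)
      map_id := fun Y => F.map_injective (by simp)
      map_comp := fun f g => F.map_injective (by simp) }
  refine ⟨G, CategoryTheory.Functor.ext he' fun X Y f => F.map_injective ?_,
    CategoryTheory.Functor.ext he fun X Y f => ?_⟩
  · simp [G, eqToHom_map]
  · simp [G]

end Isomorphism

/-! ### The ribbon groupoid -/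

namespace RibbonGroupoid

variable {M : Type*} [Monoid M] {Δ : M}

theorem hom_ext {H K : RibbonGroupoid Δ} {f g : H ⟶ K} (h : elt f = elt g) : f = g :=
  RibbonGroupoid.Hom.ext h

end RibbonGroupoid

namespace IsGarsideElement

variable {M : Type*} [Monoid M] {Δ : M} {φ : M ≃* M} (h : IsGarsideElement Δ φ)

include h

theorem toFormal_injective : Function.Injective (toFormal M) :=
  RibbonGarside.toFormal_injective h.left_cancel h.right_cancel fun a b => by
    obtain ⟨n, ⟨x, hx⟩, ⟨y, hy⟩⟩ := h.exists_pow_rightDvd_pow a b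
    exact ⟨x, y, by rw [← hx, hy]⟩

/-- A positive element of the subgroup is a fraction `p q⁻¹` over `P`; so `m * q = p`, and `m` is in
`P` as a factor of `p`. The common multiples behind the fractions are joins, whose cofactors are in
`P` for the same reason. -/
theorem positivePart_generatedSubgroup {P : Submonoid M} (hP : IsParabolic Δ P) :
    positivePart (generatedSubgroup P) = P.map (toFormal M) := by
  have hcm : ∀ p ∈ P, ∀ q ∈ P, ∃ x ∈ P, ∃ y ∈ P, p * x = q * y := by
    intro p hp q hq
    obtain ⟨m, hm⟩ := h.exists_left_join p q
    have hmP := hP.left_join p hp q hq m hm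
    obtain ⟨⟨x, rfl⟩, ⟨y, hy⟩, -⟩ := hm
    exact ⟨x, (h.mem_of_mul_mem hP hmP).2, y, (h.mem_of_mul_mem hP (hy ▸ hmP)).2, hy⟩
  ext g
  constructor
  · rintro ⟨hg, m, rfl⟩
    obtain ⟨p, hp, q, hq, e⟩ := (mem_generatedSubgroup_iff hcm).1 hg
    rw [eq_mul_inv_iff_mul_eq, ← map_mul] at e
    have e' := h.toFormal_injective e
    exact ⟨m, (h.mem_of_mul_mem hP (e' ▸ hp)).1, rfl⟩
  · rintro ⟨p, hp, rfl⟩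
    exact ⟨Subgroup.subset_closure ⟨p, hp, rfl⟩, p, rfl⟩

theorem conjugates_positivePart_iff {P Q : Submonoid M} (hP : IsParabolic Δ P)
    (hQ : IsParabolic Δ Q) {a : M} :
    Conjugates (positivePart (generatedSubgroup P)) (positivePart (generatedSubgroup Q))
      (toFormal M a) ↔ Conjugates P Q a := by
  rw [h.positivePart_generatedSubgroup hP, h.positivePart_generatedSubgroup hQ]
  exact conjugates_map_iff _ h.toFormal_injective h.left_cancel h.right_cancel
    (fun _ _ _ => mul_left_cancel) (fun _ _ _ => mul_right_cancel)

theorem exists_mul_pow (g : FormalGroup M) : ∃ n a, g * toFormal M (Δ ^ n) = toFormal M a := by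
  have hg : g ∈ generatedSubgroup (⊤ : Submonoid M) := by
    rw [generatedSubgroup_top]
    trivial
  rw [mem_generatedSubgroup_iff] at hg
  · obtain ⟨p, -, q, -, rfl⟩ := hg
    obtain ⟨n, x, hx⟩ := h.exists_leftDvd_pow q
    exact ⟨n, p * x, by rw [hx, map_mul, map_mul, mul_assoc, inv_mul_cancel_left]⟩
  · intro p _ q _
    obtain ⟨n, ⟨x, hx⟩, ⟨y, hy⟩⟩ := h.exists_pow_dvd_pow p q
    exact ⟨x, trivial, y, trivial, hx.symm.trans hy⟩

/-- The functor from the positive ribbon category to the ribbon groupoid. -/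
def toRibbonGroupoid : PositiveRibbon Δ ⥤ RibbonGroupoid Δ where
  obj P := ⟨generatedSubgroup P.obj.sub, P.obj.sub, P.property, rfl⟩
  map {P Q} f := ⟨toFormal M (PositiveRibbon.elt f),
    conjugates_generatedSubgroup (PositiveRibbon.conj f),
    (h.conjugates_positivePart_iff P.property Q.property).2 (PositiveRibbon.conj f)⟩
  map_id _ := RibbonGroupoid.hom_ext (map_one (toFormal M))
  map_comp _ _ := RibbonGroupoid.hom_ext (map_mul (toFormal M) _ _)

/-- Two ribbons with the same source both divide a power of `Δ`, which is again a ribbon from that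
source. The cofactors are ribbons by left quotient and complete the square. -/
theorem hasLeftCalculusOfFractions :
    (⊤ : MorphismProperty (PositiveRibbon Δ)).HasLeftCalculusOfFractions where
  exists_leftFraction X Y r := by
    obtain ⟨n, x, hx⟩ := h.exists_leftDvd_pow (PositiveRibbon.elt r.f)
    obtain ⟨m, y, hy⟩ := h.exists_leftDvd_pow (PositiveRibbon.elt r.s)
    obtain ⟨T, hT⟩ := h.conjugates_pow_target r.X' (n + m)
    have e1 : PositiveRibbon.elt r.f * (x * Δ ^ m) = Δ ^ (n + m) := by
      rw [← mul_assoc, ← hx, pow_add]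
    have e2 : PositiveRibbon.elt r.s * (y * Δ ^ n) = Δ ^ (n + m) := by
      rw [← mul_assoc, ← hy, add_comm, pow_add]
    exact ⟨⟨PositiveRibbon.mkHom _ ((PositiveRibbon.conj r.s).quot_left h.left_cancel (e2 ▸ hT)),
      PositiveRibbon.mkHom _ ((PositiveRibbon.conj r.f).quot_left h.left_cancel (e1 ▸ hT)),
      trivial⟩, PositiveRibbon.hom_ext (e1.trans e2.symm)⟩
  ext X' X Y f g s _ hs := ⟨Y, 𝟙 Y, trivial, by
    rw [PositiveRibbon.hom_ext (h.left_cancel _ _ _ (congrArg PositiveRibbon.elt hs))]⟩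

theorem ribbonGroupoidIsFormalInverses : RibbonGroupoidIsFormalInverses Δ := by
  have := h.hasLeftCalculusOfFractions
  refine ⟨h.toRibbonGroupoid, fun _ => rfl, fun _ _ _ => rfl, ?_⟩
  -- The calculus of fractions reduces faithfulness to positive ribbons, where it is the injectivity
  -- of `toFormal`.
  have : (FreeGroupoid.lift h.toRibbonGroupoid).Faithful := by
    refine Functor.faithful_of_comp_of_hasLeftCalculusOfFractions (FreeGroupoid.of _) ⊤ _
      fun X Y f g hfg => ?_
    have e : h.toRibbonGroupoid.map f = h.toRibbonGroupoid.map g :=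
      (FreeGroupoid.lift_map_homMk _ f).symm.trans
        (hfg.trans (FreeGroupoid.lift_map_homMk _ g))
    rw [PositiveRibbon.hom_ext (h.toFormal_injective (congrArg RibbonGroupoid.elt e))]
  -- Multiplying a ribbon `g` by a large power of `Δ` gives a positive element `a`. Conjugation of
  -- the positive parts makes `a` a positive ribbon, so `g` is a quotient of two positive ribbons.
  have : (FreeGroupoid.lift h.toRibbonGroupoid).Full := by
    refine ⟨fun {X Y} g => ?_⟩
    obtain ⟨X, rfl⟩ := FreeGroupoid.of_obj_bijective.2 X
    obtain ⟨Y, rfl⟩ := FreeGroupoid.of_obj_bijective.2 Y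
    change h.toRibbonGroupoid.obj X ⟶ h.toRibbonGroupoid.obj Y at g
    obtain ⟨n, a, ha⟩ := h.exists_mul_pow (RibbonGroupoid.elt g)
    obtain ⟨T, hT⟩ := h.conjugates_pow_target Y n
    let d : Y ⟶ T := PositiveRibbon.mkHom _ hT
    have h1 := (g ≫ h.toRibbonGroupoid.map d).conj_positive
    have h2 : RibbonGroupoid.Hom.elt (g ≫ h.toRibbonGroupoid.map d) = toFormal M a := ha
    rw [h2] at h1
    let u : X ⟶ T := PositiveRibbon.mkHom a
      ((h.conjugates_positivePart_iff X.property T.property).1 h1)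
    refine ⟨FreeGroupoid.homMk u ≫ inv (FreeGroupoid.homMk d), ?_⟩
    have e : h.toRibbonGroupoid.map u = g ≫ h.toRibbonGroupoid.map d :=
      RibbonGroupoid.hom_ext ha.symm
    rw [Functor.map_comp, Functor.map_inv]
    refine (IsIso.comp_inv_eq ((FreeGroupoid.lift h.toRibbonGroupoid).map
      (FreeGroupoid.homMk d))).2 ?_
    exact (FreeGroupoid.lift_map_homMk _ u).trans
      (e.trans (congrArg (g ≫ ·) (FreeGroupoid.lift_map_homMk _ d).symm))
  -- On objects, `P` is recovered as the positive part of the subgroup that it generates.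
  refine isIsomorphism_of_bijective _ ⟨fun X Y hXY => ?_, fun H => ?_⟩
  · obtain ⟨X, rfl⟩ := FreeGroupoid.of_obj_bijective.2 X
    obtain ⟨Y, rfl⟩ := FreeGroupoid.of_obj_bijective.2 Y
    have h1 : generatedSubgroup X.obj.sub = generatedSubgroup Y.obj.sub :=
      congrArg RibbonGroupoid.sub hXY
    have h2 := congrArg positivePart h1
    rw [h.positivePart_generatedSubgroup X.property,
      h.positivePart_generatedSubgroup Y.property] at h2
    rw [PositiveRibbon.obj_ext (Submonoid.map_injective_of_injective h.toFormal_injective h2)]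
  · obtain ⟨P, hP, hH⟩ := H.standard
    exact ⟨FreeGroupoid.mk ⟨⟨P⟩, hP⟩, RibbonGroupoid.ext hH.symm⟩

end IsGarsideElement

end RibbonGarside

namespace CoxeterSystem

open List

variable {B W : Type*} [Group W] {M : CoxeterMatrix B} (cs : CoxeterSystem M W)

/-! ### The parity representation and the strong exchange property -/

open Classical in
/-- The action of a simple reflection on pairs of a group element and a parity. -/
noncomputable def parityPerm (i : B) : Equiv.Perm (W × ZMod 2) :=
  Function.Involutive.toPerm
    (fun x => (cs.simple i * x.1 * cs.simple i, x.2 + if x.1 = cs.simple i then 1 else 0)) (by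
      rintro ⟨t, e⟩
      have h : cs.simple i * t * cs.simple i = cs.simple i ↔ t = cs.simple i := by
        rw [mul_assoc, mul_eq_left, mul_eq_one_iff_eq_inv, inv_simple]
      ext
      · simp [mul_assoc]
      · simp only [h]
        split_ifs
        · rw [add_assoc, show (1 : ZMod 2) + 1 = 0 from rfl, add_zero]
        · simp)

open Classical in
theorem parityPerm_apply (i : B) (x : W × ZMod 2) : cs.parityPerm i x =
    (cs.simple i * x.1 * cs.simple i, x.2 + if x.1 = cs.simple i then 1 else 0) := rfl

theorem parityPerm_mul_self (i : B) : cs.parityPerm i * cs.parityPerm i = 1 := by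
  ext x : 1
  exact Function.Involutive.toPerm_involutive _ x

open Classical in
-- A letter changes the parity exactly when `t`, conjugated by the letters to its right, equals that
-- letter; that is, when `t` is the corresponding entry of the right inversion sequence.
theorem prod_parityPerm_apply (ω : List B) (t : W) (e : ZMod 2) :
    (ω.map cs.parityPerm).prod (t, e) =
      (cs.wordProd ω * t * (cs.wordProd ω)⁻¹, e + (cs.rightInvSeq ω).count t) := by
  induction ω with
  | nil => simp
  | cons i ω ih =>
    rw [List.map_cons, List.prod_cons, Equiv.Perm.mul_apply, ih, parityPerm_apply]
    have h : cs.wordProd ω * t * (cs.wordProd ω)⁻¹ = cs.simple i ↔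
        (cs.wordProd ω)⁻¹ * cs.simple i * cs.wordProd ω = t := by
      rw [mul_inv_eq_iff_eq_mul, eq_comm, mul_assoc, inv_mul_eq_iff_eq_mul]
    ext
    · simp [wordProd_cons, mul_assoc]
    · simp only [rightInvSeq, List.count_cons, h, beq_iff_eq]
      push_cast
      rw [add_assoc]

theorem map_alternatingWord_prod {G : Type*} [Monoid G] (f : B → G) (i j : B) (p : ℕ) :
    ((alternatingWord i j (2 * p)).map f).prod = (f i * f j) ^ p := by
  induction p with
  | zero => simp [alternatingWord]
  | succ p ih =>
    rw [show 2 * (p + 1) = 2 * p + 1 + 1 by ring, alternatingWord_succ, alternatingWord_succ]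
    simp [ih, pow_succ]

/-- The entries are a fixed simple reflection times successive powers of an element whose `M i j`-th
power is `1`, so the second half repeats the first. Every reflection therefore occurs an even number
of times. -/
theorem leftInvSeq_braid_sq (i j : B) :
    cs.leftInvSeq (alternatingWord i j (2 * M i j)) =
      (cs.leftInvSeq (alternatingWord i j (2 * M i j))).take (M i j) ++
        (cs.leftInvSeq (alternatingWord i j (2 * M i j))).take (M i j) := by
  conv_lhs => rw [← List.take_append_drop (M i j) (cs.leftInvSeq _)]
  congr 1
  apply List.ext_getElem
  · simp
    lia
  · intro k h1 h2
    simp only [length_drop, length_leftInvSeq, length_alternatingWord] at h1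
    rw [List.getElem_drop, List.getElem_take,
      cs.getElem_leftInvSeq_alternatingWord i j _ _ (by lia),
      cs.getElem_leftInvSeq_alternatingWord i j _ _ (by lia),
      prod_alternatingWord_eq_mul_pow, prod_alternatingWord_eq_mul_pow]
    have e1 : (2 * (M i j + k) + 1) / 2 = M i j + k := by lia
    have e2 : (2 * k + 1) / 2 = k := by lia
    have e3 : ∀ k, ¬ Even (2 * k + 1) := fun k => by simp
    rw [e1, e2, if_neg (e3 _), if_neg (e3 _), pow_add, cs.simple_mul_simple_pow' i j, one_mul]

theorem parityPerm_isLiftable : M.IsLiftable cs.parityPerm := by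
  classical
  intro i j
  have h : (cs.parityPerm j * cs.parityPerm i) ^ M i j = 1 := by
    -- Reversing the word turns its right inversion sequence into a left one, whose entries are
    -- explicit for alternating words.
    have hrev : (((alternatingWord i j (2 * M i j)).reverse).map cs.parityPerm).prod =
        (cs.parityPerm j * cs.parityPerm i) ^ M i j := by
      have hinv : ∀ i, (cs.parityPerm i)⁻¹ = cs.parityPerm i := fun i =>
        inv_eq_of_mul_eq_one_left (cs.parityPerm_mul_self i)
      rw [← inv_inj, ← inv_pow, mul_inv_rev, hinv, hinv, ← map_alternatingWord_prod,
        List.prod_inv_reverse, List.map_reverse, List.map_reverse, List.reverse_reverse, List.map_map]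
      congr 2
    rw [← hrev]
    ext1 ⟨t, e⟩
    rw [prod_parityPerm_apply, rightInvSeq_reverse, List.count_reverse, leftInvSeq_braid_sq,
      List.count_append, wordProd_reverse]
    have h1 : cs.wordProd (alternatingWord i j (2 * M i j)) = 1 := by
      rw [wordProd, map_alternatingWord_prod, cs.simple_mul_simple_pow]
    rw [h1, ← two_mul]
    push_cast
    rw [show (2 : ZMod 2) = 0 from rfl]
    simp
  have h2 := congrArg (·⁻¹) h
  simp only [← inv_pow, mul_inv_rev, inv_one] at h2
  rwa [inv_eq_of_mul_eq_one_left (cs.parityPerm_mul_self i),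
    inv_eq_of_mul_eq_one_left (cs.parityPerm_mul_self j)] at h2

/-- The parity representation of the Coxeter group. -/
noncomputable def parityRep : W →* Equiv.Perm (W × ZMod 2) :=
  cs.lift ⟨cs.parityPerm, cs.parityPerm_isLiftable⟩

theorem parityRep_simple (i : B) : cs.parityRep (cs.simple i) = cs.parityPerm i :=
  cs.lift_apply_simple _ i

open Classical in
theorem parityRep_wordProd (ω : List B) (t : W) (e : ZMod 2) :
    cs.parityRep (cs.wordProd ω) (t, e) =
      (cs.wordProd ω * t * (cs.wordProd ω)⁻¹, e + (cs.rightInvSeq ω).count t) := by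
  rw [← prod_parityPerm_apply, wordProd, map_list_prod, List.map_map]
  congr 3
  ext1 i
  exact cs.parityRep_simple i

/-- The parity with which a word for `w` has `t` in its right inversion sequence. -/
noncomputable def parity (w t : W) : ZMod 2 := (cs.parityRep w (t, 0)).2

theorem parityRep_apply (w t : W) (e : ZMod 2) :
    cs.parityRep w (t, e) = (w * t * w⁻¹, e + cs.parity w t) := by
  classical
  obtain ⟨ω, rfl⟩ := cs.wordProd_surjective w
  rw [parity, parityRep_wordProd, parityRep_wordProd, zero_add]

open Classical in
theorem parity_wordProd (ω : List B) (t : W) :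
    cs.parity (cs.wordProd ω) t = (cs.rightInvSeq ω).count t := by
  rw [parity, parityRep_wordProd, zero_add]

theorem parity_mul (u v t : W) :
    cs.parity (u * v) t = cs.parity v t + cs.parity u (v * t * v⁻¹) := by
  rw [parity, map_mul, Equiv.Perm.mul_apply, parityRep_apply, parityRep_apply, zero_add]

/-- Write `t = u s u⁻¹` and use the cocycle rule `parity_mul`: the contributions of `u` and `u⁻¹`
add up to the parity of `1`, which is zero, and `s` contributes `1`. -/
theorem parity_reflection {t : W} (ht : cs.IsReflection t) : cs.parity t t = 1 := by
  obtain ⟨u, i, rfl⟩ := ht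
  have h1 : cs.parity (cs.simple i) (cs.simple i) = 1 := by
    rw [parity, parityRep_simple, parityPerm_apply]
    simp
  have h2 : ∀ t, cs.parity 1 t = 0 := fun t => by simp [parity]
  have h3 := cs.parity_mul u u⁻¹ (u * cs.simple i * u⁻¹)
  rw [mul_inv_cancel, h2] at h3
  have e1 : u⁻¹ * (u * cs.simple i * u⁻¹) * u⁻¹⁻¹ = cs.simple i := by group
  rw [e1] at h3
  rw [parity_mul, parity_mul, e1, mul_inv_cancel_right, h1, add_left_comm, ← h3, add_zero]

/-- A right inversion of a product belongs to the right inversion sequence of every word for it. -/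
theorem IsRightInversion.mem_rightInvSeq {ω : List B} {t : W}
    (h : cs.IsRightInversion (cs.wordProd ω) t) : t ∈ cs.rightInvSeq ω := by
  classical
  obtain ⟨ht, hlt⟩ := h
  by_contra hmem
  have h0 : cs.parity (cs.wordProd ω) t = 0 := by
    rw [parity_wordProd, List.count_eq_zero_of_not_mem hmem]
    rfl
  -- Multiplication by `t` flips the parity at `t`. If `t` were missing from the sequence of `ω`, it
  -- would be an inversion of the shorter element `wordProd ω * t`, which is absurd.
  have h1 : cs.parity (cs.wordProd ω * t) t = 1 := by
    rw [parity_mul, parity_reflection cs ht, mul_inv_cancel_right, h0, add_zero]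
  obtain ⟨ω', hω', e⟩ := cs.exists_isReduced (cs.wordProd ω * t)
  rw [e, parity_wordProd] at h1
  have hmem' : t ∈ cs.rightInvSeq ω' := by
    by_contra h'
    rw [List.count_eq_zero_of_not_mem h'] at h1
    exact absurd h1 (by decide)
  have := (cs.isRightInversion_of_mem_rightInvSeq hω' hmem').2
  rw [← e, mul_assoc, ht.mul_self, mul_one] at this
  exact lt_asymm hlt this

/-- The strong exchange property. -/
theorem IsRightInversion.exists_eraseIdx {ω : List B} {t : W}
    (h : cs.IsRightInversion (cs.wordProd ω) t) :
    ∃ j < ω.length, cs.wordProd ω * t = cs.wordProd (ω.eraseIdx j) := by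
  obtain ⟨j, hj, e⟩ := List.mem_iff_getElem.1 h.mem_rightInvSeq
  refine ⟨j, by simpa using hj, ?_⟩
  rw [← wordProd_mul_getD_rightInvSeq, List.getD_eq_getElem _ _ hj, e]

/-- Parities depend only on the product. A reflection occurring once in the sequence of `ω` must
thus occur in that of a reduced word, which is then at least as long as `ω`. -/
theorem isReduced_of_nodup_rightInvSeq {ω : List B} (h : (cs.rightInvSeq ω).Nodup) :
    cs.IsReduced ω := by
  classical
  obtain ⟨ω', hω', e⟩ := cs.exists_isReduced (cs.wordProd ω)
  have hsub : cs.rightInvSeq ω ⊆ cs.rightInvSeq ω' := by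
    intro t ht
    by_contra h'
    have h1 := cs.parity_wordProd ω t
    rw [e, parity_wordProd, List.count_eq_zero_of_not_mem h', List.count_eq_one_of_mem h ht] at h1
    exact absurd h1 (by decide)
  have hle := (h.subperm hsub).length_le
  rw [length_rightInvSeq, length_rightInvSeq] at hle
  refine le_antisymm (cs.length_wordProd_le ω) ?_
  rw [e, hω'.eq]
  exact hle

theorem isReduced_of_nodup_leftInvSeq {ω : List B} (h : (cs.leftInvSeq ω).Nodup) :
    cs.IsReduced ω := by
  rw [← isReduced_reverse_iff]
  apply isReduced_of_nodup_rightInvSeq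
  rwa [rightInvSeq_reverse, List.nodup_reverse]

end CoxeterSystem

/-! ### The order of a product of two simple reflections -/

namespace CoxeterMatrix

open Polynomial.Chebyshev

variable {B : Type*} (M : CoxeterMatrix B)

/-- The coroot of the geometric representation: `2⟨eᵢ, ·⟩`. -/
noncomputable def geomCoroot (i : B) : Module.Dual ℝ (B →₀ ℝ) :=
  -- For the entry `0`, division by zero makes the angle `0` and the coefficient `-2`, the usual
  -- value for infinite order.
  Finsupp.linearCombination ℝ fun j => -2 * Real.cos (Real.pi / M i j)

/-- The root of the geometric representation. -/
noncomputable def geomRoot (i : B) : B →₀ ℝ := Finsupp.single i 1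

theorem geomCoroot_root (i j : B) :
    M.geomCoroot i (geomRoot j) = -2 * Real.cos (Real.pi / M i j) := by
  simp [geomCoroot, geomRoot]

theorem geomCoroot_self (i : B) : M.geomCoroot i (geomRoot i) = 2 := by
  rw [geomCoroot_root, M.diagonal]
  simp

/-- The simple reflections of the geometric representation. -/
noncomputable def geomReflection (i : B) : (B →₀ ℝ) ≃ₗ[ℝ] (B →₀ ℝ) :=
  Module.reflection (M.geomCoroot_self i)

theorem geomCoroot_mul (i j : B) :
    M.geomCoroot i (geomRoot j) * M.geomCoroot j (geomRoot i) - 2 =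
      2 * Real.cos (2 * (Real.pi / M i j)) := by
  rw [geomCoroot_root, geomCoroot_root, M.symmetric j i, Real.cos_two_mul]
  ring

theorem sin_two_pi_div_pos {m : ℕ} (hm : 3 ≤ m) : 0 < Real.sin (2 * (Real.pi / m)) := by
  have hm' : (3 : ℝ) ≤ m := by exact_mod_cast hm
  have hpi := Real.pi_pos
  apply Real.sin_pos_of_pos_of_lt_pi
  · positivity
  · rw [← mul_div_assoc, div_lt_iff₀ (by linarith)]
    nlinarith

theorem geomReflection_isLiftable : M.IsLiftable M.geomReflection := by
  intro i j
  -- The orders `1` and `2` are treated apart because `sin (2π / m)`, by which the Chebyshev formula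
  -- divides, vanishes for them.
  obtain hm | hm | hm | hm : M i j = 0 ∨ M i j = 1 ∨ M i j = 2 ∨ 3 ≤ M i j := by lia
  · rw [hm, pow_zero]
  · have hij : i = j := by
      by_contra h
      exact M.off_diagonal i j h hm
    subst hij
    rw [hm, pow_one]
    ext1 v
    exact Module.involutive_reflection (M.geomCoroot_self i) v
  · ext1 v
    refine (Module.reflection_mul_reflection_pow_apply (M.geomCoroot_self i) (M.geomCoroot_self j)
      _ v (M.geomCoroot i (geomRoot j) * M.geomCoroot j (geomRoot i) - 2) rfl).trans ?_
    have h0 : M.geomCoroot i (geomRoot j) = 0 := by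
      rw [geomCoroot_root, hm]
      simp
    have h1 : M.geomCoroot j (geomRoot i) = 0 := by
      rw [geomCoroot_root, M.symmetric, hm]
      simp
    rw [h0, h1, hm]
    norm_num
    abel
  · ext1 v
    refine (Module.reflection_mul_reflection_pow_apply (M.geomCoroot_self i) (M.geomCoroot_self j)
      _ v _ (M.geomCoroot_mul i j).symm).trans ?_
    have hsin := sin_two_pi_div_pos hm
    have hm0 : (M i j : ℝ) ≠ 0 := by
      have : (3 : ℝ) ≤ M i j := by exact_mod_cast hm
      linarith
    set θ := 2 * (Real.pi / M i j) with hθ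
    have key : ∀ k : ℤ, (S ℝ k).eval (2 * Real.cos θ) = Real.sin ((k + 1) * θ) / Real.sin θ :=
      fun k => by rw [eq_div_iff hsin.ne', S_two_mul_real_cos]
    have hmθ : (M i j : ℝ) * θ = 2 * Real.pi := by
      rw [hθ]
      field_simp
    -- For `m = 2k`, `kθ = π` makes `S_{k-1}` vanish. For `m = 2k + 1`, `(k + 1)θ` and `kθ` add up
    -- to `2π`, so `S_k + S_{k-1}` vanishes.
    obtain ⟨k, hk | hk⟩ := Nat.even_or_odd' (M i j)
    · have e1 : ((M i j : ℤ) - 2) / 2 = k - 1 := by lia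
      have e2 : ((M i j : ℤ) - 1) / 2 = k - 1 := by lia
      have hz : (S ℝ ((k : ℤ) - 1)).eval (2 * Real.cos θ) = 0 := by
        rw [key]
        have : ((((k : ℤ) - 1 : ℤ) : ℝ) + 1) * θ = Real.pi := by
          rw [hk] at hmθ
          push_cast at hmθ ⊢
          linarith
        rw [this, Real.sin_pi, zero_div]
      rw [e1, e2, hz]
      simp
    · have e1 : ((M i j : ℤ) - 2) / 2 = k - 1 := by lia
      have e2 : ((M i j : ℤ) - 1) / 2 = k := by lia
      have e3 : ((M i j : ℤ) - 3) / 2 = k - 1 := by lia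
      have e4 : (M i j : ℤ) / 2 = k := by lia
      have hz : (S ℝ (k : ℤ)).eval (2 * Real.cos θ) +
          (S ℝ ((k : ℤ) - 1)).eval (2 * Real.cos θ) = 0 := by
        rw [key, key, ← add_div]
        have : (((k : ℤ) : ℝ) + 1) * θ = 2 * Real.pi - ((((k : ℤ) - 1 : ℤ) : ℝ) + 1) * θ := by
          rw [hk] at hmθ
          push_cast at hmθ ⊢
          linarith
        rw [this, Real.sin_two_pi_sub, neg_add_cancel, zero_div]
      rw [e1, e2, e3, e4, hz]
      simp

/-- If the power were trivial, the coordinates of the image of the root `i` would force `S_{k-1}`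
times the coefficient to be `0` and `S_k + S_{k-1} = 1`. In the main case `m ≥ 3` this means `sin
(kθ) = 0` and `cos (kθ) = 1`, impossible for `0 < kθ < 2π`; for infinite order `S_{k-1}(2) = k` is
nonzero. -/
theorem geomReflection_pow_ne_one {i j : B} (hij : i ≠ j) {k : ℕ} (hk : 0 < k)
    (hkm : M i j = 0 ∨ k < M i j) : (M.geomReflection i * M.geomReflection j) ^ k ≠ 1 := by
  intro h
  have h1 := (Module.reflection_mul_reflection_pow_apply_self (M.geomCoroot_self i)
    (M.geomCoroot_self j) k _ (M.geomCoroot_mul i j).symm).symm.trans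
      (congrArg (fun f : (B →₀ ℝ) ≃ₗ[ℝ] (B →₀ ℝ) => f (geomRoot i)) h)
  have hi := DFunLike.congr_fun h1 i
  have hj := DFunLike.congr_fun h1 j
  simp only [geomRoot, Finsupp.coe_add, Finsupp.coe_smul, Pi.add_apply, Pi.smul_apply,
    Finsupp.single_eq_same, Finsupp.single_eq_of_ne hij, Finsupp.single_eq_of_ne hij.symm,
    LinearEquiv.coe_one, id_eq, smul_eq_mul, mul_one, mul_zero, add_zero, zero_add] at hi hj
  have hc : M.geomCoroot j (Finsupp.single i 1) = -2 * Real.cos (Real.pi / M i j) := by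
    rw [M.symmetric i j]
    exact M.geomCoroot_root j i
  rw [hc] at hj
  have hpi := Real.pi_pos
  obtain hm | hm | hm | hm : M i j = 0 ∨ M i j = 1 ∨ M i j = 2 ∨ 3 ≤ M i j := by lia
  · rw [hm] at hj
    simp only [Nat.cast_zero, div_zero, mul_zero, Real.cos_zero, mul_one, S_eval_two] at hj
    push_cast at hj
    have : (0 : ℝ) < k := by exact_mod_cast hk
    linarith
  · exact M.off_diagonal i j hij hm
  · have : k = 1 := by lia
    subst this
    rw [hm] at hi
    have e : 2 * (Real.pi / ((2 : ℕ) : ℝ)) = Real.pi := by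
      push_cast
      ring
    rw [e] at hi
    norm_num at hi
  · have hsin := sin_two_pi_div_pos hm
    have hm' : (3 : ℝ) ≤ M i j := by exact_mod_cast hm
    have hcos : 0 < Real.cos (Real.pi / M i j) := by
      apply Real.cos_pos_of_mem_Ioo
      constructor
      · have : 0 < Real.pi / M i j := by positivity
        linarith
      · rw [div_lt_div_iff₀ (by linarith) (by norm_num)]
        nlinarith
    set θ := 2 * (Real.pi / M i j) with hθ
    have hS : (S ℝ ((k : ℤ) - 1)).eval (2 * Real.cos θ) = 0 := by
      rcases mul_eq_zero.1 hj with h | h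
      · exact h
      · exfalso
        linarith
    rw [hS, add_zero] at hi
    have h2 := S_two_mul_real_cos θ ((k : ℤ) - 1)
    have h3 := S_two_mul_real_cos θ (k : ℤ)
    rw [hS, zero_mul] at h2
    rw [hi, one_mul] at h3
    push_cast at h2 h3
    rw [sub_add_cancel] at h2
    rw [add_mul, one_mul, Real.sin_add, ← h2, zero_mul, zero_add] at h3
    have h4 : Real.cos (k * θ) = 1 := mul_right_cancel₀ hsin.ne' (by linarith)
    have hk' : (k : ℝ) < M i j := by
      exact_mod_cast hkm.resolve_left (by lia)
    have hk0 : (0 : ℝ) < k := by exact_mod_cast hk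
    have hθ' : (M i j : ℝ) * θ = 2 * Real.pi := by
      rw [hθ]
      field_simp
    have hθ0 : 0 < θ := by positivity
    have h5 : (k : ℝ) * θ < 2 * Real.pi := by
      rw [← hθ']
      exact mul_lt_mul_of_pos_right hk' hθ0
    have h6 : 0 < (k : ℝ) * θ := by positivity
    have := (Real.cos_eq_one_iff_of_lt_of_lt (by linarith) h5).1 h4
    linarith

end CoxeterMatrix

namespace CoxeterSystem

open List

variable {B W : Type*} [Group W] {M : CoxeterMatrix B} (cs : CoxeterSystem M W)

theorem simple_mul_simple_pow_ne_one {i j : B} (hij : i ≠ j) {k : ℕ} (hk : 0 < k)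
    (hkm : M i j = 0 ∨ k < M i j) : (cs.simple i * cs.simple j) ^ k ≠ 1 := by
  intro h
  refine M.geomReflection_pow_ne_one hij hk hkm ?_
  have := congrArg (cs.lift ⟨M.geomReflection, M.geomReflection_isLiftable⟩) h
  rwa [map_pow, map_mul, lift_apply_simple, lift_apply_simple, map_one] at this

theorem simple_injective : Function.Injective cs.simple := by
  intro i j h
  by_contra hij
  refine cs.simple_mul_simple_pow_ne_one hij one_pos ?_ (by rw [h]; simp)
  have := M.off_diagonal i j hij
  lia

/-- The left inversions are a fixed simple reflection times powers of `s_j s_i` with exponents less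
than its order. They are distinct, so the word is reduced. -/
theorem isReduced_alternatingWord {i j : B} (hij : i ≠ j) {k : ℕ}
    (hk : M i j = 0 ∨ k ≤ M i j) : cs.IsReduced (alternatingWord i j k) := by
  have key : ∀ i j, i ≠ j → (M i j = 0 ∨ k ≤ M i j) →
      -- The formula for the inversions concerns alternating words of even length, so the word is
      -- taken as a prefix of such a word; the parity of `k` decides which of the two alternating
      -- words this prefix is.
      cs.IsReduced ((alternatingWord i j (2 * (k + 1))).take k) := by
    intro i j hij hk
    apply cs.isReduced_of_nodup_leftInvSeq
    rw [leftInvSeq_take, List.nodup_iff_injective_getElem]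
    rintro ⟨a, ha⟩ ⟨b, hb⟩ hab
    simp only [length_take, length_leftInvSeq, length_alternatingWord, lt_min_iff] at ha hb
    simp only [List.getElem_take] at hab
    rw [cs.getElem_leftInvSeq_alternatingWord i j _ _ (by lia),
      cs.getElem_leftInvSeq_alternatingWord i j _ _ (by lia),
      prod_alternatingWord_eq_mul_pow, prod_alternatingWord_eq_mul_pow] at hab
    have e2 : ∀ k, (2 * k + 1) / 2 = k := by lia
    have e3 : ∀ k, ¬ Even (2 * k + 1) := fun k => by simp
    rw [e2, e2, if_neg (e3 _), if_neg (e3 _)] at hab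
    have hpow := mul_left_cancel hab
    rw [Fin.mk.injEq]
    have hne := fun {d : ℕ} => cs.simple_mul_simple_pow_ne_one hij.symm (k := d)
    rw [M.symmetric j i] at hne
    rcases lt_trichotomy a b with hlt | heq | hgt
    · rw [← Nat.add_sub_of_le hlt.le, pow_add, left_eq_mul] at hpow
      exact (hne (by lia) (by lia) hpow).elim
    · exact heq
    · rw [← Nat.add_sub_of_le hgt.le, pow_add, mul_eq_left] at hpow
      exact (hne (by lia) (by lia) hpow).elim
  by_cases hev : Even k
  · have := key i j hij hk
    rwa [listTake_alternatingWord i j _ _ (by lia), if_pos hev] at this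
  · have := key j i hij.symm (by rwa [M.symmetric])
    rwa [listTake_alternatingWord j i _ _ (by lia), if_neg hev] at this

/-! ### Dihedral elements and Matsumoto's theorem -/

theorem alternatingWord_reverse (i j : B) (k : ℕ) :
    (alternatingWord i j k).reverse =
      if Even k then alternatingWord j i k else alternatingWord i j k := by
  induction k generalizing i j with
  | zero => simp [alternatingWord]
  | succ k ih =>
    rw [alternatingWord_succ, concat_eq_append, reverse_append, ih]
    by_cases hk : Even k
    · have hk' : ¬ Even (k + 1) := by simp [hk, parity_simps]
      simp only [hk, hk', if_true, if_false]
      have h := alternatingWord_succ' i j k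
      rw [if_pos hk, alternatingWord_succ, concat_eq_append] at h
      rw [h]
      rfl
    · have hk' : Even (k + 1) := by simp [hk, parity_simps]
      simp only [hk, hk', if_true, if_false]
      rw [alternatingWord_succ', if_neg hk]
      rfl

/-- The longest element of the dihedral group generated by two simple reflections, if finite. -/
def braid (i j : B) : W := cs.wordProd (alternatingWord i j (M i j))

theorem braid_comm (i j : B) : cs.braid i j = cs.braid j i := cs.wordProd_braidWord_eq i j

theorem braid_inv (i j : B) : (cs.braid i j)⁻¹ = cs.braid i j := by
  rw [braid, ← wordProd_reverse, alternatingWord_reverse]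
  split_ifs
  · have h := cs.wordProd_braidWord_eq j i
    rwa [braidWord, braidWord, M.symmetric j i] at h
  · rfl

theorem length_braid {i j : B} (hij : i ≠ j) : cs.length (cs.braid i j) = M i j := by
  rw [braid, (cs.isReduced_alternatingWord hij (Or.inr le_rfl)).eq, length_alternatingWord]

/-- Given a reduced factorization of `y` ending in the alternating word with last letter `i`,
exchange with the descent `j` deletes a letter. It cannot be in the alternating part, for the next
alternating word is reduced; so it is in `z`, and the suffix grows by one letter. -/
theorem exists_eq_mul_alternatingWord {y : W} {i j : B} (hij : i ≠ j)
    (hi : cs.IsRightDescent y i) (hj : cs.IsRightDescent y j) (k : ℕ)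
    (hk : M i j = 0 ∨ k ≤ M i j) :
    ∃ z, y = z * cs.wordProd (alternatingWord i j k) ∧ cs.length y = cs.length z + k := by
  induction k generalizing i j with
  | zero => exact ⟨y, by simp [alternatingWord], rfl⟩
  | succ k ih =>
    obtain ⟨z, hy, hl⟩ := ih hij.symm hj hi (by rw [M.symmetric]; lia)
    obtain ⟨ωz, hωz, rfl⟩ := cs.exists_isReduced z
    have hinv : cs.IsRightInversion (cs.wordProd (ωz ++ alternatingWord j i k)) (cs.simple j) := by
      rw [wordProd_append, ← hy]
      exact ⟨cs.isReflection_simple j, hj⟩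
    obtain ⟨a, ha, e⟩ := hinv.exists_eraseIdx
    rw [length_append, length_alternatingWord] at ha
    rw [wordProd_append, mul_assoc, ← wordProd_concat, ← alternatingWord_succ] at e
    by_cases haz : a < ωz.length
    · rw [eraseIdx_append_of_lt_length haz, wordProd_append] at e
      refine ⟨cs.wordProd (ωz.eraseIdx a), ?_, ?_⟩
      · rw [alternatingWord_succ, wordProd_concat] at e ⊢
        rw [← mul_assoc, ← e, ← mul_assoc, simple_mul_simple_cancel_right, hy]
      · have h1 : cs.length (cs.wordProd (ωz.eraseIdx a)) + 1 ≤ ωz.length := by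
          have := cs.length_wordProd_le (ωz.eraseIdx a)
          have := length_eraseIdx_add_one haz
          lia
        rw [hωz.eq] at hl
        have h2 : y = cs.wordProd (ωz.eraseIdx a) * cs.wordProd (alternatingWord i j (k + 1)) := by
          rw [alternatingWord_succ, wordProd_concat] at e ⊢
          rw [← mul_assoc, ← e, ← mul_assoc, simple_mul_simple_cancel_right, hy]
        have h3 := cs.length_mul_le (cs.wordProd (ωz.eraseIdx a))
          (cs.wordProd (alternatingWord i j (k + 1)))
        have h4 := cs.length_wordProd_le (alternatingWord i j (k + 1))
        rw [length_alternatingWord] at h4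
        rw [← h2] at h3
        lia
    · exfalso
      rw [eraseIdx_append_of_length_le (not_lt.1 haz), wordProd_append] at e
      have e' := congrArg cs.length (mul_left_cancel e)
      rw [(cs.isReduced_alternatingWord hij hk).eq, length_alternatingWord] at e'
      have := cs.length_wordProd_le ((alternatingWord j i k).eraseIdx (a - ωz.length))
      have := length_eraseIdx_add_one (l := alternatingWord j i k) (i := a - ωz.length)
        (by rw [length_alternatingWord]; lia)
      rw [length_alternatingWord] at this
      lia

theorem exists_eq_mul_braid {y : W} {i j : B} (hij : i ≠ j)
    (hi : cs.IsRightDescent y i) (hj : cs.IsRightDescent y j) :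
    M i j ≠ 0 ∧ ∃ z, y = z * cs.braid i j ∧ cs.length y = cs.length z + M i j := by
  refine ⟨fun h0 => ?_, cs.exists_eq_mul_alternatingWord hij hi hj _ (Or.inr le_rfl)⟩
  -- If the order were infinite, `y` would have an alternating suffix longer than itself.
  obtain ⟨z, -, hz⟩ := cs.exists_eq_mul_alternatingWord hij hi hj (cs.length y + 1) (Or.inl h0)
  lia

theorem exists_eq_braid_mul {y : W} {i j : B} (hij : i ≠ j)
    (hi : cs.IsLeftDescent y i) (hj : cs.IsLeftDescent y j) :
    M i j ≠ 0 ∧ ∃ z, y = cs.braid i j * z ∧ cs.length y = M i j + cs.length z := by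
  rw [← isRightDescent_inv_iff] at hi hj
  obtain ⟨h0, z, hz, hl⟩ := cs.exists_eq_mul_braid hij hi hj
  refine ⟨h0, z⁻¹, ?_, ?_⟩
  · rw [← inv_inj, hz, mul_inv_rev, inv_inv, braid_inv]
  · rw [length_inv] at hl ⊢
    lia

theorem isRightDescent_wordProd_concat {ω : List B} {i : B} (h : cs.IsReduced (ω ++ [i])) :
    cs.IsRightDescent (cs.wordProd (ω ++ [i])) i := by
  rw [IsRightDescent, h.eq, wordProd_append, wordProd_singleton, simple_mul_simple_cancel_right,
    length_append]
  exact lt_of_le_of_lt (cs.length_wordProd_le ω) (by simp)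

/-- Matsumoto's theorem. -/
theorem IsReduced.map_prod_eq {N : Type*} [Monoid N] (f : B → N)
    (hf : ∀ i j, ((alternatingWord i j (M i j)).map f).prod =
      ((alternatingWord j i (M i j)).map f).prod) {ω ω' : List B} (h : cs.IsReduced ω)
    (h' : cs.IsReduced ω') (e : cs.wordProd ω = cs.wordProd ω') :
    (ω.map f).prod = (ω'.map f).prod := by
  induction hn : ω.length generalizing ω ω' with
  | zero =>
    have hl : ω'.length = 0 := by rw [← h'.eq, ← e, h.eq, hn]
    rw [List.length_eq_zero_iff] at hn hl
    rw [hn, hl]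
  | succ n ih =>
    have key : ∀ (ω ω' : List B) (i : B), cs.IsReduced (ω ++ [i]) → cs.IsReduced (ω' ++ [i]) →
        cs.wordProd (ω ++ [i]) = cs.wordProd (ω' ++ [i]) → (ω ++ [i]).length = n + 1 →
        ((ω ++ [i]).map f).prod = ((ω' ++ [i]).map f).prod := by
      intro ω ω' i h h' e hn
      have h1 : cs.IsReduced ω := by simpa using h.take ω.length
      have h2 : cs.IsReduced ω' := by simpa using h'.take ω'.length
      rw [wordProd_append, wordProd_append] at e
      rw [map_append, map_append, prod_append, prod_append,
        ih h1 h2 (mul_right_cancel e) (by simpa using hn)]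
    have hl : ω'.length = n + 1 := by rw [← h'.eq, ← e, h.eq, hn]
    obtain ⟨a, i, rfl⟩ : ∃ a i, ω = a ++ [i] :=
      ⟨_, _, (dropLast_append_getLast (by rintro rfl; simp at hn)).symm⟩
    obtain ⟨b, j, rfl⟩ : ∃ b j, ω' = b ++ [j] :=
      ⟨_, _, (dropLast_append_getLast (by rintro rfl; simp at hl)).symm⟩
    by_cases hij : i = j
    · subst hij
      exact key a b i h h' e hn
    have hi := cs.isRightDescent_wordProd_concat h
    have hj := cs.isRightDescent_wordProd_concat h'
    rw [← e] at hj
    obtain ⟨h0, z, hz, hlz⟩ := cs.exists_eq_mul_braid hij hi hj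
    obtain ⟨c, hc, rfl⟩ := cs.exists_isReduced z
    obtain ⟨m, hm⟩ := Nat.exists_eq_succ_of_ne_zero h0
    -- When the last letters differ, both are descents, so the element also has reduced words `c ++
    -- (i j braid word)` and `c ++ (j i braid word)`. Each shares its last letter with one of the
    -- given words, and they differ by one braid relation.
    have hred : ∀ i' j', cs.braid i' j' = cs.braid i j → M i' j' = M i j →
        cs.wordProd (a ++ [i]) = cs.wordProd (c ++ alternatingWord i' j' (M i' j')) ∧
        cs.IsReduced (c ++ alternatingWord i' j' (M i' j')) := by
      intro i' j' hb hm'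
      have e1 : cs.wordProd (a ++ [i]) = cs.wordProd (c ++ alternatingWord i' j' (M i' j')) := by
        rw [hz, wordProd_append, ← hb]
        rfl
      refine ⟨e1, ?_⟩
      rw [IsReduced, ← e1, hlz, hc.eq, length_append, length_alternatingWord, hm']
    obtain ⟨e1, r1⟩ := hred i j rfl rfl
    obtain ⟨e2, r2⟩ := hred j i (cs.braid_comm j i) (M.symmetric j i)
    have hm2 : M j i = m + 1 := by rw [M.symmetric, hm]
    rw [hm, alternatingWord_succ, concat_eq_append, ← append_assoc] at e1 r1
    rw [hm2, alternatingWord_succ, concat_eq_append, ← append_assoc] at e2 r2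
    have hf' := hf i j
    rw [hm, alternatingWord_succ, alternatingWord_succ, concat_eq_append, concat_eq_append] at hf'
    rw [key _ _ _ h r2 e2 hn, ← key _ _ _ r1 h' (e1.symm.trans e)
      (by rw [← r1.eq, ← e1, h.eq, hn])]
    simp only [append_assoc, map_append, prod_append] at hf' ⊢
    rw [hf']

/-- The lift of a Coxeter group to a monoid given by reduced words. -/
noncomputable def reducedLift {N : Type*} [Monoid N] (f : B → N) (w : W) : N :=
  ((Classical.choose (cs.exists_isReduced w)).map f).prod

section ReducedLift

variable {N : Type*} [Monoid N] (f : B → N)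
  (hf : ∀ i j, ((alternatingWord i j (M i j)).map f).prod =
    ((alternatingWord j i (M i j)).map f).prod)

include hf

theorem reducedLift_wordProd {ω : List B} (h : cs.IsReduced ω) :
    cs.reducedLift f (cs.wordProd ω) = (ω.map f).prod := by
  obtain ⟨h1, h2⟩ := Classical.choose_spec (cs.exists_isReduced (cs.wordProd ω))
  exact IsReduced.map_prod_eq cs f hf h1 h h2.symm

theorem reducedLift_mul {u v : W} (h : cs.length (u * v) = cs.length u + cs.length v) :
    cs.reducedLift f (u * v) = cs.reducedLift f u * cs.reducedLift f v := by
  obtain ⟨a, ha, rfl⟩ := cs.exists_isReduced u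
  obtain ⟨b, hb, rfl⟩ := cs.exists_isReduced v
  have hab : cs.IsReduced (a ++ b) := by
    rw [IsReduced, wordProd_append, h, ha.eq, hb.eq, length_append]
  rw [← wordProd_append, cs.reducedLift_wordProd f hf hab, cs.reducedLift_wordProd f hf ha,
    cs.reducedLift_wordProd f hf hb, map_append, prod_append]

theorem reducedLift_one : cs.reducedLift f (1 : W) = 1 := by
  have := cs.reducedLift_wordProd f hf (ω := []) (by simp [IsReduced])
  simpa using this

theorem reducedLift_simple (i : B) : cs.reducedLift f (cs.simple i) = f i := by
  have := cs.reducedLift_wordProd f hf (ω := [i]) (by simp [IsReduced])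
  simpa using this

end ReducedLift

/-! ### The prefix order and elements of maximal length -/

/-- The prefix order (right weak order): `v` starts with a reduced word for `u`. -/
def IsPrefix (u v : W) : Prop := cs.length v = cs.length u + cs.length (u⁻¹ * v)

variable {cs}

theorem IsPrefix.refl (u : W) : cs.IsPrefix u u := by simp [IsPrefix]

theorem IsPrefix.one (u : W) : cs.IsPrefix 1 u := by simp [IsPrefix]

theorem isPrefix_mul {u v : W} : cs.IsPrefix u (u * v) ↔
    cs.length (u * v) = cs.length u + cs.length v := by
  rw [IsPrefix, inv_mul_cancel_left]

theorem isPrefix_iff {u w : W} :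
    cs.IsPrefix u w ↔ ∃ v, w = u * v ∧ cs.length w = cs.length u + cs.length v :=
  ⟨fun h => ⟨u⁻¹ * w, by simp, h⟩, fun ⟨v, hv, h⟩ => by rw [hv, isPrefix_mul, ← hv, h]⟩

theorem IsPrefix.trans {u v w : W} (h : cs.IsPrefix u v) (h' : cs.IsPrefix v w) :
    cs.IsPrefix u w := by
  obtain ⟨a, rfl, ha⟩ := isPrefix_iff.1 h
  obtain ⟨b, rfl, hb⟩ := isPrefix_iff.1 h'
  rw [mul_assoc, isPrefix_mul, ← mul_assoc]
  have h1 := cs.length_mul_le a b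
  have h2 := cs.length_mul_le u (a * b)
  rw [← mul_assoc] at h2
  lia

theorem IsPrefix.length_le {u v : W} (h : cs.IsPrefix u v) : cs.length u ≤ cs.length v := by
  rw [IsPrefix] at h
  lia

theorem IsPrefix.eq_of_length_le {u v : W} (h : cs.IsPrefix u v)
    (hl : cs.length v ≤ cs.length u) : u = v := by
  rw [IsPrefix] at h
  have : cs.length (u⁻¹ * v) = 0 := by lia
  rw [length_eq_zero_iff, inv_mul_eq_one] at this
  exact this

theorem IsPrefix.antisymm {u v : W} (h : cs.IsPrefix u v) (h' : cs.IsPrefix v u) : u = v :=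
  h.eq_of_length_le h'.length_le

theorem isPrefix_mul_left_iff {x a b : W} (ha : cs.length (x * a) = cs.length x + cs.length a)
    (hb : cs.length (x * b) = cs.length x + cs.length b) :
    cs.IsPrefix (x * a) (x * b) ↔ cs.IsPrefix a b := by
  rw [IsPrefix, IsPrefix, ha, hb, mul_inv_rev, mul_assoc, inv_mul_cancel_left]
  lia

theorem IsPrefix.length_mul_eq {u x y : W} (h : cs.IsPrefix x y)
    (hy : cs.length (u * y) = cs.length u + cs.length y) :
    cs.length (u * x) = cs.length u + cs.length x := by
  obtain ⟨z, rfl, hz⟩ := isPrefix_iff.1 h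
  have h1 := cs.length_mul_le u x
  have h2 := cs.length_mul_le (u * x) z
  rw [mul_assoc] at h2
  lia

theorem IsPrefix.length_inv_mul_add {x y w : W} (h : cs.IsPrefix x y) (h' : cs.IsPrefix y w) :
    cs.length (x⁻¹ * w) = cs.length (x⁻¹ * y) + cs.length (y⁻¹ * w) := by
  have := h.trans h'
  rw [IsPrefix] at *
  lia

theorem exists_isPrefix_mul_simple {x y : W} (h : cs.IsPrefix x y) (hne : x ≠ y) :
    ∃ i, cs.length (x * cs.simple i) = cs.length x + 1 ∧ cs.IsPrefix (x * cs.simple i) y := by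
  have h1 : x⁻¹ * y ≠ 1 := by rwa [ne_eq, inv_mul_eq_one]
  obtain ⟨i, hi⟩ := cs.exists_leftDescent_of_ne_one h1
  rw [isLeftDescent_iff] at hi
  have h2 := cs.length_mul_le (x * cs.simple i) (cs.simple i * (x⁻¹ * y))
  have h3 := cs.length_mul_le x (cs.simple i)
  rw [length_simple] at h3
  have e : x * cs.simple i * (cs.simple i * (x⁻¹ * y)) = y := by
    rw [mul_assoc, simple_mul_simple_cancel_left, mul_inv_cancel_left]
  rw [e] at h2
  rw [IsPrefix] at h
  refine ⟨i, by lia, ?_⟩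
  rw [isPrefix_iff]
  exact ⟨_, e.symm, by lia⟩

/-- A bounded set of elements that is closed under prefixes and under dihedral completion is the set
of prefixes of an element. -/
theorem exists_greatest_isPrefix (E : Set W) (h1 : 1 ∈ E)
    (hE : ∀ y ∈ E, ∀ x, cs.IsPrefix x y → x ∈ E) (n : ℕ) (hn : ∀ x ∈ E, cs.length x ≤ n)
    (hconf : ∀ x i j, i ≠ j → x * cs.simple i ∈ E → x * cs.simple j ∈ E →
      cs.length (x * cs.simple i) = cs.length x + 1 →
      cs.length (x * cs.simple j) = cs.length x + 1 →
      ∃ y ∈ E, cs.IsPrefix (x * cs.simple i) y ∧ cs.IsPrefix (x * cs.simple j) y) :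
    ∃ m ∈ E, ∀ x ∈ E, cs.IsPrefix x m := by
  -- Diamond argument by descending induction on length: above each `x` in `E` there is a greatest
  -- element. Those found above two covers of `x` coincide, because both equal the one above a
  -- common bound of the covers.
  have key : ∀ k, ∀ x ∈ E, n < cs.length x + k →
      ∃ m ∈ E, cs.IsPrefix x m ∧ ∀ y ∈ E, cs.IsPrefix x y → cs.IsPrefix y m := by
    intro k
    induction k with
    | zero =>
      intro x hx hxn
      have := hn x hx
      lia
    | succ k ih =>
      intro x hx hxn
      by_cases hmax : ∀ y ∈ E, cs.IsPrefix x y → y = x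
      · exact ⟨x, hx, IsPrefix.refl x, fun y hy hxy => by rw [hmax y hy hxy]; exact IsPrefix.refl x⟩
      push Not at hmax
      obtain ⟨y₀, hy₀, hxy₀, hne₀⟩ := hmax
      obtain ⟨i, hi, hiy₀⟩ := exists_isPrefix_mul_simple hxy₀ hne₀.symm
      have hiE := hE _ hy₀ _ hiy₀
      obtain ⟨m, hm, him, hmmax⟩ := ih _ hiE (by lia)
      have hxi : ∀ i, cs.length (x * cs.simple i) = cs.length x + 1 →
          cs.IsPrefix x (x * cs.simple i) := fun i hi => by
        rw [isPrefix_mul, hi, length_simple]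
      refine ⟨m, hm, (hxi i hi).trans him, fun y hy hxy => ?_⟩
      by_cases hyx : x = y
      · rw [← hyx]
        exact (hxi i hi).trans him
      obtain ⟨j, hj, hjy⟩ := exists_isPrefix_mul_simple hxy hyx
      by_cases hij : i = j
      · subst hij
        exact hmmax y hy hjy
      have hjE := hE _ hy _ hjy
      obtain ⟨m', hm', hjm', hmmax'⟩ := ih _ hjE (by lia)
      obtain ⟨z, hz, hiz, hjz⟩ := hconf x i j hij hiE hjE hi hj
      obtain ⟨m'', hm'', hzm'', hmmax''⟩ := ih z hz (by have := hiz.length_le; lia)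
      have e1 : m = m'' := (hmmax'' m hm (hmmax z hz hiz)).antisymm
        (hmmax m'' hm'' (hiz.trans hzm''))
      have e2 : m' = m'' := (hmmax'' m' hm' (hmmax' z hz hjz)).antisymm
        (hmmax' m'' hm'' (hjz.trans hzm''))
      rw [e1, ← e2]
      exact hmmax' y hy hjy
  obtain ⟨m, hm, -, hmax⟩ := key (n + 1) 1 h1 (by lia)
  exact ⟨m, hm, fun x hx => hmax x hx (IsPrefix.one x)⟩

/-! ### Length in the presence of an element of maximal length -/

section Longest

variable {w₀ : W} (h₀ : ∀ w, cs.length w ≤ cs.length w₀)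

include h₀

/-- For `w₀ = z x`, maximality makes `x⁻¹ s_i x` an inversion of `w₀`. Since `i :: ω` is reduced,
the exchange deletes a letter of `z`, whence `w₀ = (z s_i)(s_i x)` with lengths adding up. -/
theorem exists_eq_mul_of_longest (ω : List B) (hω : cs.IsReduced ω) :
    ∃ z, w₀ = z * cs.wordProd ω ∧ cs.length w₀ = cs.length z + cs.length (cs.wordProd ω) := by
  induction ω with
  | nil => exact ⟨w₀, by simp, by simp⟩
  | cons i ω ih =>
    have hω' : cs.IsReduced ω := hω.drop 1
    obtain ⟨z, hz, hl⟩ := ih hω'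
    obtain ⟨ωz, hωz, rfl⟩ := cs.exists_isReduced z
    set x := cs.wordProd ω with hx
    have ht : cs.IsReflection (x⁻¹ * cs.simple i * x) := by
      simpa using (cs.isReflection_simple i).conj x⁻¹
    have hinv : cs.IsRightInversion (cs.wordProd (ωz ++ ω)) (x⁻¹ * cs.simple i * x) := by
      refine ⟨ht, ?_⟩
      rw [wordProd_append, ← hx, ← hz]
      exact lt_of_le_of_ne (h₀ _) (ht.length_mul_left_ne _)
    obtain ⟨a, ha, e⟩ := hinv.exists_eraseIdx
    have e' : cs.wordProd (ωz ++ ω) * (x⁻¹ * cs.simple i * x) =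
        cs.wordProd ωz * (cs.simple i * x) := by
      rw [wordProd_append, ← hx]
      group
    rw [e'] at e
    have hix := hω.eq
    rw [wordProd_cons, ← hx, length_cons, ← hω'.eq, ← hx] at hix
    by_cases haz : a < ωz.length
    · rw [eraseIdx_append_of_lt_length haz, wordProd_append, ← mul_assoc, ← hx] at e
      have e2 := mul_right_cancel e
      have h1 := cs.length_wordProd_le (ωz.eraseIdx a)
      have h2 := length_eraseIdx_add_one haz
      rw [← e2] at h1
      have e3 : w₀ = cs.wordProd ωz * cs.simple i * (cs.simple i * x) := by
        rw [mul_assoc, simple_mul_simple_cancel_left, hz]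
      refine ⟨cs.wordProd ωz * cs.simple i, by rw [wordProd_cons, ← hx, e3], ?_⟩
      have h3 := cs.length_mul_le (cs.wordProd ωz * cs.simple i) (cs.simple i * x)
      rw [← e3] at h3
      rw [hωz.eq] at hl
      rw [wordProd_cons, ← hx]
      lia
    · exfalso
      rw [eraseIdx_append_of_length_le (not_lt.1 haz), wordProd_append] at e
      have e2 := congrArg cs.length (mul_left_cancel e)
      have h1 := cs.length_wordProd_le (ω.eraseIdx (a - ωz.length))
      rw [length_append] at ha
      have h2 := length_eraseIdx_add_one (l := ω) (i := a - ωz.length) (by lia)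
      have h3 := hω'.eq
      rw [← hx] at h3
      lia

theorem length_longest_mul (u : W) : cs.length (w₀ * u) + cs.length u = cs.length w₀ := by
  obtain ⟨ω, hω, e⟩ := cs.exists_isReduced u⁻¹
  obtain ⟨z, hz, hl⟩ := exists_eq_mul_of_longest h₀ ω hω
  rw [← e] at hz hl
  rw [hl, hz, inv_mul_cancel_right, length_inv]

/-- Left multiplication by `w₀` reverses lengths, so it turns the two ascents of `y` into descents
of `w₀ y`, to which `exists_eq_mul_braid` applies. -/
theorem length_mul_braid {y : W} {i j : B} (hij : i ≠ j)
    (hi : cs.length (y * cs.simple i) = cs.length y + 1)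
    (hj : cs.length (y * cs.simple j) = cs.length y + 1) :
    M i j ≠ 0 ∧ cs.length (y * cs.braid i j) = cs.length y + M i j := by
  have key : ∀ i, cs.length (y * cs.simple i) = cs.length y + 1 →
      cs.IsRightDescent (w₀ * y) i := fun i hi => by
    have h1 := length_longest_mul h₀ y
    have h2 := length_longest_mul h₀ (y * cs.simple i)
    rw [IsRightDescent, mul_assoc]
    lia
  obtain ⟨h0, z, hz, hl⟩ := cs.exists_eq_mul_braid hij (key i hi) (key j hj)
  refine ⟨h0, ?_⟩
  have h1 := length_longest_mul h₀ y
  have h2 := length_longest_mul h₀ (y * cs.braid i j)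
  have h3 : w₀ * (y * cs.braid i j) = z := by
    rw [← mul_assoc, hz, mul_assoc]
    nth_rewrite 1 [← cs.braid_inv]
    rw [inv_mul_cancel, mul_one]
  rw [h3] at h2
  lia

theorem isPrefix_mul_braid {y : W} {i j : B} (hij : i ≠ j)
    (hi : cs.length (y * cs.simple i) = cs.length y + 1)
    (hj : cs.length (y * cs.simple j) = cs.length y + 1) :
    cs.IsPrefix (y * cs.simple i) (y * cs.braid i j) := by
  obtain ⟨h0, hl⟩ := length_mul_braid h₀ hij hi hj
  rw [isPrefix_iff]
  refine ⟨cs.simple i * cs.braid i j, by rw [mul_assoc, simple_mul_simple_cancel_left], ?_⟩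
  have h1 : cs.IsLeftDescent (cs.braid i j) i := by
    obtain ⟨m, hm⟩ := Nat.exists_eq_succ_of_ne_zero h0
    rw [← isRightDescent_inv_iff, braid_inv, braid_comm, braid, M.symmetric, hm,
      alternatingWord_succ, concat_eq_append]
    apply isRightDescent_wordProd_concat
    rw [← concat_eq_append, ← alternatingWord_succ, show m + 1 = M i j from hm.symm]
    exact cs.isReduced_alternatingWord hij.symm (Or.inr (by rw [M.symmetric]))
  rw [isLeftDescent_iff, cs.length_braid hij] at h1
  lia

/-- For every `u` and `v` there is a longest prefix `x` of `v` such that `u x` is reduced. -/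
theorem exists_cap (u v : W) :
    ∃ x, (cs.IsPrefix x v ∧ cs.length (u * x) = cs.length u + cs.length x) ∧
      ∀ y, cs.IsPrefix y v → cs.length (u * y) = cs.length u + cs.length y → cs.IsPrefix y x := by
  obtain ⟨x, hx, hmax⟩ := exists_greatest_isPrefix (cs := cs)
    {x | cs.IsPrefix x v ∧ cs.length (u * x) = cs.length u + cs.length x}
    ⟨IsPrefix.one v, by simp⟩
    (fun y hy x hxy => ⟨hxy.trans hy.1, hxy.length_mul_eq hy.2⟩)
    (cs.length v) (fun x hx => hx.1.length_le) (by
      rintro x i j hij ⟨hi1, hi2⟩ ⟨hj1, hj2⟩ hi hj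
      have hp : ∀ i, cs.length (x * cs.simple i) = cs.length x + 1 →
          cs.IsPrefix x (x * cs.simple i) := fun i hi => by
        rw [isPrefix_mul, hi, length_simple]
      have hd : ∀ i, cs.length (x * cs.simple i) = cs.length x + 1 →
          cs.IsPrefix (x * cs.simple i) v → cs.IsLeftDescent (x⁻¹ * v) i := fun i hi hiv => by
        have h1 := (hp i hi).trans hiv
        rw [IsPrefix] at h1 hiv
        rw [mul_inv_rev, inv_simple, mul_assoc] at hiv
        rw [IsLeftDescent]
        lia
      -- Both letters are left descents of the remainder `x⁻¹ v`, so the whole braid element is a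
      -- prefix of it; and `u x` ascends along both letters, so its product with the braid element
      -- stays reduced.
      obtain ⟨h0, z, hz, hlz⟩ := cs.exists_eq_braid_mul hij (hd i hi hi1) (hd j hj hj1)
      obtain ⟨-, hb⟩ := length_mul_braid h₀ hij hi hj
      have hux : cs.length (u * x) = cs.length u + cs.length x :=
        (hp i hi).length_mul_eq hi2
      obtain ⟨-, hub⟩ := length_mul_braid h₀ (y := u * x) hij
        (by rw [mul_assoc]; lia) (by rw [mul_assoc]; lia)
      refine ⟨x * cs.braid i j, ⟨?_, ?_⟩, isPrefix_mul_braid h₀ hij hi hj, ?_⟩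
      · have h1 := (hp i hi).trans hi1
        rw [IsPrefix] at h1
        rw [isPrefix_iff]
        exact ⟨z, by rw [mul_assoc, ← hz, mul_inv_cancel_left], by lia⟩
      · rw [← mul_assoc]
        lia
      · rw [braid_comm]
        exact isPrefix_mul_braid h₀ hij.symm hj hi)
  exact ⟨x, hx, fun y h1 h2 => hmax y ⟨h1, h2⟩⟩

end Longest

variable (cs) in
/-- The longest prefix `x` of `v` such that `u x` is reduced. -/
noncomputable def cap (u v : W) : W :=
  open Classical in
  -- The default value `1` does not occur when an element of maximal length exists, by `exists_cap`.
  if h : ∃ x, (cs.IsPrefix x v ∧ cs.length (u * x) = cs.length u + cs.length x) ∧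
      ∀ y, cs.IsPrefix y v → cs.length (u * y) = cs.length u + cs.length y → cs.IsPrefix y x
  then Classical.choose h else 1

section Longest

variable {w₀ : W} (h₀ : ∀ w, cs.length w ≤ cs.length w₀)

include h₀

theorem cap_spec (u v : W) :
    (cs.IsPrefix (cs.cap u v) v ∧
      cs.length (u * cs.cap u v) = cs.length u + cs.length (cs.cap u v)) ∧
    ∀ y, cs.IsPrefix y v → cs.length (u * y) = cs.length u + cs.length y →
      cs.IsPrefix y (cs.cap u v) := by
  rw [cap, dif_pos (exists_cap h₀ u v)]
  exact Classical.choose_spec (exists_cap h₀ u v)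

/-- Absorbing into `u'` and then into `u` is the same as absorbing into `u u'`. Indeed `u'` is a
prefix of `cap u (u' * cap u' v)`, and the quotient and `cap (u * u') v` are prefixes of each other
by maximality. This is what makes `act` multiplicative on reduced products. -/
theorem cap_mul {u u' : W} (v : W) (hu : cs.length (u * u') = cs.length u + cs.length u') :
    cs.cap u (u' * cs.cap u' v) = u' * cs.cap (u * u') v ∧
      cs.IsPrefix (cs.cap (u * u') v) (cs.cap u' v) := by
  obtain ⟨⟨hc1, hc2⟩, hc3⟩ := cap_spec h₀ u' v
  set c' := cs.cap u' v
  obtain ⟨⟨hd1, hd2⟩, hd3⟩ := cap_spec h₀ u (u' * c')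
  set d := cs.cap u (u' * c')
  obtain ⟨⟨hx1, hx2⟩, hx3⟩ := cap_spec h₀ (u * u') v
  set c := cs.cap (u * u') v
  clear_value d c c'
  have hud : cs.IsPrefix u' d := hd3 u' (isPrefix_mul.2 hc2) hu
  obtain ⟨e, rfl, he⟩ := isPrefix_iff.1 hud
  have hec' : cs.IsPrefix e c' := (isPrefix_mul_left_iff he hc2).1 hd1
  have hec : cs.IsPrefix e c := hx3 e (hec'.trans hc1) (by rw [mul_assoc]; lia)
  have huc : cs.length (u' * c) = cs.length u' + cs.length c := by
    have h1 := cs.length_mul_le u (u' * c)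
    have h2 := cs.length_mul_le u' c
    rw [mul_assoc] at hx2
    lia
  have hcc' : cs.IsPrefix c c' := hc3 c hx1 huc
  have hce : cs.IsPrefix c e := (isPrefix_mul_left_iff huc he).1
    (hd3 _ ((isPrefix_mul_left_iff huc hc2).2 hcc') (by rw [← mul_assoc]; lia))
  exact ⟨by rw [hce.antisymm hec], hcc'⟩

end Longest

end CoxeterSystem

namespace RibbonGarside

open CoxeterSystem

/-! ### Artin–Tits monoids: length, reversal, and lifts of Coxeter group elements -/

namespace ArtinMonoid

variable {B : Type*} {A : CoxeterMatrix B}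

variable (A) in
/-- The generators of the Artin–Tits monoid. -/
def gen (i : B) : ArtinMonoid A := PresentedMonoid.of (braidRels A) i

theorem prod_map_gen (ω : List B) : (ω.map (gen A)).prod = artinProd A ω := by
  induction ω with
  | nil => rfl
  | cons i ω ih =>
    rw [List.map_cons, List.prod_cons, ih]
    rfl

theorem gen_braid (i j : B) : ((alternatingWord i j (A i j)).map (gen A)).prod =
    ((alternatingWord j i (A i j)).map (gen A)).prod := by
  rw [prod_map_gen, prod_map_gen]
  exact PresentedMonoid.mk_eq_mk_of_rel ⟨i, j, rfl, rfl⟩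

@[elab_as_elim]
theorem induction {p : ArtinMonoid A → Prop} (one : p 1) (mul : ∀ i a, p a → p (gen A i * a))
    (a : ArtinMonoid A) : p a := by
  obtain ⟨ω, rfl⟩ : ∃ ω, artinProd A ω = a := by
    obtain ⟨x, rfl⟩ := PresentedMonoid.surjective_mk a
    exact ⟨x.toList, rfl⟩
  rw [← prod_map_gen]
  induction ω with
  | nil => exact one
  | cons i ω ih =>
    rw [List.map_cons, List.prod_cons]
    exact mul i _ ih

theorem exists_prod_eq (a : ArtinMonoid A) : ∃ ω : List B, (ω.map (gen A)).prod = a := by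
  induction a using induction with
  | one => exact ⟨[], rfl⟩
  | mul i a ih =>
    obtain ⟨ω, rfl⟩ := ih
    exact ⟨i :: ω, by simp⟩

/-- The universal property of the Artin–Tits monoid. -/
def lift {N : Type*} [Monoid N] (f : B → N)
    (hf : ∀ i j, ((alternatingWord i j (A i j)).map f).prod =
      ((alternatingWord j i (A i j)).map f).prod) : ArtinMonoid A →* N :=
  PresentedMonoid.lift f (by
    rintro _ _ ⟨i, j, rfl, rfl⟩
    rw [FreeMonoid.lift_ofList, FreeMonoid.lift_ofList]
    exact hf i j)

theorem lift_gen {N : Type*} [Monoid N] (f : B → N)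
    (hf : ∀ i j, ((alternatingWord i j (A i j)).map f).prod =
      ((alternatingWord j i (A i j)).map f).prod) (i : B) : lift f hf (gen A i) = f i := rfl

variable (A) in
/-- The length homomorphism. -/
def lenHom : ArtinMonoid A →* Multiplicative ℕ :=
  lift (fun _ => Multiplicative.ofAdd 1) (by simp [List.map_const'])

/-- The length of an element. -/
def len (a : ArtinMonoid A) : ℕ := (lenHom A a).toAdd

@[simp] theorem len_one : len (1 : ArtinMonoid A) = 0 := rfl

@[simp] theorem len_mul (a b : ArtinMonoid A) : len (a * b) = len a + len b := by
  simp [len]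

@[simp] theorem len_gen (i : B) : len (gen A i) = 1 := rfl

theorem len_prod_map_gen (ω : List B) : len (ω.map (gen A)).prod = ω.length := by
  induction ω with
  | nil => rfl
  | cons i ω ih => simp [ih, add_comm]

theorem len_eq_zero {a : ArtinMonoid A} : len a = 0 ↔ a = 1 := by
  refine ⟨fun h => ?_, fun h => h ▸ len_one⟩
  obtain ⟨ω, rfl⟩ := exists_prod_eq a
  rw [len_prod_map_gen, List.length_eq_zero_iff] at h
  simp [h]

theorem eq_one_of_mul_eq_one {a b : ArtinMonoid A} (h : a * b = 1) : a = 1 := by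
  have := congrArg len h
  rw [len_mul, len_one] at this
  exact len_eq_zero.1 (by lia)

theorem exists_eq_gen_mul {a : ArtinMonoid A} (h : a ≠ 1) : ∃ i b, a = gen A i * b := by
  induction a using induction with
  | one => exact (h rfl).elim
  | mul i a _ => exact ⟨i, a, rfl⟩

theorem len_eq_one {a : ArtinMonoid A} : len a = 1 ↔ ∃ i, a = gen A i := by
  refine ⟨fun h => ?_, fun ⟨i, hi⟩ => hi ▸ len_gen i⟩
  obtain ⟨i, b, rfl⟩ := exists_eq_gen_mul (a := a) (by rintro rfl; simp at h)
  rw [len_mul, len_gen, Nat.add_eq_left, len_eq_zero] at h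
  exact ⟨i, by rw [h, mul_one]⟩

theorem gen_ne_one (i : B) : gen A i ≠ 1 := fun h => by simpa using congrArg len h

theorem isAtomMor_hom_iff_exists {a : ArtinMonoid A} :
    IsAtomMor (OneObj.hom a) ↔ ∃ i, a = gen A i := by
  rw [RibbonGarside.isAtomMor_hom_iff]
  constructor
  · rintro ⟨h1, h⟩
    obtain ⟨i, b, rfl⟩ := exists_eq_gen_mul h1
    refine ⟨i, ?_⟩
    rw [(h _ _ rfl).resolve_left (gen_ne_one i), mul_one]
  · rintro ⟨i, rfl⟩
    refine ⟨gen_ne_one i, fun a b hab => ?_⟩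
    have := congrArg len hab
    rw [len_mul, len_gen] at this
    rw [← len_eq_zero, ← len_eq_zero]
    lia

variable (A) in
/-- The reversal of words, as a homomorphism to the opposite monoid. -/
def revHom : ArtinMonoid A →* (ArtinMonoid A)ᵐᵒᵖ :=
  lift (fun i => MulOpposite.op (gen A i)) (by
    have key : ∀ ω : List B, (ω.map fun i => MulOpposite.op (gen A i)).prod =
        MulOpposite.op (ω.reverse.map (gen A)).prod := fun ω => by
      induction ω with
      | nil => rfl
      | cons i ω ih => simp [ih]
    intro i j
    rw [key, key, alternatingWord_reverse, alternatingWord_reverse]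
    split_ifs
    · rw [gen_braid]
    · rw [gen_braid])

/-- The reversal of words. -/
def rev (a : ArtinMonoid A) : ArtinMonoid A := (revHom A a).unop

@[simp] theorem rev_one : rev (1 : ArtinMonoid A) = 1 := rfl

@[simp] theorem rev_mul (a b : ArtinMonoid A) : rev (a * b) = rev b * rev a := by simp [rev]

@[simp] theorem rev_gen (i : B) : rev (gen A i) = gen A i := rfl

@[simp] theorem rev_rev (a : ArtinMonoid A) : rev (rev a) = a := by
  induction a using induction with
  | one => rfl
  | mul i a ih => simp [ih]

@[simp] theorem len_rev (a : ArtinMonoid A) : len (rev a) = len a := by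
  induction a using induction with
  | one => rfl
  | mul i a ih => simp [ih, add_comm]

/-- The reversal of words, as a permutation. -/
def revEquiv (A : CoxeterMatrix B) : ArtinMonoid A ≃ ArtinMonoid A := ⟨rev, rev, rev_rev, rev_rev⟩

theorem rightDvd_iff_rev {a b : ArtinMonoid A} : RightDvd a b ↔ LeftDvd (rev a) (rev b) := by
  constructor
  · rintro ⟨c, rfl⟩
    exact ⟨rev c, rev_mul _ _⟩
  · rintro ⟨c, hc⟩
    exact ⟨rev c, by rw [← rev_rev b, hc, rev_mul, rev_rev]⟩

theorem leftDvd_iff_rev {a b : ArtinMonoid A} : LeftDvd a b ↔ RightDvd (rev a) (rev b) := by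
  rw [rightDvd_iff_rev, rev_rev, rev_rev]

variable (A) in
/-- The projection to the Coxeter group. -/
def proj : ArtinMonoid A →* A.Group :=
  lift A.toCoxeterSystem.simple fun i j => by
    have := A.toCoxeterSystem.wordProd_braidWord_eq i j
    rw [braidWord, braidWord, A.symmetric j i] at this
    exact this

@[simp] theorem proj_gen (i : B) : proj A (gen A i) = A.toCoxeterSystem.simple i := rfl

theorem proj_prod_map_gen (ω : List B) :
    proj A (ω.map (gen A)).prod = A.toCoxeterSystem.wordProd ω := by
  induction ω with
  | nil => rfl
  | cons i ω ih => rw [List.map_cons, List.prod_cons, map_mul, ih, proj_gen, wordProd_cons]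

theorem gen_injective : Function.Injective (gen A) := fun i j h =>
  A.toCoxeterSystem.simple_injective (by rw [← proj_gen, h, proj_gen])

/-- The canonical lift of an element of the Coxeter group, given by its reduced words. -/
noncomputable def red (w : A.Group) : ArtinMonoid A := A.toCoxeterSystem.reducedLift (gen A) w

theorem red_wordProd {ω : List B} (h : A.toCoxeterSystem.IsReduced ω) :
    red (A.toCoxeterSystem.wordProd ω) = (ω.map (gen A)).prod :=
  reducedLift_wordProd _ _ gen_braid h

theorem red_mul {u v : A.Group} (h : A.toCoxeterSystem.length (u * v) =
    A.toCoxeterSystem.length u + A.toCoxeterSystem.length v) : red (u * v) = red u * red v :=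
  reducedLift_mul _ _ gen_braid h

@[simp] theorem red_one : red (1 : A.Group) = 1 := reducedLift_one _ _ gen_braid

@[simp] theorem red_simple (i : B) : red (A.toCoxeterSystem.simple i) = gen A i :=
  reducedLift_simple _ _ gen_braid i

@[simp] theorem proj_red (w : A.Group) : proj A (red w) = w := by
  obtain ⟨ω, hω, rfl⟩ := A.toCoxeterSystem.exists_isReduced w
  rw [red_wordProd hω, proj_prod_map_gen]

@[simp] theorem len_red (w : A.Group) : len (red w) = A.toCoxeterSystem.length w := by
  obtain ⟨ω, hω, rfl⟩ := A.toCoxeterSystem.exists_isReduced w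
  rw [red_wordProd hω, len_prod_map_gen, hω.eq]

@[simp] theorem rev_red (w : A.Group) : rev (red w) = red w⁻¹ := by
  have key : ∀ ω : List B, rev (ω.map (gen A)).prod = (ω.reverse.map (gen A)).prod := fun ω => by
    induction ω with
    | nil => rfl
    | cons i ω ih => simp [ih]
  obtain ⟨ω, hω, rfl⟩ := A.toCoxeterSystem.exists_isReduced w
  rw [red_wordProd hω, key, ← wordProd_reverse, red_wordProd (by simpa using hω)]

theorem red_of_isPrefix {u w : A.Group} (h : A.toCoxeterSystem.IsPrefix u w) :
    red w = red u * red (u⁻¹ * w) := by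
  rw [← red_mul (by rw [mul_inv_cancel_left]; exact h), mul_inv_cancel_left]

/-- Length in the monoid is additive and agrees with Coxeter length on lifts. Concatenated words for
`a` and `b` thus form a reduced word for `w`, and so do its two parts for their own products. -/
theorem eq_red_of_mul_eq_red {a b : ArtinMonoid A} {w : A.Group} (h : a * b = red w) :
    a = red (proj A a) ∧ b = red (proj A b) ∧ A.toCoxeterSystem.IsPrefix (proj A a) w := by
  obtain ⟨ω, rfl⟩ := exists_prod_eq a
  obtain ⟨ω', rfl⟩ := exists_prod_eq b
  have hw : w = A.toCoxeterSystem.wordProd (ω ++ ω') := by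
    rw [← proj_red w, ← h, map_mul, proj_prod_map_gen, proj_prod_map_gen, wordProd_append]
  have hl : A.toCoxeterSystem.IsReduced (ω ++ ω') := by
    rw [CoxeterSystem.IsReduced, ← hw, ← len_red, ← h, len_mul, len_prod_map_gen, len_prod_map_gen,
      List.length_append]
  have h1 : A.toCoxeterSystem.IsReduced ω := by simpa using hl.take ω.length
  have h2 : A.toCoxeterSystem.IsReduced ω' := by simpa using hl.drop ω.length
  rw [proj_prod_map_gen, proj_prod_map_gen, red_wordProd h1, red_wordProd h2]
  refine ⟨rfl, rfl, ?_⟩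
  rw [hw, wordProd_append, isPrefix_mul, ← wordProd_append, hl.eq, h1.eq, h2.eq, List.length_append]

theorem leftDvd_red_iff {a : ArtinMonoid A} {w : A.Group} :
    LeftDvd a (red w) ↔ ∃ u, a = red u ∧ A.toCoxeterSystem.IsPrefix u w := by
  constructor
  · rintro ⟨b, hb⟩
    obtain ⟨h1, -, h2⟩ := eq_red_of_mul_eq_red hb.symm
    exact ⟨_, h1, h2⟩
  · rintro ⟨u, rfl, hu⟩
    exact ⟨_, red_of_isPrefix hu⟩

/-! ### The longest element and the head of an element -/

variable [Finite A.Group]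

variable (A) in
theorem exists_length_le :
    ∃ w₀ : A.Group, ∀ w, A.toCoxeterSystem.length w ≤ A.toCoxeterSystem.length w₀ :=
  Finite.exists_max _

variable (A) in
/-- The longest element of a finite Coxeter group. -/
noncomputable def longest : A.Group := Classical.choose (exists_length_le A)

variable (A) in
theorem length_le_longest (w : A.Group) :
    A.toCoxeterSystem.length w ≤ A.toCoxeterSystem.length (longest A) :=
  Classical.choose_spec (exists_length_le A) w

/-- The action of an element of the Coxeter group on factored elements of the Artin–Tits monoid. -/
noncomputable def act (w : A.Group) : Function.End (A.Group × ArtinMonoid A) := fun x =>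
  (w * A.toCoxeterSystem.cap w x.1, red ((A.toCoxeterSystem.cap w x.1)⁻¹ * x.1) * x.2)

theorem act_one : act (1 : A.Group) = 1 := by
  funext ⟨v, g⟩
  obtain ⟨⟨h1, -⟩, h2⟩ := cap_spec (length_le_longest A) 1 v
  have h : A.toCoxeterSystem.cap 1 v = v := h1.antisymm (h2 v (IsPrefix.refl v) (by simp))
  rw [act, h, inv_mul_cancel, red_one, one_mul, one_mul]
  rfl

theorem act_mul {u v : A.Group} (h : A.toCoxeterSystem.length (u * v) =
    A.toCoxeterSystem.length u + A.toCoxeterSystem.length v) : act (u * v) = act u * act v := by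
  funext ⟨x, g⟩
  obtain ⟨h1, h2⟩ := cap_mul (length_le_longest A) x h
  obtain ⟨⟨h3, -⟩, -⟩ := cap_spec (length_le_longest A) v x
  change act (u * v) (x, g) = act u (act v (x, g))
  rw [act, act, act]
  simp only
  rw [h1]
  have h4 := h2.length_inv_mul_add h3
  refine Prod.ext (mul_assoc _ _ _) ?_
  simp only
  rw [← mul_assoc, mul_inv_rev, mul_assoc _ v⁻¹, inv_mul_cancel_left, ← red_mul]
  · congr 2
    group
  · rw [← h4]
    congr 1
    group

theorem prod_map_act {ω : List B} (h : A.toCoxeterSystem.IsReduced ω) :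
    (ω.map fun i => act (A.toCoxeterSystem.simple i)).prod =
      act (A.toCoxeterSystem.wordProd ω) := by
  induction ω with
  | nil => simp [act_one]
  | cons i ω ih =>
    have h' : A.toCoxeterSystem.IsReduced ω := h.drop 1
    rw [List.map_cons, List.prod_cons, ih h', wordProd_cons, act_mul]
    rw [← wordProd_cons, h.eq, h'.eq, length_simple, List.length_cons, add_comm]

variable (A) in
/-- The action of the Artin–Tits monoid on its factored elements. -/
noncomputable def actHom : ArtinMonoid A →* Function.End (A.Group × ArtinMonoid A) :=
  lift (fun i => act (A.toCoxeterSystem.simple i)) fun i j => by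
    by_cases hij : i = j
    · rw [hij]
    rw [prod_map_act (isReduced_alternatingWord _ hij (Or.inr le_rfl)),
      prod_map_act (isReduced_alternatingWord _ (Ne.symm hij) (Or.inr (A.symmetric j i).ge))]
    have := A.toCoxeterSystem.wordProd_braidWord_eq i j
    rw [braidWord, braidWord, A.symmetric j i] at this
    rw [this]

theorem actHom_red (w : A.Group) : actHom A (red w) = act w := by
  obtain ⟨ω, hω, rfl⟩ := A.toCoxeterSystem.exists_isReduced w
  rw [red_wordProd hω, ← prod_map_act hω]
  clear hω
  induction ω with
  | nil => simp
  | cons i ω ih =>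
    rw [List.map_cons, List.prod_cons, map_mul, ih, List.map_cons, List.prod_cons]
    rfl

theorem red_mul_act (w : A.Group) (x : A.Group × ArtinMonoid A) :
    red (act w x).1 * (act w x).2 = red w * (red x.1 * x.2) := by
  obtain ⟨⟨h1, h2⟩, -⟩ := cap_spec (length_le_longest A) w x.1
  rw [act, red_mul h2, red_of_isPrefix h1]
  simp only [mul_assoc]

/-- The head and the tail of an element. -/
noncomputable def factorization (a : ArtinMonoid A) : A.Group × ArtinMonoid A := actHom A a (1, 1)

theorem factorization_red_mul (w : A.Group) (a : ArtinMonoid A) :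
    factorization (red w * a) = act w (factorization a) := by
  rw [factorization, map_mul, actHom_red]
  rfl

theorem factorization_mul (a : ArtinMonoid A) :
    red (factorization a).1 * (factorization a).2 = a := by
  induction a using induction with
  | one =>
    rw [factorization, map_one]
    exact (mul_one _).trans red_one
  | mul i a ih => rw [← red_simple, factorization_red_mul, red_mul_act, ih]

/-- By construction the head of `red w * b` is a reduced product starting with `w`; conversely the
head divides the element. So the head is the greatest simple prefix, obtained without prior
knowledge of cancellation. -/
theorem red_leftDvd_iff {w : A.Group} {a : ArtinMonoid A} :
    LeftDvd (red w) a ↔ A.toCoxeterSystem.IsPrefix w (factorization a).1 := by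
  constructor
  · rintro ⟨b, rfl⟩
    obtain ⟨⟨-, h⟩, -⟩ := cap_spec (length_le_longest A) w (factorization b).1
    rw [factorization_red_mul, act, isPrefix_mul, h]
  · intro h
    rw [← factorization_mul a, red_of_isPrefix h, mul_assoc]
    exact ⟨_, rfl⟩

/-- The action of a generator is injective after multiplying out: the new head determines the
absorbed prefix, and the new tail is everything else. -/
theorem left_cancel {a b c : ArtinMonoid A} (h : a * b = a * c) : b = c := by
  induction a using induction with
  | one => simpa using h
  | mul i a ih =>
    apply ih
    rw [mul_assoc, mul_assoc] at h
    generalize a * b = x at h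
    generalize a * c = y at h
    have h' := congrArg factorization h
    rw [← red_simple, factorization_red_mul, factorization_red_mul, act, act, Prod.mk.injEq] at h'
    obtain ⟨h1, h2⟩ := h'
    have h1 := mul_left_cancel h1
    obtain ⟨⟨hx, -⟩, -⟩ := cap_spec (length_le_longest A) (A.toCoxeterSystem.simple i)
      (factorization x).1
    obtain ⟨⟨hy, -⟩, -⟩ := cap_spec (length_le_longest A) (A.toCoxeterSystem.simple i)
      (factorization y).1
    rw [← factorization_mul x, ← factorization_mul y, red_of_isPrefix hx, red_of_isPrefix hy,
      mul_assoc, mul_assoc, h2, h1]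

theorem right_cancel {a b c : ArtinMonoid A} (h : a * c = b * c) : a = b := by
  have := congrArg rev h
  rw [rev_mul, rev_mul] at this
  rw [← rev_rev a, left_cancel this, rev_rev]

end ArtinMonoid

/-! ### The Garside structure of an Artin–Tits monoid of spherical type -/

namespace ArtinMonoid

variable {B : Type*} {A : CoxeterMatrix B}

/-! #### Standard submonoids -/

variable (A) in
/-- The submonoid generated by a set of generators. -/
def standard (I : Set B) : Submonoid (ArtinMonoid A) := Submonoid.closure (gen A '' I)

theorem prod_map_alternatingWord {N : Type*} [CommMonoid N] {f : B → N}
    (hf : ∀ i, f i * f i = f i) (i j : B) (k : ℕ) :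
    ((alternatingWord i j (k + 2)).map f).prod = f i * f j := by
  induction k generalizing i j with
  | zero => simp [alternatingWord]
  | succ k ih =>
    rw [alternatingWord_succ, List.concat_eq_append, List.map_append, List.prod_append, ih]
    simp only [List.map_cons, List.map_nil, List.prod_singleton]
    rw [mul_comm, ← mul_assoc, hf, mul_comm]

open Classical in
/-- The indicator homomorphism of a standard submonoid. -/
noncomputable def indicatorHom (I : Set B) : ArtinMonoid A →* ℕ :=
  lift (fun i => if i ∈ I then 1 else 0) fun i j => by
    by_cases hij : i = j
    · rw [hij]
    -- The entry `0` gives two empty words, and `1` is excluded off the diagonal. Otherwise each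
    -- word contains both letters, and its value in idempotent commuting elements is their product.
    rcases h : A i j with _ | _ | k
    · rfl
    · exact (A.off_diagonal i j hij h).elim
    · rw [prod_map_alternatingWord (by simp), prod_map_alternatingWord (by simp), mul_comm]

theorem indicatorHom_gen {I : Set B} {i : B} : indicatorHom I (gen A i) = 1 ↔ i ∈ I := by
  rw [indicatorHom, lift_gen]
  simp

/-- A product of zeros and ones is `1` only if all factors are. This characterization makes closure
under factors immediate. -/
theorem mem_standard_iff {I : Set B} {a : ArtinMonoid A} :
    a ∈ standard A I ↔ indicatorHom I a = 1 := by
  constructor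
  · intro h
    induction h using Submonoid.closure_induction with
    | mem x hx =>
      obtain ⟨i, hi, rfl⟩ := hx
      exact indicatorHom_gen.2 hi
    | one => exact map_one _
    | mul x y _ _ hx hy => rw [map_mul, hx, hy, mul_one]
  · intro h
    induction a using induction with
    | one => exact one_mem _
    | mul i a ih =>
      rw [map_mul, mul_eq_one] at h
      exact mul_mem (Submonoid.subset_closure ⟨i, indicatorHom_gen.1 h.1, rfl⟩) (ih h.2)

theorem mul_mem_standard_iff {I : Set B} {a b : ArtinMonoid A} :
    a * b ∈ standard A I ↔ a ∈ standard A I ∧ b ∈ standard A I := by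
  rw [mem_standard_iff, mem_standard_iff, mem_standard_iff, map_mul, mul_eq_one]

@[simp] theorem gen_mem_standard_iff {I : Set B} {i : B} : gen A i ∈ standard A I ↔ i ∈ I := by
  rw [mem_standard_iff, indicatorHom_gen]

theorem rev_mem_standard_iff {I : Set B} {a : ArtinMonoid A} :
    rev a ∈ standard A I ↔ a ∈ standard A I := by
  induction a using induction with
  | one => rfl
  | mul i a ih =>
    rw [rev_mul, mul_mem_standard_iff, mul_mem_standard_iff, ih, rev_gen, and_comm]

theorem mem_standard_univ (a : ArtinMonoid A) : a ∈ standard A Set.univ := by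
  induction a using induction with
  | one => exact one_mem _
  | mul i a ih => exact mul_mem_standard_iff.2 ⟨gen_mem_standard_iff.2 trivial, ih⟩

theorem eq_or_eq_of_mem_alternatingWord {i j l : B} {k : ℕ} (h : l ∈ alternatingWord i j k) :
    l = i ∨ l = j := by
  induction k generalizing i j with
  | zero => simp [alternatingWord] at h
  | succ k ih =>
    rw [alternatingWord_succ, List.concat_eq_append, List.mem_append, List.mem_singleton] at h
    rcases h with h | h
    · exact (ih h).symm
    · exact Or.inr h

theorem red_braid_mem_standard {I : Set B} {i j : B} (hij : i ≠ j) (hi : i ∈ I) (hj : j ∈ I) :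
    red (A.toCoxeterSystem.braid i j) ∈ standard A I := by
  rw [braid, red_wordProd (isReduced_alternatingWord _ hij (Or.inr le_rfl))]
  refine Submonoid.list_prod_mem _ fun x hx => ?_
  obtain ⟨l, hl, rfl⟩ := List.mem_map.1 hx
  rw [gen_mem_standard_iff]
  rcases eq_or_eq_of_mem_alternatingWord hl with rfl | rfl
  · exact hi
  · exact hj

theorem rev_pow (a : ArtinMonoid A) (n : ℕ) : rev (a ^ n) = rev a ^ n := by
  induction n with
  | zero => simp
  | succ n ih => rw [pow_succ, rev_mul, ih, pow_succ']

variable [Finite A.Group]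

variable (A) in
-- The elements with lift in the standard submonoid are closed under prefixes. They are also closed
-- under dihedral completion, since a braid element uses only the two letters involved.
theorem exists_standard_longest (I : Set B) :
    ∃ w : A.Group, red w ∈ standard A I ∧
      ∀ u : A.Group, red u ∈ standard A I → A.toCoxeterSystem.IsPrefix u w := by
  have hmul : ∀ {x : A.Group} {i},
      A.toCoxeterSystem.length (x * A.toCoxeterSystem.simple i) = A.toCoxeterSystem.length x + 1 →
      red (x * A.toCoxeterSystem.simple i) ∈ standard A I → red x ∈ standard A I ∧ i ∈ I := by
    intro x i h hx
    rw [red_mul (by rw [h, length_simple]), mul_mem_standard_iff, red_simple,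
      gen_mem_standard_iff] at hx
    exact hx
  refine exists_greatest_isPrefix {w : A.Group | red w ∈ standard A I} ?_ ?_
    (A.toCoxeterSystem.length (longest A)) (fun w _ => length_le_longest A w) ?_
  · change red 1 ∈ standard A I
    rw [red_one]
    exact one_mem _
  · intro y hy x hxy
    change red y ∈ standard A I at hy
    rw [red_of_isPrefix hxy, mul_mem_standard_iff] at hy
    exact hy.1
  · intro x i j hij hi hj hli hlj
    obtain ⟨h0, hb⟩ := length_mul_braid (length_le_longest A) hij hli hlj
    refine ⟨x * A.toCoxeterSystem.braid i j, ?_,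
      isPrefix_mul_braid (length_le_longest A) hij hli hlj, ?_⟩
    · change red _ ∈ standard A I
      rw [red_mul (by rw [hb, length_braid _ hij]), mul_mem_standard_iff]
      exact ⟨(hmul hli hi).1, red_braid_mem_standard hij (hmul hli hi).2 (hmul hlj hj).2⟩
    · rw [braid_comm]
      exact isPrefix_mul_braid (length_le_longest A) hij.symm hlj hli

variable (A) in
/-- The longest element of a standard parabolic subgroup. -/
noncomputable def standardLongest (I : Set B) : A.Group :=
  Classical.choose (exists_standard_longest A I)

variable (A) in
/-- The Garside element of a standard submonoid. -/
noncomputable def delta (I : Set B) : ArtinMonoid A := red (standardLongest A I)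

theorem delta_mem (I : Set B) : delta A I ∈ standard A I :=
  (Classical.choose_spec (exists_standard_longest A I)).1

theorem isPrefix_standardLongest {I : Set B} {u : A.Group} (h : red u ∈ standard A I) :
    A.toCoxeterSystem.IsPrefix u (standardLongest A I) :=
  (Classical.choose_spec (exists_standard_longest A I)).2 u h

theorem red_leftDvd_delta {I : Set B} {u : A.Group} (h : red u ∈ standard A I) :
    LeftDvd (red u) (delta A I) :=
  leftDvd_red_iff.2 ⟨u, rfl, isPrefix_standardLongest h⟩

theorem exists_eq_red_of_leftDvd_delta {I : Set B} {a : ArtinMonoid A}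
    (h : LeftDvd a (delta A I)) : ∃ u, a = red u := by
  obtain ⟨u, hu, -⟩ := leftDvd_red_iff.1 h
  exact ⟨u, hu⟩

/-- Write `Δ_I = s_i u`. As `u` lies in the standard submonoid it is also a prefix, `Δ_I = u t`, and
`t` has length one, so it is some `s_j`. Then `s_i Δ_I = s_i u s_j = Δ_I s_j`. -/
theorem exists_gen_mul_delta {I : Set B} {i : B} (hi : i ∈ I) :
    ∃ j ∈ I, gen A i * delta A I = delta A I * gen A j := by
  have hp : A.toCoxeterSystem.IsPrefix (A.toCoxeterSystem.simple i) (standardLongest A I) :=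
    isPrefix_standardLongest (by rwa [red_simple, gen_mem_standard_iff])
  have e := red_of_isPrefix hp
  set u := (A.toCoxeterSystem.simple i)⁻¹ * standardLongest A I
  change delta A I = _ at e
  rw [red_simple] at e
  have hmem := delta_mem (A := A) I
  rw [e, mul_mem_standard_iff] at hmem
  obtain ⟨t, ht⟩ := red_leftDvd_delta hmem.2
  have hmem' := delta_mem (A := A) I
  rw [ht, mul_mem_standard_iff] at hmem'
  have hl := congrArg len (e.symm.trans ht)
  rw [len_mul, len_mul, len_gen, add_comm, Nat.add_left_cancel_iff, eq_comm, len_eq_one] at hl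
  obtain ⟨j, rfl⟩ := hl
  refine ⟨j, gen_mem_standard_iff.1 hmem'.2, ?_⟩
  nth_rewrite 1 [ht]
  rw [e, mul_assoc]

theorem rev_delta (I : Set B) : rev (delta A I) = delta A I := by
  rw [delta, rev_red]
  congr 1
  refine (isPrefix_standardLongest ?_).eq_of_length_le (length_inv _ _).ge
  rw [← rev_red, rev_mem_standard_iff]
  exact delta_mem I

/-! #### Conjugation of standard submonoids -/

/-- Length additivity forces the conjugate of a generator to be a generator, so conjugation of
standard submonoids is visible on generators. -/
theorem conjugates_standard_iff {I J : Set B} {g : ArtinMonoid A} :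
    Conjugates (standard A I) (standard A J) g ↔
      (∀ i ∈ I, ∃ j ∈ J, gen A i * g = g * gen A j) ∧
        ∀ j ∈ J, ∃ i ∈ I, gen A i * g = g * gen A j := by
  rw [Conjugates.iff_forall (fun _ _ _ => left_cancel) (fun _ _ _ => right_cancel)]
  refine and_congr ⟨fun h i hi => ?_, fun h p hp => ?_⟩ ⟨fun h j hj => ?_, fun h q hq => ?_⟩
  · obtain ⟨q, hq, e⟩ := h _ (gen_mem_standard_iff.2 hi)
    have hl := congrArg len e
    rw [len_mul, len_mul, add_comm, Nat.add_left_cancel_iff, len_gen, eq_comm, len_eq_one] at hl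
    obtain ⟨j, rfl⟩ := hl
    exact ⟨j, gen_mem_standard_iff.1 hq, e⟩
  · induction p using induction with
    | one => exact ⟨1, one_mem _, by simp⟩
    | mul i a ih =>
      rw [mul_mem_standard_iff, gen_mem_standard_iff] at hp
      obtain ⟨j, hj, e⟩ := h i hp.1
      obtain ⟨q, hq, e'⟩ := ih hp.2
      exact ⟨gen A j * q, mul_mem (gen_mem_standard_iff.2 hj) hq,
        by rw [mul_assoc, e', ← mul_assoc, e, mul_assoc]⟩
  · obtain ⟨p, hp, e⟩ := h _ (gen_mem_standard_iff.2 hj)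
    have hl := congrArg len e
    rw [len_mul, len_mul, add_comm, Nat.add_left_cancel_iff, len_gen, len_eq_one] at hl
    obtain ⟨i, rfl⟩ := hl
    exact ⟨i, gen_mem_standard_iff.1 hp, e⟩
  · induction q using induction with
    | one => exact ⟨1, one_mem _, by simp⟩
    | mul j a ih =>
      rw [mul_mem_standard_iff, gen_mem_standard_iff] at hq
      obtain ⟨i, hi, e⟩ := h j hq.1
      obtain ⟨p, hp, e'⟩ := ih hq.2
      exact ⟨gen A i * p, mul_mem (gen_mem_standard_iff.2 hi) hp,
        by rw [mul_assoc, e', ← mul_assoc, e, mul_assoc]⟩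

variable [Finite B]

/-- Right cancellation makes the map of generators injective, and the cardinality bound makes it
onto `J`. -/
theorem exists_eq_gen_mul_of_map {I J : Set B} {g : ArtinMonoid A}
    (h : ∀ i ∈ I, ∃ j ∈ J, gen A i * g = g * gen A j) (hc : J.ncard ≤ I.ncard) {j : B}
    (hj : j ∈ J) : ∃ i ∈ I, gen A i * g = g * gen A j := by
  choose! f hf hf' using h
  have hinj : Set.InjOn f I := fun i hi i' hi' e => by
    have := hf' i hi
    rw [e, ← hf' i' hi'] at this
    exact gen_injective (right_cancel this)
  obtain ⟨i, hi, rfl⟩ : j ∈ f '' I := by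
    rw [Set.eq_of_subset_of_ncard_le (Set.image_subset_iff.2 hf)
      (by rwa [hinj.ncard_image]) (Set.toFinite _)]
    exact hj
  exact ⟨i, hi, hf' i hi⟩

theorem conjugates_delta (I : Set B) :
    Conjugates (standard A I) (standard A I) (delta A I) :=
  conjugates_standard_iff.2 ⟨fun _ hi => exists_gen_mul_delta hi, fun _ hj =>
    exists_eq_gen_mul_of_map (fun _ hi => exists_gen_mul_delta hi) le_rfl hj⟩

theorem exists_mul_delta {I : Set B} {a : ArtinMonoid A} (ha : a ∈ standard A I) :
    ∃ b ∈ standard A I, a * delta A I = delta A I * b := by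
  obtain ⟨φ, hφ⟩ := conjugates_delta (A := A) I
  exact ⟨_, (φ ⟨a, ha⟩).2, hφ ⟨a, ha⟩⟩

theorem leftDvd_delta_pow {I : Set B} {a : ArtinMonoid A} (ha : a ∈ standard A I) {n : ℕ}
    (hn : len a ≤ n) : LeftDvd a (delta A I ^ n) := by
  induction a using induction generalizing n with
  | one => exact LeftDvd.one _
  | mul i a ih =>
    rw [mul_mem_standard_iff] at ha
    rw [len_mul, len_gen] at hn
    obtain ⟨n, rfl⟩ : ∃ m, n = m + 1 := ⟨n - 1, by lia⟩
    obtain ⟨c, hc⟩ := ih ha.2 (n := n) (by lia)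
    obtain ⟨d, hd⟩ : LeftDvd (gen A i) (delta A I) := by
      rw [← red_simple]
      exact red_leftDvd_delta (by rw [red_simple]; exact ha.1)
    have hmem := delta_mem (A := A) I
    rw [hd, mul_mem_standard_iff] at hmem
    have key : ∀ m, ∀ d ∈ standard A I, ∃ e, d * delta A I ^ m = delta A I ^ m * e := by
      intro m
      induction m with
      | zero => exact fun d _ => ⟨d, by simp⟩
      | succ m ih =>
        intro d hd
        obtain ⟨b, hb, e⟩ := exists_mul_delta hd
        obtain ⟨f, hf⟩ := ih b hb
        exact ⟨f, by rw [pow_succ', ← mul_assoc, e, mul_assoc, hf, mul_assoc]⟩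
    obtain ⟨e, he⟩ := key n d hmem.2
    refine ⟨c * e, ?_⟩
    rw [pow_succ']
    nth_rewrite 1 [hd]
    rw [mul_assoc, he, hc]
    simp only [mul_assoc]

theorem rightDvd_delta_pow {I : Set B} {a : ArtinMonoid A} (ha : a ∈ standard A I) {n : ℕ}
    (hn : len a ≤ n) : RightDvd a (delta A I ^ n) := by
  rw [rightDvd_iff_rev, rev_pow, rev_delta]
  exact leftDvd_delta_pow (rev_mem_standard_iff.2 ha) (by rwa [len_rev])

end ArtinMonoid

namespace ArtinMonoid

variable {B : Type*} {A : CoxeterMatrix B}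

/-! #### The lattice of divisors -/

variable (A) in
theorem standard_univ : standard A Set.univ = ⊤ := (Submonoid.eq_top_iff' _).2 mem_standard_univ

theorem noetherian (w : ℕ → ArtinMonoid A) (h : ∀ i, ∃ x y, w i = x * w (i + 1) * y) :
    ∃ N, ∀ i, N ≤ i → w i = w N := by
  obtain ⟨N, hN⟩ : ∃ N, ∀ i, len (w N) ≤ len (w i) := by
    obtain ⟨_, ⟨N, rfl⟩, hN⟩ :=
      wellFounded_lt.has_min (Set.range fun i => len (w i)) ⟨_, 0, rfl⟩
    exact ⟨N, fun i => not_lt.1 (hN _ ⟨i, rfl⟩)⟩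
  refine ⟨N, fun i hi => ?_⟩
  induction i, hi using Nat.le_induction with
  | base => rfl
  | succ i _ ih =>
    obtain ⟨x, y, e⟩ := h i
    have hl := congrArg len e
    rw [len_mul, len_mul, ih] at hl
    have := hN (i + 1)
    rw [len_eq_zero.1 (by lia : len x = 0), len_eq_zero.1 (by lia : len y = 0), one_mul,
      mul_one] at e
    rw [← e, ih]

theorem mem_standard_of_leftDvd {I : Set B} {a b : ArtinMonoid A} (h : LeftDvd a b)
    (hb : b ∈ standard A I) : a ∈ standard A I := by
  obtain ⟨c, rfl⟩ := h
  exact (mul_mem_standard_iff.1 hb).1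

theorem mem_standard_of_rightDvd {I : Set B} {a b : ArtinMonoid A} (h : RightDvd a b)
    (hb : b ∈ standard A I) : a ∈ standard A I := by
  obtain ⟨c, rfl⟩ := h
  exact (mul_mem_standard_iff.1 hb).2

variable [Finite A.Group]

theorem gen_leftDvd_delta {I : Set B} {i : B} (hi : i ∈ I) : LeftDvd (gen A i) (delta A I) := by
  rw [← red_simple]
  exact red_leftDvd_delta (by rwa [red_simple, gen_mem_standard_iff])

theorem artinProd_eq_delta {ω : List B} (h : IsLongestWord A ω) :
    artinProd A ω = delta A Set.univ := by
  rw [← prod_map_gen, ← red_wordProd h.1, delta]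
  congr 1
  refine (isPrefix_standardLongest (mem_standard_univ _)).eq_of_length_le ?_
  rw [h.1.eq]
  exact h.2 _

/-- Both generators are left descents of the head, and a Coxeter element with two such descents
starts with their braid element. -/
theorem red_braid_leftDvd {i j : B} (hij : i ≠ j) {a : ArtinMonoid A} (hi : LeftDvd (gen A i) a)
    (hj : LeftDvd (gen A j) a) : LeftDvd (red (A.toCoxeterSystem.braid i j)) a := by
  have key : ∀ i, LeftDvd (gen A i) a → A.toCoxeterSystem.IsLeftDescent (factorization a).1 i := by
    intro i hi
    rw [← red_simple, red_leftDvd_iff, IsPrefix, length_simple, inv_simple, add_comm] at hi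
    exact (isLeftDescent_iff _).2 hi.symm
  rw [red_leftDvd_iff, isPrefix_iff]
  obtain ⟨-, z, hz, hl⟩ := exists_eq_braid_mul _ hij (key i hi) (key j hj)
  exact ⟨z, hz, by rw [hl, length_braid _ hij]⟩

theorem gen_leftDvd_red_braid {i j : B} (hij : i ≠ j) :
    LeftDvd (gen A i) (red (A.toCoxeterSystem.braid i j)) := by
  rw [← red_simple, leftDvd_red_iff]
  refine ⟨_, rfl, ?_⟩
  have := isPrefix_mul_braid (length_le_longest A) (y := 1) hij
    (by rw [one_mul, length_simple, length_one]) (by rw [one_mul, length_simple, length_one])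
  rwa [one_mul, one_mul] at this

variable (A) in
/-- The positive ribbons from a standard submonoid. -/
def ribbons (I : Set B) : Set (ArtinMonoid A) :=
  {g | ∃ J, Conjugates (standard A I) (standard A J) g}

/-- The target can be taken as the set of generators obtained by conjugating those of `I`: if `g`
divides `s_i g`, the cofactor has length one. In this form the condition visibly respects lcms. -/
theorem mem_ribbons_iff {I : Set B} {g : ArtinMonoid A} :
    g ∈ ribbons A I ↔ ∀ i ∈ I, LeftDvd g (gen A i * g) := by
  constructor
  · rintro ⟨J, hJ⟩ i hi
    obtain ⟨j, -, e⟩ := (conjugates_standard_iff.1 hJ).1 i hi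
    exact ⟨_, e⟩
  · intro h
    refine ⟨{j | ∃ i ∈ I, gen A i * g = g * gen A j}, conjugates_standard_iff.2
      ⟨fun i hi => ?_, fun j hj => hj⟩⟩
    obtain ⟨x, e⟩ := h i hi
    have hl := congrArg len e
    rw [len_mul, len_mul, add_comm, Nat.add_left_cancel_iff, len_gen, eq_comm, len_eq_one] at hl
    obtain ⟨j, rfl⟩ := hl
    exact ⟨j, ⟨i, hi, e⟩, e⟩

theorem join_mem_ribbons {I : Set B} {g h m : ArtinMonoid A} (hg : g ∈ ribbons A I)
    (hh : h ∈ ribbons A I) (hm : IsJoin LeftDvd g h m) : m ∈ ribbons A I := by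
  rw [mem_ribbons_iff] at *
  exact fun i hi => hm.2.2 _ ((hg i hi).trans (hm.1.mul_left _)) ((hh i hi).trans (hm.2.1.mul_left _))

theorem conjugates_rev {I J : Set B} {g : ArtinMonoid A}
    (h : Conjugates (standard A I) (standard A J) g) :
    Conjugates (standard A J) (standard A I) (rev g) := by
  rw [conjugates_standard_iff] at *
  have key : ∀ i j, gen A i * g = g * gen A j → gen A j * rev g = rev g * gen A i := fun i j e => by
    rw [← rev_gen j, ← rev_mul, ← e, rev_mul, rev_gen]
  constructor
  · intro j hj
    obtain ⟨i, hi, e⟩ := h.2 j hj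
    exact ⟨i, hi, key i j e⟩
  · intro i hi
    obtain ⟨j, hj, e⟩ := h.1 i hi
    exact ⟨j, hj, key i j e⟩

variable [Finite B]

/-- Here the general construction is used with a single object: the prefixes are generators, whose
joins are braid elements, and common multiples are powers of `Δ`. -/
theorem leftDvd_isLatticeOrder : IsLatticeOrder (LeftDvd (M := ArtinMonoid A)) := by
  let R : TypedElements (ArtinMonoid A) Unit :=
    ⟨fun _ _ _ => True, fun _ => trivial, fun _ _ => trivial, fun _ _ => trivial⟩
  have hR : ∀ a, a ∈ R.outs () := fun a => ⟨(), trivial⟩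
  refine IsLatticeOrder.of_equiv (β := R.outs ())
    ⟨fun a => ⟨a, hR a⟩, fun a => a.1, fun _ => rfl, fun _ => rfl⟩ (fun a b => Iff.rfl)
    (TypedElements.isLatticeOrder_outs (fun _ _ _ => left_cancel) ?_ ?_
      (fun _ _ => eq_one_of_mul_eq_one) ?_ ())
  · refine Subrelation.wf ?_ (measure len).wf
    rintro a _ ⟨x, hx, rfl⟩
    have : len x ≠ 0 := fun h => hx (len_eq_zero.1 h)
    change len a < len (x * a)
    rw [len_mul]
    lia
  · intro _ a _ b _ k _ ha hb hak hbk
    obtain ⟨i, a', rfl⟩ := exists_eq_gen_mul ha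
    obtain ⟨j, b', rfl⟩ := exists_eq_gen_mul hb
    refine ⟨gen A i, hR _, gen A j, hR _, gen_ne_one i, gen_ne_one j, LeftDvd.mul_right _ _,
      LeftDvd.mul_right _ _, ?_⟩
    by_cases hij : i = j
    · subst hij
      exact ⟨gen A i, hR _, LeftDvd.refl _, LeftDvd.refl _, fun c _ h _ => h⟩
    · refine ⟨_, hR _, gen_leftDvd_red_braid hij, ?_, fun c _ h h' => red_braid_leftDvd hij h h'⟩
      rw [braid_comm]
      exact gen_leftDvd_red_braid (Ne.symm hij)
  · intro _ a _ b _
    exact ⟨delta A Set.univ ^ (len a + len b), hR _,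
      leftDvd_delta_pow (mem_standard_univ a) (by lia),
      leftDvd_delta_pow (mem_standard_univ b) (by lia)⟩

theorem rightDvd_isLatticeOrder : IsLatticeOrder (RightDvd (M := ArtinMonoid A)) :=
  leftDvd_isLatticeOrder.of_equiv (revEquiv A) fun _ _ => rightDvd_iff_rev

variable (A) in
theorem exists_isGarsideElement :
    ∃ φ : ArtinMonoid A ≃* ArtinMonoid A, IsGarsideElement (delta A Set.univ) φ := by
  have hc := conjugates_delta (A := A) Set.univ
  rw [standard_univ] at hc
  obtain ⟨φ, hφ⟩ := hc
  exact ⟨Submonoid.topEquiv.symm.trans (φ.trans Submonoid.topEquiv),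
    { mul_eq := fun a => hφ ⟨a, trivial⟩
      left_cancel := fun _ _ _ => left_cancel
      right_cancel := fun _ _ _ => right_cancel
      noetherian := noetherian
      left_lattice := leftDvd_isLatticeOrder
      right_lattice := rightDvd_isLatticeOrder
      atom_dvd := by
        rintro ⟨s, hs⟩
        obtain ⟨i, rfl⟩ := isAtomMor_hom_iff_exists.1 hs
        exact gen_leftDvd_delta (Set.mem_univ i) }⟩

/-! #### Parabolic submonoids are the standard submonoids -/

variable (A) in
-- Closure under factors gives everything except joins. For those, both elements divide a power of
-- `Δ_I`, so their join is a factor of an element of the submonoid.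
theorem isParabolic_standard (I : Set B) : IsParabolic (delta A Set.univ) (standard A I) where
  left_join a ha b hb m hm :=
    mem_standard_of_leftDvd (hm.2.2 (delta A I ^ (len a + len b))
      (leftDvd_delta_pow ha (by lia)) (leftDvd_delta_pow hb (by lia))) (pow_mem (delta_mem I) _)
  left_meet a ha b _ m hm := mem_standard_of_leftDvd hm.1 ha
  right_join a ha b hb m hm :=
    mem_standard_of_rightDvd (hm.2.2 (delta A I ^ (len a + len b))
      (rightDvd_delta_pow ha (by lia)) (rightDvd_delta_pow hb (by lia))) (pow_mem (delta_mem I) _)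
  right_meet a ha b _ m hm := mem_standard_of_rightDvd hm.1 ha
  exists_garside := by
    refine ⟨delta A I, conjugates_delta I, ?_, ?_⟩
    · ext g
      constructor
      · intro hg
        refine ⟨?_, mem_standard_of_leftDvd hg (delta_mem I)⟩
        obtain ⟨u, rfl⟩ := exists_eq_red_of_leftDvd_delta hg
        exact red_leftDvd_delta (mem_standard_univ _)
      · rintro ⟨hg, hgI⟩
        obtain ⟨u, rfl⟩ := exists_eq_red_of_leftDvd_delta hg
        exact red_leftDvd_delta hgI
    · ext g
      constructor
      · rintro ⟨hg, hgI⟩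
        exact ⟨g, hgI, hg, LeftDvd.refl g, fun c _ h => h⟩
      · rintro ⟨p, hp, hg⟩
        exact ⟨hg.1, mem_standard_of_leftDvd hg.2.1 hp⟩

/-- Closure of a parabolic submonoid under factors means that it is generated by the generators that
it contains. -/
theorem exists_eq_standard {P : Submonoid (ArtinMonoid A)}
    (hP : IsParabolic (delta A Set.univ) P) : ∃ I, P = standard A I := by
  obtain ⟨φ, h⟩ := exists_isGarsideElement A
  refine ⟨{i | gen A i ∈ P}, le_antisymm (fun a ha => ?_) ?_⟩
  · induction a using induction with
    | one => exact one_mem _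
    | mul i a ih =>
      obtain ⟨h1, h2⟩ := h.mem_of_mul_mem hP ha
      exact mul_mem (gen_mem_standard_iff.2 h1) (ih h2)
  · rw [standard, Submonoid.closure_le]
    rintro _ ⟨i, hi, rfl⟩
    exact hi

/-! #### Ribbons and the `ν`-structure -/

/-- The gcd of `s g` and `s h` has the form `s e` with `e` dividing both `g` and `h`, hence their
gcd `m`. Since `m` divides `s g` and `s h`, it divides `s e`, and so `s m`. -/
theorem meet_mem_ribbons {I : Set B} {g h m : ArtinMonoid A} (hg : g ∈ ribbons A I)
    (hh : h ∈ ribbons A I) (hm : IsMeet LeftDvd g h m) : m ∈ ribbons A I := by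
  rw [mem_ribbons_iff] at *
  intro i hi
  obtain ⟨e, he1, he2, he3⟩ := (leftDvd_isLatticeOrder.2.2.2 (gen A i * g) (gen A i * h)).2
  have h1 : LeftDvd m e := he3 m (hm.1.trans (hg i hi)) (hm.2.1.trans (hh i hi))
  obtain ⟨e, rfl⟩ := he3 (gen A i) (LeftDvd.mul_right _ _) (LeftDvd.mul_right _ _)
  exact h1.trans ((hm.2.2 e (he1.of_mul_left fun _ _ _ => left_cancel)
    (he2.of_mul_left fun _ _ _ => left_cancel)).mul_left _)

/-- Stability under gcds gives a least ribbon `g₀` divisible by the generator. A shortest nontrivial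
ribbon prefix `n` of `g₀` is irreducible and divides every ribbon that `g₀` divides; divisibility of
`n` itself by the generator is neither required nor shown. -/
theorem exists_nu (I : Set B) (i : B) :
    ∃ n ∈ ribbons A I, n ≠ 1 ∧ (∀ g ∈ ribbons A I, LeftDvd (gen A i) g → LeftDvd n g) ∧
      ∀ a b, a * b = n → a ∈ ribbons A I → a = 1 ∨ b = 1 := by
  have hΔ : delta A Set.univ ∈ ribbons A I := mem_ribbons_iff.2 fun i _ => by
    obtain ⟨j, -, e⟩ := exists_gen_mul_delta (A := A) (Set.mem_univ i)
    exact ⟨_, e⟩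
  obtain ⟨g₀, ⟨hg₀, hig₀⟩, hmin⟩ := (measure (len (A := A))).wf.has_min
    {g | g ∈ ribbons A I ∧ LeftDvd (gen A i) g} ⟨_, hΔ, gen_leftDvd_delta (Set.mem_univ i)⟩
  have hdvd : ∀ g ∈ ribbons A I, LeftDvd (gen A i) g → LeftDvd g₀ g := by
    intro g hg hig
    obtain ⟨d, hd⟩ := (leftDvd_isLatticeOrder.2.2.2 g₀ g).2
    have h1 : ¬ len d < len g₀ := hmin d ⟨meet_mem_ribbons hg₀ hg hd, hd.2.2 _ hig₀ hig⟩
    obtain ⟨x, hx⟩ := hd.1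
    have h2 := congrArg len hx
    rw [len_mul] at h2
    rw [len_eq_zero.1 (by lia : len x = 0), mul_one] at hx
    rw [hx]
    exact hd.2.1
  have hg₀1 : g₀ ≠ 1 := by
    rintro rfl
    obtain ⟨c, hc⟩ := hig₀
    exact gen_ne_one i (eq_one_of_mul_eq_one hc.symm)
  obtain ⟨n, ⟨hn, hn1, hng₀⟩, hmin'⟩ := (measure (len (A := A))).wf.has_min
    {n | n ∈ ribbons A I ∧ n ≠ 1 ∧ LeftDvd n g₀} ⟨g₀, hg₀, hg₀1, LeftDvd.refl _⟩
  refine ⟨n, hn, hn1, fun g hg hig => hng₀.trans (hdvd g hg hig), fun a b hab ha => ?_⟩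
  rw [or_iff_not_imp_left]
  intro ha1
  have h1 : ¬ len a < len n := hmin' a ⟨ha, ha1, LeftDvd.trans ⟨b, hab.symm⟩ hng₀⟩
  rw [← hab, len_mul] at h1
  exact len_eq_zero.1 (by lia)

variable (A) in
theorem hasNuFunction : HasNuFunction (delta A Set.univ) := by
  intro P
  obtain ⟨I, hI⟩ := exists_eq_standard P.property
  have hrib : ∀ {Q : PositiveRibbon (delta A Set.univ)} (f : P ⟶ Q),
      PositiveRibbon.elt f ∈ ribbons A I := by
    intro Q f
    obtain ⟨J, hJ⟩ := exists_eq_standard Q.property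
    have := PositiveRibbon.conj f
    rw [hI, hJ] at this
    exact ⟨J, this⟩
  have hmor : ∀ g ∈ ribbons A I, ∃ f : MorFrom P, PositiveRibbon.elt f.2 = g := by
    rintro g ⟨J, hJ⟩
    exact ⟨⟨⟨⟨standard A J⟩, isParabolic_standard A J⟩, PositiveRibbon.mkHom g (by rwa [hI])⟩, rfl⟩
  have hid := fun {Q R} (f : Q ⟶ R) => PositiveRibbon.isIdentity_iff (Δ := delta A Set.univ)
    (fun _ _ _ => left_cancel) f
  have hnu : ∀ s : Atoms (ArtinMonoid A), ∃ f : MorFrom P, IsAtomMor f.2 ∧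
      ∀ g : MorFrom P, LeftDvd s.1 (PositiveRibbon.elt g.2) →
        LeftDvd (PositiveRibbon.elt f.2) (PositiveRibbon.elt g.2) := by
    rintro ⟨s, hs⟩
    obtain ⟨i, rfl⟩ := isAtomMor_hom_iff_exists.1 hs
    obtain ⟨n, hn, hn1, hdvd, hat⟩ := exists_nu (A := A) I i
    obtain ⟨f, rfl⟩ := hmor n hn
    refine ⟨f, ⟨fun h => hn1 ((hid _).1 h), fun Q g h e => ?_⟩, fun g => hdvd _ (hrib g.2)⟩
    rw [hid, hid]
    exact hat _ _ (by rw [← e]; rfl) (hrib g)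
  choose ν h1 h2 using hnu
  exact ⟨ν, h1, h2, fun s t m hm => hmor m (join_mem_ribbons (hrib _) (hrib _) hm)⟩

variable (A) in
theorem hasNuTildeFunction : HasNuTildeFunction (delta A Set.univ) := by
  intro P
  obtain ⟨I, hI⟩ := exists_eq_standard P.property
  have hrib : ∀ {Q : PositiveRibbon (delta A Set.univ)} (f : Q ⟶ P),
      rev (PositiveRibbon.elt f) ∈ ribbons A I := by
    intro Q f
    obtain ⟨J, hJ⟩ := exists_eq_standard Q.property
    have := PositiveRibbon.conj f
    rw [hI, hJ] at this
    exact ⟨J, conjugates_rev this⟩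
  have hmor : ∀ g, rev g ∈ ribbons A I → ∃ f : MorTo P, PositiveRibbon.elt f.2 = g := by
    rintro g ⟨J, hJ⟩
    have := conjugates_rev hJ
    rw [rev_rev] at this
    exact ⟨⟨⟨⟨standard A J⟩, isParabolic_standard A J⟩, PositiveRibbon.mkHom g (by rwa [hI])⟩, rfl⟩
  have hid := fun {Q R} (f : Q ⟶ R) => PositiveRibbon.isIdentity_iff (Δ := delta A Set.univ)
    (fun _ _ _ => left_cancel) f
  have hnu : ∀ s : Atoms (ArtinMonoid A), ∃ f : MorTo P, IsAtomMor f.2 ∧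
      ∀ g : MorTo P, RightDvd s.1 (PositiveRibbon.elt g.2) →
        RightDvd (PositiveRibbon.elt f.2) (PositiveRibbon.elt g.2) := by
    rintro ⟨s, hs⟩
    obtain ⟨i, rfl⟩ := isAtomMor_hom_iff_exists.1 hs
    obtain ⟨n, hn, hn1, hdvd, hat⟩ := exists_nu (A := A) I i
    rw [← rev_rev n] at hn
    obtain ⟨f, hf⟩ := hmor _ hn
    obtain rfl : n = rev (PositiveRibbon.elt f.2) := by rw [hf, rev_rev]
    refine ⟨f, ⟨fun h => hn1 ?_, fun Q g h e => ?_⟩, fun g hg => ?_⟩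
    · rw [(hid _).1 h, rev_one]
    · have := hat (rev (PositiveRibbon.elt h)) (rev (PositiveRibbon.elt g))
        (by rw [← rev_mul, ← e]; rfl) (hrib h)
      rw [hid, hid, ← rev_rev (PositiveRibbon.elt g), ← rev_rev (PositiveRibbon.elt h)]
      exact this.symm.imp (fun h => by rw [h, rev_one]) fun h => by rw [h, rev_one]
    · rw [rightDvd_iff_rev] at hg ⊢
      exact hdvd _ (hrib g.2) hg
  choose ν h1 h2 using hnu
  refine ⟨ν, h1, h2, fun s t m hm => hmor m (join_mem_ribbons (hrib (ν s).2) (hrib (ν t).2)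
    ⟨rightDvd_iff_rev.1 hm.1, rightDvd_iff_rev.1 hm.2.1, fun c h h' => ?_⟩)⟩
  rw [leftDvd_iff_rev, rev_rev] at h h' ⊢
  exact hm.2.2 _ h h'

end ArtinMonoid

/-! ### Artin–Tits groups are the groups of formal inverses of Artin–Tits monoids -/

/-- The universal properties of the three presentations give inverse homomorphisms, compared on
generators. -/
theorem exists_artinGroup_mulEquiv {B : Type*} (A : CoxeterMatrix B) :
    ∃ e : ArtinGroup A ≃* FormalGroup (ArtinMonoid A), ∀ i : B, e (PresentedGroup.of i) =
      toFormal (ArtinMonoid A) (PresentedMonoid.of (braidRels A) i) := by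
  have hf : ∀ i j, ((alternatingWord i j (A i j)).map
      (PresentedGroup.of : B → ArtinGroup A)).prod =
        ((alternatingWord j i (A i j)).map (PresentedGroup.of : B → ArtinGroup A)).prod := by
    intro i j
    have h := PresentedGroup.one_of_mem (rels := {r : FreeGroup B | ∃ i j : B,
      r = ((alternatingWord i j (A i j)).map FreeGroup.of).prod *
        ((alternatingWord j i (A i j)).map FreeGroup.of).prod⁻¹}) ⟨i, j, rfl⟩
    rw [map_mul, map_inv, mul_inv_eq_one, map_list_prod, map_list_prod, List.map_map,
      List.map_map] at h
    exact h
  let ψ₀ : ArtinMonoid A →* ArtinGroup A := ArtinMonoid.lift PresentedGroup.of hf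
  let ψ : FormalGroup (ArtinMonoid A) →* ArtinGroup A := PresentedGroup.toGroup (f := ψ₀) (by
    rintro _ ⟨a, b, rfl⟩
    simp)
  let f : B → FormalGroup (ArtinMonoid A) := fun i =>
    toFormal (ArtinMonoid A) (ArtinMonoid.gen A i)
  let φ : ArtinGroup A →* FormalGroup (ArtinMonoid A) := PresentedGroup.toGroup (f := f) (by
    rintro _ ⟨i, j, rfl⟩
    rw [map_mul, map_inv, mul_inv_eq_one, map_list_prod, map_list_prod, List.map_map,
      List.map_map]
    have h := congrArg (toFormal (ArtinMonoid A)) (ArtinMonoid.gen_braid i j)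
    rw [map_list_prod, map_list_prod, List.map_map, List.map_map] at h
    simpa [Function.comp_def, f] using h)
  have hφ : ∀ i, φ (PresentedGroup.of i) = f i := fun i => PresentedGroup.toGroup.of _
  have hψ : ∀ a, ψ (toFormal _ a) = ψ₀ a := fun a => PresentedGroup.toGroup.of _
  have h1 : ∀ a, φ (ψ₀ a) = toFormal _ a := fun a =>
    DFunLike.congr_fun (PresentedMonoid.ext (φ := φ.comp ψ₀) (ψ := toFormal _) _ hφ) a
  refine ⟨MonoidHom.toMulEquiv φ ψ ?_ ?_, hφ⟩
  · refine PresentedGroup.ext fun i => ?_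
    change ψ (φ (PresentedGroup.of i)) = PresentedGroup.of i
    rw [hφ]
    exact hψ _
  · refine PresentedGroup.ext fun a => ?_
    change φ (ψ (toFormal _ a)) = toFormal _ a
    rw [hψ, h1]

end RibbonGarside

theorem theorem1p1 :
    (∀ (M : Type*) [Monoid M] (Δ : M),
      RibbonGarside.IsGarsideMonoid M Δ → RibbonGarside.HasNuStructure Δ →
        RibbonGarside.PositiveRibbonIsGarside Δ ∧
        RibbonGarside.RibbonGroupoidIsFormalInverses Δ) ∧
    (∀ (B : Type*) [Finite B] (A : CoxeterMatrix B) [Finite A.Group],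
      ∃ Δ : RibbonGarside.ArtinMonoid A,
        (∀ ω : List B, RibbonGarside.IsLongestWord A ω → RibbonGarside.artinProd A ω = Δ) ∧
        RibbonGarside.IsGarsideMonoid (RibbonGarside.ArtinMonoid A) Δ ∧
        (∃ e : RibbonGarside.ArtinGroup A ≃*
            RibbonGarside.FormalGroup (RibbonGarside.ArtinMonoid A),
          ∀ i : B, e (PresentedGroup.of i) =
            RibbonGarside.toFormal (RibbonGarside.ArtinMonoid A)
              (PresentedMonoid.of (RibbonGarside.braidRels A) i)) ∧
        RibbonGarside.HasNuStructure Δ ∧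
        RibbonGarside.PositiveRibbonIsGarside Δ ∧
        RibbonGarside.RibbonGroupoidIsFormalInverses Δ) := by
  refine ⟨fun M _ Δ h hν => ?_, fun B _ A _ => ?_⟩
  · obtain ⟨φ, hφ⟩ := h.exists_isGarsideElement
    exact ⟨hφ.positiveRibbonIsGarside hν, hφ.ribbonGroupoidIsFormalInverses⟩
  · obtain ⟨φ, hφ⟩ := RibbonGarside.ArtinMonoid.exists_isGarsideElement A
    have hν : RibbonGarside.HasNuStructure (RibbonGarside.ArtinMonoid.delta A Set.univ) :=
      ⟨RibbonGarside.ArtinMonoid.hasNuFunction A, RibbonGarside.ArtinMonoid.hasNuTildeFunction A⟩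
    exact ⟨RibbonGarside.ArtinMonoid.delta A Set.univ,
      fun ω hω => RibbonGarside.ArtinMonoid.artinProd_eq_delta hω, hφ.isGarsideMonoid,
      RibbonGarside.exists_artinGroup_mulEquiv A, hν, hφ.positiveRibbonIsGarside hν,
      hφ.ribbonGroupoidIsFormalInverses⟩
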